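/- Let $\mathcal S,\mathcal A,\mathcal B,\mathcal E$ be finite alphabets, $Q_S$ a distribution on $\mathcal S$ (the state law), $W_{BE|AS}$ a state-dependent memoryless channel with receiver output $B$ and warden output $E$, and $P_0$ a distribution on $\mathcal A$, the law of the input symbol when there is no communication (a point mass if there is an innocent symbol). Put $Q_0(e)=\sum_{s,a,b}Q_S(s)P_0(a)W(b,e|a,s)$. Assume that the warden's channel is degraded with respect to the receiver's, i.e. $W(b,e|a,s)=W_B(b|a,s)\,V(e|b)$ for some channel $V$. A code of length $n$ with $\lfloor 2^{nR}\rfloor$ messages and $\lfloor 2^{nR_K}\rfloor$ keys consists of a stochastic encoder, which maps the message $M$ and the state sequence $S^n$ to an input sequence $A^n$ and a key $K$, and a stochastic decoder, which maps $(B^n,S^n)$ to estimates $(\hat M,\hat K)$; here $M$ is uniform and independent of $S^n$, and $S^n$ is i.i.d. $\sim Q_S$. A pair $(R,R_K)$ with $R,R_K\ge 0$ is achievable if there is a sequence of such codes, $n\to\infty$, with $\mathbb P\{(M,K)\neq(\hat M,\hat K)\}\to0$, with the total variation distance between $P_{KE^n}$ and (uniform law on the keys) $\otimes\, Q_0^{\otimes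 n}$ tending to $0$, and with the total variation distance between $P_{MK}$ and the uniform law on pairs of a message and a key tending to $0$. The covert-message/covert-key capacity region $\mathcal C_{\rm CC\text{-}CSK}$ is the closure of the set of achievable pairs. Let $\mathcal D$ be the set of all distributions $P_{SUABE}=Q_S P_{U|S}P_{A|US}W_{BE|AS}$, with $U$ in an arbitrary finite alphabet, such that $P_E=Q_0$. Assume that, if some $P\in\mathcal D$ has $I(U;B|S)>0$, then some $P\in\mathcal D$ has $I(U;B|E,S)+H(S|E)>0$ (this holds, for instance, if the state is not a function of the warden's output when there is no communication). Then $\mathcal C_{\rm CC\text{-}CSK}$ is the set of all $(R,R_K)$ with $R,R_K\ge0$ for which there is a $P_{SUABE}\in\mathcal D$ with $$R\le I(U;B|S),\qquad R_K\le I(U;B|E,S)+H(S|E),\qquad R+R_K\le I(U;B|S)+H(S).$$ All entropies are in bits. -/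

import Mathlib

namespace CovertKey

/-! Probability distributions on finite alphabets are real functions lying in Mathlib's
`stdSimplex ℝ α`, that is, nonnegative functions with total sum one. -/

open Classical in
/-- The distribution of the random variable `X` when the outcome is distributed as `p`. -/
noncomputable def marginal {Ω α : Type*} [Fintype Ω] (p : Ω → ℝ) (X : Ω → α) : α → ℝ :=
  fun x => ∑ ω, if X ω = x then p ω else 0

/-- The Shannon entropy `H(X)` in bits. -/
noncomputable def entropy {Ω α : Type*} [Fintype Ω] [Fintype α] (p : Ω → ℝ) (X : Ω → α) : ℝ :=
  ∑ x, Real.negMulLog (marginal p X x) / Real.log 2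

/-- The conditional entropy `H(X | Y) = H(X, Y) - H(Y)` in bits. -/
noncomputable def condEntropy {Ω α β : Type*} [Fintype Ω] [Fintype α] [Fintype β]
    (p : Ω → ℝ) (X : Ω → α) (Y : Ω → β) : ℝ :=
  entropy p (fun ω => (X ω, Y ω)) - entropy p Y

/-- The conditional mutual information `I(X ; Y | Z) = H(X | Z) - H(X | Y, Z)` in bits. -/
noncomputable def condMutualInfo {Ω α β γ : Type*} [Fintype Ω] [Fintype α] [Fintype β]
    [Fintype γ] (p : Ω → ℝ) (X : Ω → α) (Y : Ω → β) (Z : Ω → γ) : ℝ :=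
  condEntropy p X Z - condEntropy p X (fun ω => (Y ω, Z ω))

/-- The total variation distance `1/2 ∑ |p - q|`. -/
noncomputable def tvDist {α : Type*} [Fintype α] (p q : α → ℝ) : ℝ :=
  (1 / 2) * ∑ x, |p x - q x|

/-- A classical state-dependent memoryless channel with one input (alphabet `A`), a state
(alphabet `S`), an output for the receiver (alphabet `B`) and one for the warden (alphabet `E`),
together with the law of the state and the distribution of the input symbol when no
communication takes place (a point mass if there is an innocent symbol). -/
structure StateChannel (S A B E : Type*) [Fintype S] [Fintype A] [Fintype B] [Fintype E] where
  /-- the state law `Q_S` -/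
  stateLaw : S → ℝ
  stateLaw_mem : stateLaw ∈ stdSimplex ℝ S
  /-- the innocent input distribution -/
  innocent : A → ℝ
  innocent_mem : innocent ∈ stdSimplex ℝ A
  /-- `trans a s (b, e)` is `W(b, e | a, s)` -/
  trans : A → S → B × E → ℝ
  trans_mem : ∀ a s, trans a s ∈ stdSimplex ℝ (B × E)

section

variable {S A B E : Type*} [Fintype S] [Fintype A] [Fintype B] [Fintype E]

/-- The distribution `Q_0` of one output symbol of the warden when no communication takes
place. -/
noncomputable def StateChannel.wardenIdle (ch : StateChannel S A B E) : E → ℝ :=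
  fun e => ∑ s, ∑ a, ∑ b, ch.stateLaw s * ch.innocent a * ch.trans a s (b, e)

/-- The warden's channel is (physically) degraded with respect to the receiver's channel:
`W(b, e | a, s) = W_B(b | a, s) V(e | b)`. -/
def StateChannel.IsDegraded (ch : StateChannel S A B E) : Prop :=
  ∃ V : B → E → ℝ, (∀ b, V b ∈ stdSimplex ℝ E) ∧
    ∀ a s b e, ch.trans a s (b, e) = (∑ e', ch.trans a s (b, e')) * V b e

/-- `ch.IsAdmissible P` says that the joint distribution `P` of `(S, U, A, B, E)`
factorizes as `Q_S P_{U|S} P_{A|US} W_{BE|AS}` and that its `E`-marginal is `Q_0`. -/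
def StateChannel.IsAdmissible (ch : StateChannel S A B E) {U : Type*} [Fintype U]
    (P : S × U × A × B × E → ℝ) : Prop :=
  (∃ (PU : S → U → ℝ) (PA : U → S → A → ℝ),
    (∀ s, PU s ∈ stdSimplex ℝ U) ∧ (∀ u s, PA u s ∈ stdSimplex ℝ A) ∧
    ∀ s u a b e, P (s, u, a, b, e) =
      ch.stateLaw s * PU s u * PA u s a * ch.trans a s (b, e)) ∧
  marginal P (fun (_, _, _, _, e) => e) = ch.wardenIdle

/-- `I(U ; B | S)` under the joint distribution `P` of `(S, U, A, B, E)`. -/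
noncomputable def infoUB_S {U : Type*} [Fintype U] (P : S × U × A × B × E → ℝ) : ℝ :=
  condMutualInfo P (fun (_, u, _, _, _) => u) (fun (_, _, _, b, _) => b)
    (fun (s, _, _, _, _) => s)

/-- `I(U ; B | E, S)` under the joint distribution `P` of `(S, U, A, B, E)`. -/
noncomputable def infoUB_ES {U : Type*} [Fintype U] (P : S × U × A × B × E → ℝ) : ℝ :=
  condMutualInfo P (fun (_, u, _, _, _) => u) (fun (_, _, _, b, _) => b)
    (fun (s, _, _, _, e) => (e, s))

/-- `H(S | E)` under the joint distribution `P` of `(S, U, A, B, E)`. -/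
noncomputable def entropyS_E {U : Type*} [Fintype U] (P : S × U × A × B × E → ℝ) : ℝ :=
  condEntropy P (fun (s, _, _, _, _) => s) (fun (_, _, _, _, e) => e)

/-- `H(S)` under the joint distribution `P` of `(S, U, A, B, E)`. -/
noncomputable def entropyS {U : Type*} [Fintype U] (P : S × U × A × B × E → ℝ) : ℝ :=
  entropy P (fun (s, _, _, _, _) => s)

end

/-- A code of block length `n` with `M` messages and `K` keys, the state being known
noncausally at both ends: a stochastic encoder, which maps the message and the whole state
sequence to the channel input sequence and a key, and a stochastic decoder, which maps the
receiver's whole output sequence and the whole state sequence to estimates of the message and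
of the key. -/
structure Code (S A B : Type*) [Fintype A] (n M K : ℕ) where
  enc : Fin M → (Fin n → S) → (Fin n → A) × Fin K → ℝ
  enc_mem : ∀ m s, enc m s ∈ stdSimplex ℝ ((Fin n → A) × Fin K)
  dec : (Fin n → B) → (Fin n → S) → Fin M × Fin K → ℝ
  dec_mem : ∀ b s, dec b s ∈ stdSimplex ℝ (Fin M × Fin K)

section

variable {S A B E : Type*} [Fintype S] [Fintype A] [Fintype B] [Fintype E] {n M K : ℕ}

/-- The joint distribution of `(M, Sⁿ, Aⁿ, K, Bⁿ, Eⁿ, M̂, K̂)` induced by a code: the message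
is uniform and independent of the state sequence, which is i.i.d., and the channel is
memoryless. -/
noncomputable def Code.law (c : Code S A B n M K) (ch : StateChannel S A B E) :
    Fin M × (Fin n → S) × (Fin n → A) × Fin K × (Fin n → B) × (Fin n → E) × Fin M × Fin K → ℝ :=
  fun (m, s, a, k, b, e, m', k') =>
    (1 / (M : ℝ)) * (∏ i, ch.stateLaw (s i)) * c.enc m s (a, k) *
      (∏ i, ch.trans (a i) (s i) (b i, e i)) * c.dec b s (m', k')

/-- The probability of error `P{(M, K) ≠ (M̂, K̂)}`. -/
noncomputable def Code.errorProb (c : Code S A B n M K) (ch : StateChannel S A B E) : ℝ :=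
  ∑ ω, (fun (m, _, _, k, _, _, m', k') =>
    if (m, k) ≠ (m', k') then (1 : ℝ) else 0) ω * c.law ch ω

/-- The total variation distance between the law of `(K, Eⁿ)` and the product of the uniform
law on the keys with `Q_0^{⊗ n}`. -/
noncomputable def Code.covertKeyDist (c : Code S A B n M K) (ch : StateChannel S A B E) : ℝ :=
  tvDist (marginal (c.law ch) (fun (_, _, _, k, _, e, _, _) => (k, e)))
    (fun x : Fin K × (Fin n → E) => (1 / (K : ℝ)) * ∏ i, ch.wardenIdle (x.2 i))

/-- The total variation distance between the law of `(M, K)` and the uniform law on the pairs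
of a message and a key. -/
noncomputable def Code.messageKeyDist (c : Code S A B n M K) (ch : StateChannel S A B E) : ℝ :=
  tvDist (marginal (c.law ch) (fun (m, _, _, k, _, _, _, _) => (m, k)))
    (fun _ : Fin M × Fin K => 1 / ((M : ℝ) * (K : ℝ)))

end

section

variable {S A B E : Type*} [Fintype S] [Fintype A] [Fintype B] [Fintype E]

/-- The rate pair `(R, R_K)` is achievable: there are codes of all block lengths `n` with
`⌊2^{nR}⌋` messages and `⌊2^{n R_K}⌋` keys that are reliable, are covert and keep the key
secret from the warden, and whose key is asymptotically uniform and independent of the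
message. -/
def StateChannel.Achievable (ch : StateChannel S A B E) (R RK : ℝ) : Prop :=
  ∃ c : ∀ n : ℕ, Code S A B n ⌊(2 : ℝ) ^ ((n : ℝ) * R)⌋₊ ⌊(2 : ℝ) ^ ((n : ℝ) * RK)⌋₊,
    Filter.Tendsto (fun n => (c n).errorProb ch) Filter.atTop (nhds 0) ∧
    Filter.Tendsto (fun n => (c n).covertKeyDist ch) Filter.atTop (nhds 0) ∧
    Filter.Tendsto (fun n => (c n).messageKeyDist ch) Filter.atTop (nhds 0)

/-- The capacity region: the closure of the set of achievable pairs of nonnegative rates. -/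
def StateChannel.capacityRegion (ch : StateChannel S A B E) : Set (ℝ × ℝ) :=
  closure {r | 0 ≤ r.1 ∧ 0 ≤ r.2 ∧ ch.Achievable r.1 r.2}

end

end CovertKey

/-! The region is first rewritten in terms of laws ν of (S, A) alone. Since U – (A, S) – (B, E) is a
Markov chain, replacing U by A can only increase I(U;B|S) and I(U;B|E,S), and A is itself an allowed
auxiliary variable. So the bounds to establish are those of `StateChannel.Supports`; see
`StateChannel.IsAdmissible.exists_inputLaw` and `StateChannel.exists_isAdmissible`.

Converse. Take for ν the time average of the laws of (Sᵢ, Aᵢ). A single inequality,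
`entropy_le_of_output`, combined with Fano's inequality, bounds H(M|Sⁿ), H(M,K) and H(K|Eⁿ). Block
entropies are single-letterised by Gibbs' inequality against a product of single-letter conditional
laws, so neither a time-sharing variable nor a chain rule along the block is needed. Covertness
drives the E-marginal of ν to Q₀, and compactness of the set of input laws supplies a limit.

Achievability. The codebook has an entry for every (sⁿ, m, l), where l is local randomness of rate
r; an entry is an input sequence drawn from P_{A|S} and an independent uniform key. The receiver
knows sⁿ, finds (m, l) when R + r < I(A;B|S), and reads the key off the table. The index carries
randomness R + r + H(S), so soft covering makes (K, Eⁿ) nearly uniform times Q₀ⁿ when R_K < R + r +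
H(S) − I(A,S;E). For a fixed message only sⁿ and l remain random, so (M, K) is nearly uniform when
R_K < r + H(S). Letting r approach I(A;B|S) − R gives R_K < I(A;B|S) + H(S) − I(A,S;E) and R + R_K <
I(A;B|S) + H(S). Degradedness enters only through `StateChannel.IsDegraded.secretInfo_eq`, which
identifies the first of these bounds with I(A;B|E,S) + H(S|E).

Boundary. Random coding needs strict inequalities. They are obtained by mixing ν with a little of a
law of positive secret rate, using concavity, and then shrinking the rates. If no such law exists,
the remaining hypothesis forces the region to be the single point (0, 0), attained by sending
innocent symbols. -/

namespace CovertKey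

/-! ### Marginals and entropies on a finite sample space; Gibbs' and Fano's inequalities. -/

section entropy

variable {Ω α β γ κ : Type*} [Fintype Ω] [Fintype α] [Fintype β] [Fintype γ] [Fintype κ]

omit [Fintype α] in
-- `marginal` is defined with classical decidability; this form serves any instance.
lemma marginal_apply [DecidableEq α] (p : Ω → ℝ) (X : Ω → α) (x : α) :
    marginal p X x = ∑ ω, if X ω = x then p ω else 0 := by
  unfold marginal
  exact Finset.sum_congr rfl fun ω _ => by congr

lemma sum_marginal_mul (p : Ω → ℝ) (X : Ω → α) (g : α → ℝ) :
    ∑ x, marginal p X x * g x = ∑ ω, p ω * g (X ω) := by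
  classical
  simp only [marginal, Finset.sum_mul]
  rw [Finset.sum_comm]
  refine Finset.sum_congr rfl fun ω _ => ?_
  rw [Finset.sum_eq_single (X ω)]
  · simp
  · intro x _ hx
    simp [hx.symm]
  · simp

lemma sum_marginal (p : Ω → ℝ) (X : Ω → α) : ∑ x, marginal p X x = ∑ ω, p ω := by
  simpa using sum_marginal_mul p X (fun _ => 1)

omit [Fintype α] in
lemma marginal_nonneg {p : Ω → ℝ} (hp : ∀ ω, 0 ≤ p ω) (X : Ω → α) (x : α) :
    0 ≤ marginal p X x := by
  classical
  refine Finset.sum_nonneg fun ω _ => ?_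
  split_ifs
  exacts [hp ω, le_rfl]

omit [Fintype α] in
lemma marginal_pos {p : Ω → ℝ} (hp : ∀ ω, 0 ≤ p ω) (X : Ω → α) {ω : Ω} (h : 0 < p ω) :
    0 < marginal p X (X ω) := by
  classical
  refine Finset.sum_pos' (fun ω' _ => ?_) ⟨ω, Finset.mem_univ _, by simpa using h⟩
  split_ifs
  exacts [hp ω', le_rfl]

omit [Fintype β] in
lemma marginal_marginal (p : Ω → ℝ) (X : Ω → α) (f : α → β) :
    marginal (marginal p X) f = marginal p (fun ω => f (X ω)) := by
  classical
  funext y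
  have := sum_marginal_mul p X (fun x => if f x = y then 1 else 0)
  simpa [marginal] using this

omit [Fintype α] in
-- All explicit marginals are computed with this: `e` lists the coordinates of an outcome with those
-- of `X` first, and the remaining ones are summed out.
lemma marginal_eq_sum_of_equiv (p : Ω → ℝ) (X : Ω → α) (e : α × κ ≃ Ω)
    (h : ∀ x k, X (e (x, k)) = x) (x : α) : marginal p X x = ∑ k, p (e (x, k)) := by
  classical
  have : Fintype (α × κ) := Fintype.ofEquiv Ω e.symm
  unfold marginal
  rw [← Finset.sum_filter]
  symm
  refine Finset.sum_bij (fun k _ => e (x, k)) (by simp [h]) (by simp) ?_ (by simp)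
  intro ω hω
  refine ⟨(e.symm ω).2, Finset.mem_univ _, ?_⟩
  have h1 := h (e.symm ω).1 (e.symm ω).2
  simp only [Prod.mk.eta, Equiv.apply_symm_apply] at h1
  rw [Finset.mem_filter] at hω
  rw [← hω.2, h1]
  simp

omit [Fintype γ] in
lemma sum_marginal_prod_left (p : Ω → ℝ) (X : Ω → α) (Z : Ω → γ) (z : γ) :
    ∑ x, marginal p (fun ω => (X ω, Z ω)) (x, z) = marginal p Z z := by
  classical
  simp only [marginal]
  rw [Finset.sum_comm]
  refine Finset.sum_congr rfl fun ω _ => ?_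
  rw [Finset.sum_eq_single (X ω)]
  · simp
  · intro x _ hx
    simp [hx.symm]
  · simp

/-- Writing every entropy as an expectation over the same sample space lets entropies of different
variables be compared outcome by outcome, null outcomes contributing nothing. -/
lemma entropy_eq_sum (p : Ω → ℝ) (X : Ω → α) :
    entropy p X = ∑ ω, p ω * (-Real.logb 2 (marginal p X (X ω))) := by
  rw [← sum_marginal_mul p X (fun x => -Real.logb 2 (marginal p X x))]
  unfold entropy
  refine Finset.sum_congr rfl fun x _ => ?_
  simp [Real.negMulLog, Real.logb]
  ring

lemma condEntropy_eq_sum {p : Ω → ℝ} (hp : ∀ ω, 0 ≤ p ω) (X : Ω → α) (Z : Ω → γ) :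
    condEntropy p X Z = ∑ ω, p ω * (-Real.logb 2
      (marginal p (fun ω => (X ω, Z ω)) (X ω, Z ω) / marginal p Z (Z ω))) := by
  unfold condEntropy
  rw [entropy_eq_sum, entropy_eq_sum, ← Finset.sum_sub_distrib]
  refine Finset.sum_congr rfl fun ω _ => ?_
  rcases (hp ω).eq_or_lt with h | h
  · simp [← h]
  · have h1 := marginal_pos hp (fun ω => (X ω, Z ω)) h
    have h2 := marginal_pos hp Z h
    rw [Real.logb_div h1.ne' h2.ne']
    ring

/-- The conditional entropy of a variable with conditional law `q`. -/
lemma condEntropy_eq_of_factor {p : Ω → ℝ} (hp : ∀ ω, 0 ≤ p ω) (X : Ω → α) (Z : Ω → γ)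
    (q : γ → α → ℝ)
    (h : ∀ x z, marginal p (fun ω => (X ω, Z ω)) (x, z) = marginal p Z z * q z x) :
    condEntropy p X Z = ∑ ω, p ω * (-Real.logb 2 (q (Z ω) (X ω))) := by
  rw [condEntropy_eq_sum hp]
  refine Finset.sum_congr rfl fun ω _ => ?_
  rcases (hp ω).eq_or_lt with h0 | h0
  · simp [← h0]
  · rw [h, mul_div_cancel_left₀ _ (marginal_pos hp Z h0).ne']

/-- Gibbs' inequality: the cross entropy is at least the conditional entropy. -/
lemma condEntropy_le_sum {p : Ω → ℝ} (hp : ∀ ω, 0 ≤ p ω) (X : Ω → α) (Z : Ω → γ)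
    (q : γ → α → ℝ) (hq : ∀ z x, 0 ≤ q z x) (hq1 : ∀ z, ∑ x, q z x ≤ 1)
    (hpos : ∀ ω, 0 < p ω → 0 < q (Z ω) (X ω)) :
    condEntropy p X Z ≤ ∑ ω, p ω * (-Real.logb 2 (q (Z ω) (X ω))) := by
  rw [condEntropy_eq_sum hp, ← sub_nonneg, ← Finset.sum_sub_distrib]
  set c : Ω → ℝ := fun ω => marginal p (fun ω => (X ω, Z ω)) (X ω, Z ω) / marginal p Z (Z ω)
  -- The likelihood ratio of `q` to the true conditional law `c` has expectation at most the total
  -- mass of `p`.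
  have key : ∑ ω, p ω * (q (Z ω) (X ω) / c ω) ≤ ∑ ω, p ω := by
    have h1 := sum_marginal_mul p (fun ω => (X ω, Z ω)) (fun y => q y.2 y.1 /
      (marginal p (fun ω => (X ω, Z ω)) y / marginal p Z y.2))
    have h2 : ∑ ω, p ω * (q (Z ω) (X ω) / c ω) ≤ ∑ y : α × γ, marginal p Z y.2 * q y.2 y.1 := by
      rw [← h1]
      refine Finset.sum_le_sum fun y _ => ?_
      have h0 := marginal_nonneg hp (fun ω => (X ω, Z ω)) y
      rcases h0.eq_or_lt with h | h
      · rw [← h]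
        simpa using mul_nonneg (marginal_nonneg hp Z y.2) (hq _ _)
      · exact le_of_eq (by field_simp)
    refine h2.trans ?_
    rw [Fintype.sum_prod_type_right, ← sum_marginal p Z]
    refine Finset.sum_le_sum fun z _ => ?_
    dsimp only
    rw [← Finset.mul_sum]
    exact mul_le_of_le_one_right (marginal_nonneg hp Z z) (hq1 z)
  have hl2 : 0 < Real.log 2 := Real.log_pos (by norm_num)
  -- This is log x ≤ x − 1 at x = q / c, weighted by `p ω`.
  have h3 : ∀ ω, (p ω - p ω * (q (Z ω) (X ω) / c ω)) / Real.log 2 ≤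
      p ω * (-Real.logb 2 (q (Z ω) (X ω))) - p ω * (-Real.logb 2 (c ω)) := by
    intro ω
    rcases (hp ω).eq_or_lt with h0 | h0
    · simp [← h0]
    · have hc : 0 < c ω := div_pos (marginal_pos hp _ h0) (marginal_pos hp Z h0)
      have hq0 := hpos ω h0
      have := Real.log_le_sub_one_of_pos (div_pos hq0 hc)
      rw [Real.log_div hq0.ne' hc.ne'] at this
      unfold Real.logb
      rw [div_le_iff₀ hl2]
      have e : (p ω * -(Real.log (q (Z ω) (X ω)) / Real.log 2) -
          p ω * -(Real.log (c ω) / Real.log 2)) * Real.log 2 =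
          p ω * (Real.log (c ω) - Real.log (q (Z ω) (X ω))) := by
        field_simp
        ring
      rw [e, ← mul_one_sub]
      exact mul_le_mul_of_nonneg_left (by linarith) h0.le
  refine le_trans ?_ (Finset.sum_le_sum fun ω _ => h3 ω)
  rw [← Finset.sum_div, Finset.sum_sub_distrib]
  exact div_nonneg (by linarith) hl2.le

lemma entropy_marginal (p : Ω → ℝ) (X : Ω → α) (f : α → β) :
    entropy (marginal p X) f = entropy p (fun ω => f (X ω)) := by
  unfold entropy
  rw [marginal_marginal]

lemma condEntropy_marginal (p : Ω → ℝ) (X : Ω → α) (f : α → β) (g : α → γ) :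
    condEntropy (marginal p X) f g = condEntropy p (fun ω => f (X ω)) (fun ω => g (X ω)) := by
  unfold condEntropy
  rw [entropy_marginal, entropy_marginal]

/-- The fibre of `f ∘ X` through an outcome contains the fibre of `X`, so its probability is larger
and its −log smaller. -/
lemma entropy_comp_le {p : Ω → ℝ} (hp : ∀ ω, 0 ≤ p ω) (X : Ω → α) (f : α → β) :
    entropy p (fun ω => f (X ω)) ≤ entropy p X := by
  classical
  rw [entropy_eq_sum, entropy_eq_sum]
  refine Finset.sum_le_sum fun ω _ => ?_
  rcases (hp ω).eq_or_lt with h0 | h0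
  · simp [← h0]
  · have h1 := marginal_pos hp X h0
    have h2 : marginal p X (X ω) ≤ marginal p (fun ω => f (X ω)) (f (X ω)) := by
      refine Finset.sum_le_sum fun ω' _ => ?_
      split_ifs with h h' h'
      · exact le_rfl
      · exact absurd (congrArg f h) h'
      · exact hp ω'
      · exact le_rfl
    have := (Real.logb_le_logb (b := 2) (by norm_num) h1 (h1.trans_le h2)).2 h2
    exact mul_le_mul_of_nonneg_left (by linarith) h0.le

/-- Mostly used to permute or regroup the coordinates of a tuple. -/
lemma entropy_congr {p : Ω → ℝ} (hp : ∀ ω, 0 ≤ p ω) (X : Ω → α) (Y : Ω → β) (f : α → β)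
    (g : β → α) (hf : ∀ ω, f (X ω) = Y ω) (hg : ∀ ω, g (Y ω) = X ω) :
    entropy p X = entropy p Y := by
  apply le_antisymm
  · simpa [hg] using entropy_comp_le hp Y g
  · simpa [hf] using entropy_comp_le hp X f

lemma condEntropy_nonneg {p : Ω → ℝ} (hp : ∀ ω, 0 ≤ p ω) (X : Ω → α) (Z : Ω → γ) :
    0 ≤ condEntropy p X Z :=
  sub_nonneg.2 (entropy_comp_le hp (fun ω => (X ω, Z ω)) Prod.snd)

/-- Conditioning on more reduces the entropy. -/
lemma condEntropy_le_comp {p : Ω → ℝ} (hp : ∀ ω, 0 ≤ p ω) (X : Ω → α) (Z : Ω → γ)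
    (f : γ → β) : condEntropy p X Z ≤ condEntropy p X (fun ω => f (Z ω)) := by
  rw [condEntropy_eq_sum hp X (fun ω => f (Z ω))]
  -- Gibbs' inequality with the conditional law given the coarser variable as test law.
  refine condEntropy_le_sum hp X Z (fun z x => marginal p (fun ω => (X ω, f (Z ω))) (x, f z) /
    marginal p (fun ω => f (Z ω)) (f z)) ?_ ?_ ?_
  · exact fun z x => div_nonneg (marginal_nonneg hp _ _) (marginal_nonneg hp _ _)
  · intro z
    rw [← Finset.sum_div, sum_marginal_prod_left]
    exact div_self_le_one _
  · exact fun ω h => div_pos (marginal_pos hp (fun ω => (X ω, f (Z ω))) h)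
      (marginal_pos hp (fun ω => f (Z ω)) h)

/-- Makes unconditional statements special cases of conditional ones. -/
lemma entropy_eq_condEntropy_unit {p : Ω → ℝ} (hp : ∀ ω, 0 ≤ p ω) (hp1 : ∑ ω, p ω = 1)
    (X : Ω → α) : entropy p X = condEntropy p X (fun _ => ()) := by
  have h1 : entropy p (fun _ : Ω => ()) = 0 := by
    simp [entropy, marginal, hp1]
  unfold condEntropy
  rw [h1, sub_zero]
  exact entropy_congr hp _ _ (fun x => (x, ())) Prod.fst (fun _ => rfl) (fun _ => rfl)

lemma entropy_nonneg {p : Ω → ℝ} (hp : ∀ ω, 0 ≤ p ω) (hp1 : ∑ ω, p ω = 1) (X : Ω → α) :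
    0 ≤ entropy p X := by
  rw [entropy_eq_condEntropy_unit hp hp1]
  exact condEntropy_nonneg hp _ _

/-- Fano's inequality for a stochastic estimator `q`. -/
lemma condEntropy_le_fano {p : Ω → ℝ} (hp : ∀ ω, 0 ≤ p ω) (hp1 : ∑ ω, p ω = 1) (X : Ω → α)
    (Z : Ω → γ) (q : γ → α → ℝ) (hq : ∀ z, q z ∈ stdSimplex ℝ α) :
    condEntropy p X Z ≤ 1 + (∑ ω, p ω * (1 - q (Z ω) (X ω))) *
      Real.logb 2 (Fintype.card α) := by
  rcases isEmpty_or_nonempty Ω with hΩ | ⟨⟨ω₀⟩⟩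
  · simp at hp1
  have hN : 0 < (Fintype.card α : ℝ) := by
    exact_mod_cast Fintype.card_pos_iff.2 ⟨X ω₀⟩
  set N : ℝ := (Fintype.card α : ℝ)
  have hl2 : 0 < Real.log 2 := Real.log_pos (by norm_num)
  -- Gibbs' inequality with the half-half mixture of the estimator and the uniform law. The factor
  -- 1/2 costs the one bit in the bound; the uniform part keeps the logarithm finite.
  refine (condEntropy_le_sum hp X Z (fun z x => (q z x + 1 / N) / 2) ?_ ?_ ?_).trans ?_
  · intro z x
    have := (hq z).1 x
    positivity
  · intro z
    rw [← Finset.sum_div, Finset.sum_add_distrib, (hq z).2]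
    simp [N, hN.ne']
  · intro ω _
    have := (hq (Z ω)).1 (X ω)
    positivity
  · have : ∀ ω, p ω * (-Real.logb 2 ((q (Z ω) (X ω) + 1 / N) / 2)) ≤
        p ω + p ω * (1 - q (Z ω) (X ω)) * Real.logb 2 N := by
      intro ω
      set D := q (Z ω) (X ω)
      have hD : 0 ≤ D := (hq (Z ω)).1 (X ω)
      have hD1 : D ≤ 1 := (Finset.single_le_sum (fun i _ => (hq (Z ω)).1 i)
        (Finset.mem_univ (X ω))).trans (hq (Z ω)).2.le
      -- D + 1/N is the combination of 1 + 1/N and 1/N with weights D and 1 − D, so by concavity its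
      -- logarithm is at least −(1 − D) log N.
      have hc := strictConcaveOn_log_Ioi.concaveOn.2 (x := 1 + 1 / N) (y := 1 / N)
        (by simp only [Set.mem_Ioi]; positivity) (by simp only [Set.mem_Ioi]; positivity) hD
        (sub_nonneg.2 hD1) (by ring)
      simp only [smul_eq_mul] at hc
      have e1 : D * (1 + 1 / N) + (1 - D) * (1 / N) = D + 1 / N := by ring
      rw [e1] at hc
      have h2 : 0 ≤ Real.log (1 + 1 / N) := Real.log_nonneg (by
        have : 0 < 1 / N := by positivity
        linarith)
      have h3 : Real.log (1 / N) = - Real.log N := by simp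
      have h4 : -Real.logb 2 ((D + 1 / N) / 2) ≤ 1 + (1 - D) * Real.logb 2 N := by
        unfold Real.logb
        rw [Real.log_div (by positivity) (by norm_num)]
        have : -((Real.log (D + 1 / N) - Real.log 2) / Real.log 2) =
          1 - Real.log (D + 1 / N) / Real.log 2 := by field_simp; ring
        rw [this]
        have : -(Real.log (D + 1 / N) / Real.log 2) ≤ (1 - D) * (Real.log N / Real.log 2) := by
          rw [← mul_div_assoc, ← neg_div]
          gcongr
          nlinarith [mul_nonneg hD h2]
        linarith
      nlinarith [mul_le_mul_of_nonneg_left h4 (hp ω)]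
    refine (Finset.sum_le_sum fun ω _ => this ω).trans ?_
    rw [Finset.sum_add_distrib, hp1, Finset.sum_mul]

/-- A variable which is nearly uniform and independent of `Z` has nearly maximal entropy
given `Z`. -/
lemma condEntropy_ge_of_near_uniform {p : Ω → ℝ} (hp : ∀ ω, 0 ≤ p ω) (hp1 : ∑ ω, p ω = 1)
    (X : Ω → α) (Z : Ω → γ) :
    Real.logb 2 (Fintype.card α) - 1 - 2 * Real.logb 2 (Fintype.card α) *
      (∑ y : α × γ, |marginal p (fun ω => (X ω, Z ω)) y -
        1 / (Fintype.card α : ℝ) * marginal p Z y.2|) ≤ condEntropy p X Z := by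
  rcases isEmpty_or_nonempty Ω with hΩ | ⟨⟨ω₀⟩⟩
  · simp at hp1
  have hN : 1 ≤ (Fintype.card α : ℝ) := by
    exact_mod_cast Fintype.card_pos_iff.2 ⟨X ω₀⟩
  set N : ℝ := (Fintype.card α : ℝ)
  have hl : 0 ≤ Real.logb 2 N := Real.logb_nonneg (by norm_num) hN
  rw [condEntropy_eq_sum hp]
  have h1 := sum_marginal_mul p (fun ω => (X ω, Z ω)) (fun y => -Real.logb 2
      (marginal p (fun ω => (X ω, Z ω)) y / marginal p Z y.2))
  rw [← h1]
  have h2 : ∀ y : α × γ, marginal p (fun ω => (X ω, Z ω)) y * (Real.logb 2 N - 1) -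
      2 * Real.logb 2 N * |marginal p (fun ω => (X ω, Z ω)) y - 1 / N * marginal p Z y.2| ≤
      marginal p (fun ω => (X ω, Z ω)) y * -Real.logb 2
      (marginal p (fun ω => (X ω, Z ω)) y / marginal p Z y.2) := by
    rintro ⟨x, z⟩
    dsimp only
    set a := marginal p (fun ω => (X ω, Z ω)) (x, z) with ha
    set b := marginal p Z z with hb
    have ha0 : 0 ≤ a := marginal_nonneg hp _ _
    have hab : a ≤ b := by
      rw [ha, hb, ← sum_marginal_prod_left p X Z z]
      exact Finset.single_le_sum (f := fun x => marginal p (fun ω => (X ω, Z ω)) (x, z))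
        (fun i _ => marginal_nonneg hp _ _) (Finset.mem_univ x)
    rcases ha0.eq_or_lt with h0 | h0
    · rw [← h0]
      have := mul_nonneg hl (abs_nonneg (0 - 1 / N * b))
      linarith
    · have hb0 : 0 < b := h0.trans_le hab
      -- Either the conditional probability a/b is at most 2/N, which loses one bit against log N,
      -- or it is larger and then a ≤ 2|a − b/N|, so the distance term pays for the loss.
      by_cases hc : a * N ≤ 2 * b
      · have : Real.logb 2 (a / b) ≤ 1 - Real.logb 2 N := by
          have : a / b ≤ 2 / N := by
            rw [div_le_div_iff₀ hb0 (by linarith)]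
            exact hc
          have := (Real.logb_le_logb (b := 2) (by norm_num) (by positivity) (by positivity)).2 this
          rw [Real.logb_div (x := 2) (by norm_num) (by linarith),
            Real.logb_self_eq_one (by norm_num)] at this
          exact this
        have := mul_le_mul_of_nonneg_left this ha0
        nlinarith [mul_nonneg hl (abs_nonneg (a - 1 / N * b))]
      · push Not at hc
        have h3 : Real.logb 2 (a / b) ≤ 0 := by
          apply Real.logb_nonpos (by norm_num) (by positivity)
          rw [div_le_one hb0]
          exact hab
        have h4 : a ≤ 2 * |a - 1 / N * b| := by
          have : 1 / N * b < a / 2 := by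
            rw [div_mul_eq_mul_div, one_mul, div_lt_div_iff₀ (by linarith) (by norm_num)]
            linarith
          have := le_abs_self (a - 1 / N * b)
          linarith
        nlinarith [mul_le_mul_of_nonneg_left h4 hl, mul_nonneg ha0 (neg_nonneg.2 h3)]
  refine le_trans (le_of_eq ?_) (Finset.sum_le_sum fun y _ => h2 y)
  rw [Finset.sum_sub_distrib, ← Finset.sum_mul, ← Finset.mul_sum, sum_marginal, hp1]
  ring

omit [Fintype α] in
lemma continuous_marginal (X : Ω → α) (x : α) :
    Continuous fun p : Ω → ℝ => marginal p X x := by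
  classical
  unfold marginal
  refine continuous_finsetSum _ fun ω _ => ?_
  split_ifs
  exacts [continuous_apply ω, continuous_const]

lemma continuous_entropy (X : Ω → α) : Continuous fun p : Ω → ℝ => entropy p X := by
  unfold entropy
  refine continuous_finsetSum _ fun x _ => ?_
  exact (Real.continuous_negMulLog.comp (continuous_marginal X x)).div_const _

lemma continuous_condEntropy (X : Ω → α) (Z : Ω → γ) :
    Continuous fun p : Ω → ℝ => condEntropy p X Z :=
  (continuous_entropy _).sub (continuous_entropy _)

end entropy

/-! ### Sums of products over finite index sets. -/

section products

variable {n : ℕ} {ι α β : Type*} [Fintype ι] [Fintype α] [Fintype β]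

lemma sum_prod_pi (F : ι → α → ℝ) [DecidableEq ι] :
    ∑ x : ι → α, ∏ j, F j (x j) = ∏ j, ∑ x, F j x := by
  rw [Finset.prod_univ_sum]
  simp

lemma sum_prod_pi_pair (F : ι → α → β → ℝ) [DecidableEq ι] :
    ∑ x : ι → α, ∑ y : ι → β, ∏ j, F j (x j) (y j) = ∏ j, ∑ x, ∑ y, F j x y := by
  simp_rw [sum_prod_pi]
  exact sum_prod_pi (fun j x => ∑ y, F j x y)

/-- The function of one coordinate is a product equal to 1 at the others; the sum then factorises
and the other factors sum to one. -/
lemma sum_prod_mul_coord [DecidableEq ι] (w : ι → α → ℝ) (hw : ∀ j, ∑ x, w j x = 1) (i : ι)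
    (g : α → ℝ) : ∑ x : ι → α, (∏ j, w j (x j)) * g (x i) = ∑ x, w i x * g x := by
  have h : ∀ x : ι → α, (∏ j, w j (x j)) * g (x i) =
      ∏ j, w j (x j) * (if j = i then g (x j) else 1) := by
    intro x
    rw [Finset.prod_mul_distrib, Finset.prod_ite_eq' Finset.univ i (fun j => g (x j))]
    simp
  simp_rw [h]
  rw [sum_prod_pi (fun j x => w j x * (if j = i then g x else 1)), Finset.prod_eq_single i]
  · simp
  · intro j _ hj
    simp [hj, hw]
  · simp

lemma sum_prod_mul_coord_pair [DecidableEq ι] (w : ι → α → β → ℝ)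
    (hw : ∀ j, ∑ x, ∑ y, w j x y = 1) (i : ι) (g : α → β → ℝ) :
    ∑ x : ι → α, ∑ y : ι → β, (∏ j, w j (x j) (y j)) * g (x i) (y i) =
      ∑ x, ∑ y, w i x y * g x y := by
  have h : ∀ (x : ι → α) (y : ι → β), (∏ j, w j (x j) (y j)) * g (x i) (y i) =
      ∏ j, w j (x j) (y j) * (if j = i then g (x j) (y j) else 1) := by
    intro x y
    rw [Finset.prod_mul_distrib,
      Finset.prod_ite_eq' Finset.univ i (fun j => g (x j) (y j))]
    simp
  simp_rw [h]
  rw [sum_prod_pi_pair (fun j x y => w j x y * (if j = i then g x y else 1)),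
    Finset.prod_eq_single i]
  · simp
  · intro j _ hj
    simp [hj, hw]
  · simp

lemma neg_logb_prod (f : ι → ℝ) (h : ∀ i, 0 < f i) :
    -Real.logb 2 (∏ i, f i) = ∑ i, -Real.logb 2 (f i) := by
  rw [Real.logb_prod _ _ fun i _ => (h i).ne', Finset.sum_neg_distrib]

end products

/-! ### Single-letterisation through the average law of the letters. -/

section letters

variable {Ω Ω₁ α γ : Type*} [Fintype Ω] [Fintype Ω₁] [Fintype α] [Fintype γ] {n : ℕ}

/-- The average law of the letters `T 0, …, T (n - 1)`. -/
noncomputable def letterAverage (p : Ω → ℝ) (T : Fin n → Ω → Ω₁) : Ω₁ → ℝ :=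
  fun t => (1 / (n : ℝ)) * ∑ i, marginal p (T i) t

/-- The average law plays the part of a uniform time-sharing variable: additive functions of the
block have n times their single-letter mean. -/
lemma sum_letters (hn : 0 < n) (p : Ω → ℝ) (T : Fin n → Ω → Ω₁) (g : Ω₁ → ℝ) :
    ∑ ω, p ω * ∑ i, g (T i ω) = n * ∑ t, letterAverage p T t * g t := by
  have hn' : (n : ℝ) ≠ 0 := by exact_mod_cast hn.ne'
  simp only [letterAverage, Finset.mul_sum, Finset.sum_mul]
  rw [Finset.sum_comm, Finset.sum_comm (s := (Finset.univ : Finset Ω₁))]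
  refine Finset.sum_congr rfl fun i _ => ?_
  rw [← sum_marginal_mul p (T i) g]
  refine Finset.sum_congr rfl fun t _ => ?_
  field_simp

omit [Fintype Ω₁] in
lemma letterAverage_nonneg {p : Ω → ℝ} (hp : ∀ ω, 0 ≤ p ω) (T : Fin n → Ω → Ω₁) (t : Ω₁) :
    0 ≤ letterAverage p T t :=
  mul_nonneg (by positivity) (Finset.sum_nonneg fun i _ => marginal_nonneg hp _ _)

omit [Fintype Ω₁] in
lemma letterAverage_pos {p : Ω → ℝ} (hp : ∀ ω, 0 ≤ p ω) (T : Fin n → Ω → Ω₁) (i : Fin n)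
    {ω : Ω} (h : 0 < p ω) : 0 < letterAverage p T (T i ω) := by
  have hn : 0 < n := i.pos
  refine mul_pos (by positivity) (Finset.sum_pos' (fun i _ => marginal_nonneg hp _ _)
    ⟨i, Finset.mem_univ _, marginal_pos hp (T i) h⟩)

/-- The conditional entropy of a block is at most its length times the single-letter
conditional entropy under the average law of the letters. -/
lemma condEntropy_block_le (hn : 0 < n) {p : Ω → ℝ} (hp : ∀ ω, 0 ≤ p ω) (T : Fin n → Ω → Ω₁)
    (x : Ω₁ → α) (z : Ω₁ → γ) :
    condEntropy p (fun ω i => x (T i ω)) (fun ω i => z (T i ω)) ≤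
      n * condEntropy (letterAverage p T) x z := by
  classical
  have hp' := letterAverage_nonneg hp T
  rw [condEntropy_eq_sum hp', ← sum_letters hn]
  -- The test law for Gibbs' inequality is the n-fold product of this single-letter conditional law;
  -- its −log is additive over the letters, whatever their dependence.
  set c : γ → α → ℝ := fun z' x' =>
    marginal (letterAverage p T) (fun t => (x t, z t)) (x', z') /
      marginal (letterAverage p T) z z'
  have hpos : ∀ ω, 0 < p ω → ∀ i, 0 < c (z (T i ω)) (x (T i ω)) := fun ω h i =>
    div_pos (marginal_pos hp' (fun t => (x t, z t)) (letterAverage_pos hp T i h))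
      (marginal_pos hp' z (letterAverage_pos hp T i h))
  refine (condEntropy_le_sum hp _ _ (fun z' x' => ∏ i, c (z' i) (x' i)) ?_ ?_ ?_).trans ?_
  · exact fun z' x' => Finset.prod_nonneg fun i _ =>
      div_nonneg (marginal_nonneg hp' _ _) (marginal_nonneg hp' _ _)
  · intro z'
    rw [sum_prod_pi (fun i x' => c (z' i) x')]
    refine Finset.prod_le_one (fun i _ => Finset.sum_nonneg fun x' _ =>
      div_nonneg (marginal_nonneg hp' _ _) (marginal_nonneg hp' _ _)) fun i _ => ?_
    rw [← Finset.sum_div, sum_marginal_prod_left]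
    exact div_self_le_one _
  · exact fun ω h => Finset.prod_pos fun i _ => hpos ω h i
  · refine le_of_eq (Finset.sum_congr rfl fun ω _ => ?_)
    rcases (hp ω).eq_or_lt with h0 | h0
    · simp [← h0]
    · rw [neg_logb_prod _ (hpos ω h0)]

lemma entropy_block_le (hn : 0 < n) {p : Ω → ℝ} (hp : ∀ ω, 0 ≤ p ω) (hp1 : ∑ ω, p ω = 1)
    (T : Fin n → Ω → Ω₁) (x : Ω₁ → α) :
    entropy p (fun ω i => x (T i ω)) ≤ n * entropy (letterAverage p T) x := by
  have hq1 : ∑ t, letterAverage p T t = 1 := by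
    have := sum_letters hn p T (fun _ => 1)
    simp only [Finset.sum_const, Finset.card_univ, Fintype.card_fin, nsmul_eq_mul, mul_one,
      ← Finset.sum_mul, hp1, one_mul] at this
    have hn' : (n : ℝ) ≠ 0 := by exact_mod_cast hn.ne'
    exact (mul_left_cancel₀ hn' (by rw [← this, mul_one])).symm
  rw [entropy_eq_condEntropy_unit hp hp1, entropy_eq_condEntropy_unit (letterAverage_nonneg hp T)
    hq1]
  refine le_trans (le_of_eq ?_) (condEntropy_block_le hn hp T x (fun _ => ()))
  unfold condEntropy
  rw [entropy_congr hp (fun ω => ((fun i => x (T i ω)), ())) (fun ω => ((fun i => x (T i ω)),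
    (fun _ : Fin n => ()))) (fun y => (y.1, fun _ => ())) (fun y => (y.1, ())) (fun _ => rfl)
    (fun _ => rfl), entropy_congr hp (fun _ => ()) (fun _ => (fun _ : Fin n => ()))
    (fun _ _ => ()) (fun _ => ()) (fun _ => rfl) (fun _ => rfl)]

end letters

/-! ### Concavity of conditional entropy. -/

section concavity

variable {Ω α γ : Type*} [Fintype Ω] [Fintype α] [Fintype γ]

/-- Against the conditional law `c` of the mixture, cross entropy is linear in the law; it equals
the conditional entropy for the mixture and by Gibbs' inequality dominates it for each component. -/
lemma condEntropy_concave {p q : Ω → ℝ} (hp : ∀ ω, 0 ≤ p ω) (hq : ∀ ω, 0 ≤ q ω) {t : ℝ}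
    (ht0 : 0 < t) (ht1 : t < 1) (X : Ω → α) (Z : Ω → γ) :
    (1 - t) * condEntropy p X Z + t * condEntropy q X Z ≤
      condEntropy (fun ω => (1 - t) * p ω + t * q ω) X Z := by
  set r : Ω → ℝ := fun ω => (1 - t) * p ω + t * q ω
  have ht : 0 < 1 - t := by linarith
  have hr : ∀ ω, 0 ≤ r ω := fun ω =>
    add_nonneg (mul_nonneg ht.le (hp ω)) (mul_nonneg ht0.le (hq ω))
  rw [condEntropy_eq_sum hr]
  set c : γ → α → ℝ := fun z x => marginal r (fun ω => (X ω, Z ω)) (x, z) / marginal r Z z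
  have hc : ∀ z x, 0 ≤ c z x := fun z x =>
    div_nonneg (marginal_nonneg hr _ _) (marginal_nonneg hr _ _)
  have hc1 : ∀ z, ∑ x, c z x ≤ 1 := by
    intro z
    rw [← Finset.sum_div, sum_marginal_prod_left]
    exact div_self_le_one _
  have hpos : ∀ ω, 0 < r ω → 0 < c (Z ω) (X ω) := fun ω h =>
    div_pos (marginal_pos hr (fun ω => (X ω, Z ω)) h) (marginal_pos hr Z h)
  have h1 := condEntropy_le_sum hp X Z c hc hc1 fun ω h => hpos ω
    (add_pos_of_pos_of_nonneg (mul_pos ht h) (mul_nonneg ht0.le (hq ω)))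
  have h2 := condEntropy_le_sum hq X Z c hc hc1 fun ω h => hpos ω
    (add_pos_of_nonneg_of_pos (mul_nonneg ht.le (hp ω)) (mul_pos ht0 h))
  have h3 : ∑ ω, r ω * -Real.logb 2 (c (Z ω) (X ω)) =
      (1 - t) * (∑ ω, p ω * -Real.logb 2 (c (Z ω) (X ω))) +
      t * (∑ ω, q ω * -Real.logb 2 (c (Z ω) (X ω))) := by
    rw [Finset.mul_sum, Finset.mul_sum, ← Finset.sum_add_distrib]
    exact Finset.sum_congr rfl fun ω _ => by simp only [r]; ring
  rw [h3]
  exact add_le_add (mul_le_mul_of_nonneg_left h1 ht.le) (mul_le_mul_of_nonneg_left h2 ht0.le)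

end concavity

/-! ### Single-letter quantities of a law of state and input. -/

section singleLetter

variable {S A B E : Type*} [Fintype S] [Fintype A] [Fintype B] [Fintype E]

/-- The receiver's channel. -/
noncomputable def StateChannel.outB (ch : StateChannel S A B E) (a : A) (s : S) (b : B) : ℝ :=
  ∑ e, ch.trans a s (b, e)

/-- The warden's channel. -/
noncomputable def StateChannel.outE (ch : StateChannel S A B E) (a : A) (s : S) (e : E) : ℝ :=
  ∑ b, ch.trans a s (b, e)

/-- The law of `(S, A, B, E)` when `(S, A)` is distributed as `ν`. -/
noncomputable def StateChannel.letterLaw (ch : StateChannel S A B E) (ν : S × A → ℝ) :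
    S × A × B × E → ℝ :=
  fun (s, a, b, e) => ν (s, a) * ch.trans a s (b, e)

/-- The joint laws of the state and the input. -/
def StateChannel.inputLaws (ch : StateChannel S A B E) : Set (S × A → ℝ) :=
  {ν | (∀ x, 0 ≤ ν x) ∧ ∀ s, ∑ a, ν (s, a) = ch.stateLaw s}

/-- `I(A ; B | S)`. -/
noncomputable def infoAB_S (p : S × A × B × E → ℝ) : ℝ :=
  condEntropy p (fun t => t.2.2.1) (fun t => t.1) -
    condEntropy p (fun t => t.2.2.1) (fun t => (t.2.1, t.1))

/-- `I(A ; B | E, S) + H(S | E)`. -/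
noncomputable def secretInfo (p : S × A × B × E → ℝ) : ℝ :=
  condEntropy p (fun t => t.2.2.1) (fun t => (t.2.2.2, t.1)) -
    condEntropy p (fun t => t.2.2.1) (fun t => (t.2.2.2, t.2.1, t.1)) +
    condEntropy p (fun t => t.1) (fun t => t.2.2.2)

/-- `H(S)`. -/
noncomputable def stateEntropy (p : S × A × B × E → ℝ) : ℝ :=
  entropy p (fun t => t.1)

variable (ch : StateChannel S A B E)

lemma StateChannel.trans_nonneg (a : A) (s : S) (y : B × E) : 0 ≤ ch.trans a s y :=
  (ch.trans_mem a s).1 y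

lemma StateChannel.outB_nonneg (a : A) (s : S) (b : B) : 0 ≤ ch.outB a s b :=
  Finset.sum_nonneg fun _ _ => ch.trans_nonneg _ _ _

lemma StateChannel.outE_nonneg (a : A) (s : S) (e : E) : 0 ≤ ch.outE a s e :=
  Finset.sum_nonneg fun _ _ => ch.trans_nonneg _ _ _

lemma StateChannel.trans_le_outB (a : A) (s : S) (b : B) (e : E) :
    ch.trans a s (b, e) ≤ ch.outB a s b :=
  Finset.single_le_sum (f := fun e => ch.trans a s (b, e)) (fun _ _ => ch.trans_nonneg _ _ _)
    (Finset.mem_univ e)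

lemma StateChannel.trans_le_outE (a : A) (s : S) (b : B) (e : E) :
    ch.trans a s (b, e) ≤ ch.outE a s e :=
  Finset.single_le_sum (f := fun b => ch.trans a s (b, e)) (fun _ _ => ch.trans_nonneg _ _ _)
    (Finset.mem_univ b)

/-- The quotient serves as the law of B given (A, S, E); where the denominator vanishes so does the
numerator, and the default value 0 does no harm. -/
lemma StateChannel.outE_mul_div (a : A) (s : S) (b : B) (e : E) :
    ch.outE a s e * (ch.trans a s (b, e) / ch.outE a s e) = ch.trans a s (b, e) := by
  rcases (ch.outE_nonneg a s e).eq_or_lt with h | h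
  · rw [← h, zero_mul]
    exact le_antisymm (ch.trans_nonneg a s (b, e)) (h ▸ ch.trans_le_outE a s b e)
  · field_simp

lemma StateChannel.sum_sum_trans (a : A) (s : S) : ∑ b, ∑ e, ch.trans a s (b, e) = 1 := by
  rw [← Fintype.sum_prod_type (fun y => ch.trans a s y)]
  exact (ch.trans_mem a s).2

lemma StateChannel.sum_outB (a : A) (s : S) : ∑ b, ch.outB a s b = 1 :=
  ch.sum_sum_trans a s

lemma StateChannel.sum_outE (a : A) (s : S) : ∑ e, ch.outE a s e = 1 := by
  unfold StateChannel.outE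
  rw [Finset.sum_comm]
  exact ch.sum_sum_trans a s

variable {ch} in
lemma StateChannel.letterLaw_nonneg {ν : S × A → ℝ} (hν : ν ∈ ch.inputLaws)
    (t : S × A × B × E) : 0 ≤ ch.letterLaw ν t :=
  mul_nonneg (hν.1 _) (ch.trans_nonneg _ _ _)

variable {ch} in
lemma StateChannel.sum_letterLaw {ν : S × A → ℝ} (hν : ν ∈ ch.inputLaws) :
    ∑ t, ch.letterLaw ν t = 1 := by
  simp only [Fintype.sum_prod_type, StateChannel.letterLaw, ← Finset.mul_sum,
    ch.sum_sum_trans, mul_one, hν.2]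
  exact ch.stateLaw_mem.2

/-- Given input and state, the law of the output is the channel, whatever ν. Hence this entropy is
linear in ν, and it is additive for blocks; both facts are needed because it enters with a minus
sign. -/
lemma StateChannel.condEntropy_letterLaw_B {ν : S × A → ℝ} (hν : ν ∈ ch.inputLaws) :
    condEntropy (ch.letterLaw ν) (fun t => t.2.2.1) (fun t => (t.2.1, t.1)) =
      ∑ t, ch.letterLaw ν t * -Real.logb 2 (ch.outB t.2.1 t.1 t.2.2.1) := by
  refine condEntropy_eq_of_factor (ch.letterLaw_nonneg hν) _ _
    (fun (z : A × S) b => ch.outB z.1 z.2 b) ?_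
  rintro b ⟨a, s⟩
  rw [marginal_eq_sum_of_equiv (κ := E) (e := ⟨fun y => (y.1.2.2, y.1.2.1, y.1.1, y.2),
    fun t => ((t.2.2.1, t.2.1, t.1), t.2.2.2), fun _ => rfl, fun _ => rfl⟩)
    (h := fun _ _ => rfl), marginal_eq_sum_of_equiv (κ := B × E)
    (e := ⟨fun y => (y.1.2, y.1.1, y.2.1, y.2.2),
    fun t => ((t.2.1, t.1), t.2.2.1, t.2.2.2), fun _ => rfl, fun _ => rfl⟩)
    (h := fun _ _ => rfl)]
  simp [StateChannel.letterLaw, Fintype.sum_prod_type, ← Finset.mul_sum, ch.sum_sum_trans,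
    StateChannel.outB]

lemma StateChannel.condEntropy_letterLaw_B_E {ν : S × A → ℝ} (hν : ν ∈ ch.inputLaws) :
    condEntropy (ch.letterLaw ν) (fun t => t.2.2.1) (fun t => (t.2.2.2, t.2.1, t.1)) =
      ∑ t, ch.letterLaw ν t * -Real.logb 2
        (ch.trans t.2.1 t.1 t.2.2 / ch.outE t.2.1 t.1 t.2.2.2) := by
  refine condEntropy_eq_of_factor (ch.letterLaw_nonneg hν) _ _
    (fun (z : E × A × S) b => ch.trans z.2.1 z.2.2 (b, z.1) / ch.outE z.2.1 z.2.2 z.1) ?_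
  rintro b ⟨e, a, s⟩
  rw [marginal_eq_sum_of_equiv (κ := Unit) (e := ⟨fun y => (y.1.2.2.2, y.1.2.2.1, y.1.1, y.1.2.1),
    fun t => ((t.2.2.1, t.2.2.2, t.2.1, t.1), ()), fun _ => rfl, fun _ => rfl⟩)
    (h := fun _ _ => rfl), marginal_eq_sum_of_equiv (κ := B)
    (e := ⟨fun y => (y.1.2.2, y.1.2.1, y.2, y.1.1),
    fun t => ((t.2.2.2, t.2.1, t.1), t.2.2.1), fun _ => rfl, fun _ => rfl⟩)
    (h := fun _ _ => rfl)]
  simp only [StateChannel.letterLaw, ← Finset.mul_sum, Finset.univ_unique,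
    Finset.sum_singleton, Equiv.coe_fn_mk]
  change ν (s, a) * ch.trans a s (b, e) = ν (s, a) * ch.outE a s e * _
  rw [mul_assoc, ch.outE_mul_div]

lemma StateChannel.condEntropy_letterLaw_E {ν : S × A → ℝ} (hν : ν ∈ ch.inputLaws) :
    condEntropy (ch.letterLaw ν) (fun t => t.2.2.2) (fun t => (t.2.1, t.1)) =
      ∑ t, ch.letterLaw ν t * -Real.logb 2 (ch.outE t.2.1 t.1 t.2.2.2) := by
  refine condEntropy_eq_of_factor (ch.letterLaw_nonneg hν) _ _
    (fun (z : A × S) e => ch.outE z.1 z.2 e) ?_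
  rintro e ⟨a, s⟩
  rw [marginal_eq_sum_of_equiv (κ := B) (e := ⟨fun y => (y.1.2.2, y.1.2.1, y.2, y.1.1),
    fun t => ((t.2.2.2, t.2.1, t.1), t.2.2.1), fun _ => rfl, fun _ => rfl⟩)
    (h := fun _ _ => rfl), marginal_eq_sum_of_equiv (κ := B × E)
    (e := ⟨fun y => (y.1.2, y.1.1, y.2.1, y.2.2),
    fun t => ((t.2.1, t.1), t.2.2.1, t.2.2.2), fun _ => rfl, fun _ => rfl⟩)
    (h := fun _ _ => rfl)]
  simp [StateChannel.letterLaw, Fintype.sum_prod_type, ← Finset.mul_sum, ch.sum_sum_trans,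
    StateChannel.outE]

lemma StateChannel.marginal_letterLaw_S {ν : S × A → ℝ} (hν : ν ∈ ch.inputLaws) (s : S) :
    marginal (ch.letterLaw ν) (fun t => t.1) s = ch.stateLaw s := by
  rw [marginal_eq_sum_of_equiv (κ := A × B × E) (e := Equiv.refl _) (h := fun _ _ => rfl)]
  simp [StateChannel.letterLaw, Fintype.sum_prod_type, ← Finset.mul_sum, ch.sum_sum_trans, hν.2]

lemma StateChannel.marginal_letterLaw_E (ν : S × A → ℝ) (e : E) :
    marginal (ch.letterLaw ν) (fun t => t.2.2.2) e =
      ∑ x : S × A, ν x * ch.outE x.2 x.1 e := by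
  rw [marginal_eq_sum_of_equiv (κ := (S × A) × B) (e := ⟨fun y => (y.2.1.1, y.2.1.2, y.2.2, y.1),
    fun t => (t.2.2.2, (t.1, t.2.1), t.2.2.1), fun _ => rfl, fun _ => rfl⟩)
    (h := fun _ _ => rfl), Fintype.sum_prod_type]
  simp [StateChannel.letterLaw, ← Finset.mul_sum, StateChannel.outE]

variable {ch} in
/-- Over a degraded channel, `I(A ; B | E, S) + H(S | E) = I(A ; B | S) + H(S) - I(A, S ; E)`. -/
lemma StateChannel.IsDegraded.secretInfo_eq (hdeg : ch.IsDegraded) {ν : S × A → ℝ}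
    (hν : ν ∈ ch.inputLaws) :
    secretInfo (ch.letterLaw ν) = infoAB_S (ch.letterLaw ν) + stateEntropy (ch.letterLaw ν) -
      (entropy (ch.letterLaw ν) (fun t => t.2.2.2) -
        condEntropy (ch.letterLaw ν) (fun t => t.2.2.2) (fun t => (t.2.1, t.1))) := by
  obtain ⟨V, hV, hW⟩ := hdeg
  set p := ch.letterLaw ν with hp
  have hp0 : ∀ t, 0 ≤ p t := ch.letterLaw_nonneg hν
  -- Degradedness: given B, the law of E is V, so H(E|S,A,B) and H(E|S,B) are the same expectation.
  have h1 : condEntropy p (fun t => t.2.2.2) (fun t => (t.1, t.2.1, t.2.2.1)) =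
      ∑ t, p t * -Real.logb 2 (V t.2.2.1 t.2.2.2) := by
    refine condEntropy_eq_of_factor hp0 _ _ (fun (z : S × A × B) e => V z.2.2 e) ?_
    rintro e ⟨s, a, b⟩
    rw [marginal_eq_sum_of_equiv (κ := Unit) (e := ⟨fun y => (y.1.2.1, y.1.2.2.1, y.1.2.2.2, y.1.1),
      fun t => ((t.2.2.2, t.1, t.2.1, t.2.2.1), ()), fun _ => rfl, fun _ => rfl⟩)
      (h := fun _ _ => rfl), marginal_eq_sum_of_equiv (κ := E)
      (e := ⟨fun y => (y.1.1, y.1.2.1, y.1.2.2, y.2),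
      fun t => ((t.1, t.2.1, t.2.2.1), t.2.2.2), fun _ => rfl, fun _ => rfl⟩)
      (h := fun _ _ => rfl)]
    simp only [hp, StateChannel.letterLaw, ← Finset.mul_sum, Finset.univ_unique,
      Finset.sum_singleton, Equiv.coe_fn_mk]
    change ν (s, a) * ch.trans a s (b, e) = ν (s, a) * _ * V b e
    rw [hW, mul_assoc]
  have h2 : condEntropy p (fun t => t.2.2.2) (fun t => (t.1, t.2.2.1)) =
      ∑ t, p t * -Real.logb 2 (V t.2.2.1 t.2.2.2) := by
    refine condEntropy_eq_of_factor hp0 _ _ (fun (z : S × B) e => V z.2 e) ?_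
    rintro e ⟨s, b⟩
    rw [marginal_eq_sum_of_equiv (κ := A) (e := ⟨fun y => (y.1.2.1, y.2, y.1.2.2, y.1.1),
      fun t => ((t.2.2.2, t.1, t.2.2.1), t.2.1), fun _ => rfl, fun _ => rfl⟩)
      (h := fun _ _ => rfl), marginal_eq_sum_of_equiv (κ := A × E)
      (e := ⟨fun y => (y.1.1, y.2.1, y.1.2, y.2.2),
      fun t => ((t.1, t.2.2.1), t.2.1, t.2.2.2), fun _ => rfl, fun _ => rfl⟩)
      (h := fun _ _ => rfl)]
    simp only [hp, StateChannel.letterLaw, ← Finset.mul_sum, Fintype.sum_prod_type,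
      Finset.sum_mul, Equiv.coe_fn_mk]
    refine Finset.sum_congr rfl fun a _ => ?_
    change ν (s, a) * ch.trans a s (b, e) = ν (s, a) * _ * V b e
    rw [hW, mul_assoc]
  have h3 := h1.trans h2.symm
  unfold secretInfo infoAB_S stateEntropy
  unfold condEntropy at h3 ⊢
  -- Expanded into joint entropies, the claim is linear in them once the tuples are put in a common
  -- order.
  have e1 : entropy p (fun ω : S × A × B × E => (ω.2.2.2, ω.1, ω.2.1, ω.2.2.1)) =
      entropy p (fun ω : S × A × B × E => (ω.2.2.1, ω.2.2.2, ω.2.1, ω.1)) :=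
    entropy_congr hp0 _ _ (fun y => (y.2.2.2, y.1, y.2.2.1, y.2.1))
      (fun y => (y.2.1, y.2.2.2, y.2.2.1, y.1)) (fun _ => rfl) (fun _ => rfl)
  have e2 : entropy p (fun ω : S × A × B × E => (ω.1, ω.2.1, ω.2.2.1)) =
      entropy p (fun ω : S × A × B × E => (ω.2.2.1, ω.2.1, ω.1)) :=
    entropy_congr hp0 _ _ (fun y => (y.2.2, y.2.1, y.1))
      (fun y => (y.2.2, y.2.1, y.1)) (fun _ => rfl) (fun _ => rfl)
  have e3 : entropy p (fun ω : S × A × B × E => (ω.2.2.2, ω.1, ω.2.2.1)) =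
      entropy p (fun ω : S × A × B × E => (ω.2.2.1, ω.2.2.2, ω.1)) :=
    entropy_congr hp0 _ _ (fun y => (y.2.2, y.1, y.2.1))
      (fun y => (y.2.1, y.2.2, y.1)) (fun _ => rfl) (fun _ => rfl)
  have e4 : entropy p (fun ω : S × A × B × E => (ω.1, ω.2.2.1)) =
      entropy p (fun ω : S × A × B × E => (ω.2.2.1, ω.1)) :=
    entropy_congr hp0 _ _ Prod.swap Prod.swap (fun _ => rfl) (fun _ => rfl)
  have e5 : entropy p (fun ω : S × A × B × E => (ω.2.2.2, ω.1)) =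
      entropy p (fun ω : S × A × B × E => (ω.1, ω.2.2.2)) :=
    entropy_congr hp0 _ _ Prod.swap Prod.swap (fun _ => rfl) (fun _ => rfl)
  linarith

lemma StateChannel.continuous_letterLaw : Continuous ch.letterLaw :=
  continuous_pi fun _ => (continuous_apply _).mul continuous_const

lemma StateChannel.isCompact_inputLaws : IsCompact ch.inputLaws := by
  have hsub : ch.inputLaws ⊆ stdSimplex ℝ (S × A) := fun ν hν =>
    ⟨hν.1, by
      rw [Fintype.sum_prod_type]
      simp only [hν.2]
      exact ch.stateLaw_mem.2⟩
  refine (isCompact_stdSimplex ℝ (S × A)).of_isClosed_subset ?_ hsub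
  have : ch.inputLaws = (⋂ x, {ν : S × A → ℝ | 0 ≤ ν x}) ∩
      ⋂ s, {ν : S × A → ℝ | ∑ a, ν (s, a) = ch.stateLaw s} := by
    ext ν
    simp [StateChannel.inputLaws]
  rw [this]
  refine (isClosed_iInter fun x => isClosed_le continuous_const (continuous_apply x)).inter
    (isClosed_iInter fun s => isClosed_eq ?_ continuous_const)
  exact continuous_finsetSum _ fun a _ => continuous_apply _

end singleLetter

/-! ### Replacing the auxiliary variable by the channel input. -/

section auxiliary

variable {S A B E U : Type*} [Fintype S] [Fintype A] [Fintype B] [Fintype E] [Fintype U]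

/-- Definitional restatements with projections in place of pattern-matching functions, so that
rewriting applies. -/
lemma infoUB_S_eq (P : S × U × A × B × E → ℝ) : infoUB_S P =
    entropy P (fun t => (t.2.1, t.1)) - entropy P (fun t => t.1) -
      (entropy P (fun t => (t.2.1, t.2.2.2.1, t.1)) - entropy P (fun t => (t.2.2.2.1, t.1))) :=
  rfl

lemma infoUB_ES_eq (P : S × U × A × B × E → ℝ) : infoUB_ES P =
    entropy P (fun t => (t.2.1, t.2.2.2.2, t.1)) - entropy P (fun t => (t.2.2.2.2, t.1)) -
      (entropy P (fun t => (t.2.1, t.2.2.2.1, t.2.2.2.2, t.1)) -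
        entropy P (fun t => (t.2.2.2.1, t.2.2.2.2, t.1))) :=
  rfl

lemma entropyS_E_eq (P : S × U × A × B × E → ℝ) : entropyS_E P =
    condEntropy P (fun t => t.1) (fun t => t.2.2.2.2) :=
  rfl

lemma entropyS_eq (P : S × U × A × B × E → ℝ) : entropyS P = entropy P (fun t => t.1) :=
  rfl

/-- The law of `(S, A, B, E)`. -/
noncomputable def forgetAux (P : S × U × A × B × E → ℝ) : S × A × B × E → ℝ :=
  marginal P (fun t => (t.1, t.2.2))

lemma infoAB_S_forgetAux (P : S × U × A × B × E → ℝ) : infoAB_S (forgetAux P) =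
    condEntropy P (fun t => t.2.2.2.1) (fun t => t.1) -
      condEntropy P (fun t => t.2.2.2.1) (fun t => (t.2.2.1, t.1)) := by
  unfold infoAB_S forgetAux
  rw [condEntropy_marginal, condEntropy_marginal]

lemma secretInfo_forgetAux (P : S × U × A × B × E → ℝ) : secretInfo (forgetAux P) =
    condEntropy P (fun t => t.2.2.2.1) (fun t => (t.2.2.2.2, t.1)) -
      condEntropy P (fun t => t.2.2.2.1) (fun t => (t.2.2.2.2, t.2.2.1, t.1)) +
      condEntropy P (fun t => t.1) (fun t => t.2.2.2.2) := by
  unfold secretInfo forgetAux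
  rw [condEntropy_marginal, condEntropy_marginal, condEntropy_marginal]

lemma stateEntropy_forgetAux (P : S × U × A × B × E → ℝ) :
    stateEntropy (forgetAux P) = entropyS P := by
  unfold stateEntropy forgetAux
  rw [entropy_marginal, entropyS_eq]

/-- Symmetry of mutual information; the Markov property bears on the entropies of the output B. -/
lemma infoUB_S_eq_output {P : S × U × A × B × E → ℝ} (hP : ∀ t, 0 ≤ P t) : infoUB_S P =
    condEntropy P (fun t => t.2.2.2.1) (fun t => t.1) -
      condEntropy P (fun t => t.2.2.2.1) (fun t => (t.2.1, t.1)) := by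
  rw [infoUB_S_eq]
  unfold condEntropy
  rw [entropy_congr hP (fun t => (t.2.1, t.2.2.2.1, t.1)) (fun t => (t.2.2.2.1, t.2.1, t.1))
    (fun y => (y.2.1, y.1, y.2.2)) (fun y => (y.2.1, y.1, y.2.2)) (fun _ => rfl) (fun _ => rfl)]
  ring

lemma infoUB_ES_eq_output {P : S × U × A × B × E → ℝ} (hP : ∀ t, 0 ≤ P t) : infoUB_ES P =
    condEntropy P (fun t => t.2.2.2.1) (fun t => (t.2.2.2.2, t.1)) -
      condEntropy P (fun t => t.2.2.2.1) (fun t => (t.2.2.2.2, t.2.1, t.1)) := by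
  rw [infoUB_ES_eq]
  unfold condEntropy
  rw [entropy_congr hP (fun t => (t.2.1, t.2.2.2.1, t.2.2.2.2, t.1))
    (fun t => (t.2.2.2.1, t.2.2.2.2, t.2.1, t.1))
    (fun y => (y.2.1, y.2.2.1, y.1, y.2.2.2)) (fun y => (y.2.2.1, y.1, y.2.1, y.2.2.2))
    (fun _ => rfl) (fun _ => rfl),
    entropy_congr hP (fun t => (t.2.1, t.2.2.2.2, t.1)) (fun t => (t.2.2.2.2, t.2.1, t.1))
    (fun y => (y.2.1, y.1, y.2.2)) (fun y => (y.2.1, y.1, y.2.2)) (fun _ => rfl) (fun _ => rfl)]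
  ring

variable {ch : StateChannel S A B E}

/-- The auxiliary variable may be replaced by the channel input. -/
lemma StateChannel.IsAdmissible.exists_inputLaw {P : S × U × A × B × E → ℝ}
    (hP : ch.IsAdmissible P) :
    ∃ ν ∈ ch.inputLaws, marginal (ch.letterLaw ν) (fun t => t.2.2.2) = ch.wardenIdle ∧
      infoUB_S P ≤ infoAB_S (ch.letterLaw ν) ∧
      infoUB_ES P + entropyS_E P ≤ secretInfo (ch.letterLaw ν) ∧
      entropyS P = stateEntropy (ch.letterLaw ν) := by
  obtain ⟨⟨PU, PA, hPU, hPA, hfac⟩, hE⟩ := hP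
  set π : S → U → A → ℝ := fun s u a => ch.stateLaw s * PU s u * PA u s a
  have hπ : ∀ s u a, 0 ≤ π s u a := fun s u a =>
    mul_nonneg (mul_nonneg (ch.stateLaw_mem.1 s) ((hPU s).1 u)) ((hPA u s).1 a)
  have hP0 : ∀ t, 0 ≤ P t := by
    rintro ⟨s, u, a, b, e⟩
    rw [hfac]
    exact mul_nonneg (hπ s u a) (ch.trans_nonneg _ _ _)
  have hfor : forgetAux P = ch.letterLaw (fun x => ∑ u, π x.1 u x.2) := by
    funext ⟨s, a, b, e⟩
    unfold forgetAux
    rw [marginal_eq_sum_of_equiv (κ := U) (e := ⟨fun y => (y.1.1, y.2, y.1.2),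
      fun t => ((t.1, t.2.2), t.2.1), fun _ => rfl, fun _ => rfl⟩) (h := fun _ _ => rfl)]
    simp only [StateChannel.letterLaw, Equiv.coe_fn_mk, hfac, Finset.sum_mul, π]
  refine ⟨fun x => ∑ u, π x.1 u x.2, ⟨fun x => Finset.sum_nonneg fun u _ => hπ _ _ _, ?_⟩, ?_⟩
  · intro s
    simp only [π]
    rw [Finset.sum_comm]
    simp only [← Finset.mul_sum, (hPA _ _).2, (hPU _).2, mul_one]
  rw [← hfor, infoAB_S_forgetAux, secretInfo_forgetAux, stateEntropy_forgetAux, entropyS_E_eq,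
    infoUB_S_eq_output hP0, infoUB_ES_eq_output hP0]
  refine ⟨?_, ?_, ?_, rfl⟩
  · unfold forgetAux
    rw [marginal_marginal]
    exact hE
  -- Markov chain: B has the same conditional law given (A, S) and given (U, A, S), so H(B|A,S) =
  -- H(B|U,A,S) ≤ H(B|U,S). The bound with E added to the conditioning goes the same way.
  · have h1 : condEntropy P (fun t => t.2.2.2.1) (fun t => (t.2.2.1, t.1)) =
        ∑ t, P t * -Real.logb 2 (ch.outB t.2.2.1 t.1 t.2.2.2.1) := by
      refine condEntropy_eq_of_factor hP0 _ _
        (fun (z : A × S) b => ch.outB z.1 z.2 b) ?_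
      rintro b ⟨a, s⟩
      rw [marginal_eq_sum_of_equiv (κ := U × E)
        (e := ⟨fun y => (y.1.2.2, y.2.1, y.1.2.1, y.1.1, y.2.2),
        fun t => ((t.2.2.2.1, t.2.2.1, t.1), (t.2.1, t.2.2.2.2)), fun _ => rfl, fun _ => rfl⟩)
        (h := fun _ _ => rfl), marginal_eq_sum_of_equiv (κ := U × B × E)
        (e := ⟨fun y => (y.1.2, y.2.1, y.1.1, y.2.2),
        fun t => ((t.2.2.1, t.1), (t.2.1, t.2.2.2)), fun _ => rfl, fun _ => rfl⟩)
        (h := fun _ _ => rfl)]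
      simp only [Equiv.coe_fn_mk, hfac, Fintype.sum_prod_type, ← Finset.mul_sum,
        ch.sum_sum_trans, mul_one, Finset.sum_mul]
      rfl
    have h2 : condEntropy P (fun t => t.2.2.2.1) (fun t => (t.2.1, t.2.2.1, t.1)) =
        ∑ t, P t * -Real.logb 2 (ch.outB t.2.2.1 t.1 t.2.2.2.1) := by
      refine condEntropy_eq_of_factor hP0 _ _ (fun (z : U × A × S) b => ch.outB z.2.1 z.2.2 b) ?_
      rintro b ⟨u, a, s⟩
      rw [marginal_eq_sum_of_equiv (κ := E)
        (e := ⟨fun y => (y.1.2.2.2, y.1.2.1, y.1.2.2.1, y.1.1, y.2),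
        fun t => ((t.2.2.2.1, t.2.1, t.2.2.1, t.1), t.2.2.2.2), fun _ => rfl, fun _ => rfl⟩)
        (h := fun _ _ => rfl), marginal_eq_sum_of_equiv (κ := B × E)
        (e := ⟨fun y => (y.1.2.2, y.1.1, y.1.2.1, y.2),
        fun t => ((t.2.1, t.2.2.1, t.1), t.2.2.2), fun _ => rfl, fun _ => rfl⟩)
        (h := fun _ _ => rfl)]
      simp only [Equiv.coe_fn_mk, hfac, Fintype.sum_prod_type, ← Finset.mul_sum,
        ch.sum_sum_trans, mul_one]
      rfl
    have h3 := condEntropy_le_comp hP0 (fun t => t.2.2.2.1) (fun t => (t.2.1, t.2.2.1, t.1))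
      (fun y => (y.1, y.2.2))
    dsimp only at h3
    linarith
  · have h1 : condEntropy P (fun t => t.2.2.2.1) (fun t => (t.2.2.2.2, t.2.2.1, t.1)) =
        ∑ t, P t * -Real.logb 2 (ch.trans t.2.2.1 t.1 t.2.2.2 / ch.outE t.2.2.1 t.1 t.2.2.2.2) := by
      refine condEntropy_eq_of_factor hP0 _ _
        (fun (z : E × A × S) b => ch.trans z.2.1 z.2.2 (b, z.1) / ch.outE z.2.1 z.2.2 z.1) ?_
      rintro b ⟨e, a, s⟩
      rw [marginal_eq_sum_of_equiv (κ := U)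
        (e := ⟨fun y => (y.1.2.2.2, y.2, y.1.2.2.1, y.1.1, y.1.2.1),
        fun t => ((t.2.2.2.1, t.2.2.2.2, t.2.2.1, t.1), t.2.1), fun _ => rfl, fun _ => rfl⟩)
        (h := fun _ _ => rfl), marginal_eq_sum_of_equiv (κ := U × B)
        (e := ⟨fun y => (y.1.2.2, y.2.1, y.1.2.1, y.2.2, y.1.1),
        fun t => ((t.2.2.2.2, t.2.2.1, t.1), (t.2.1, t.2.2.2.1)), fun _ => rfl, fun _ => rfl⟩)
        (h := fun _ _ => rfl)]
      simp only [Equiv.coe_fn_mk, hfac, Fintype.sum_prod_type, ← Finset.mul_sum, Finset.sum_mul]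
      refine Finset.sum_congr rfl fun u _ => ?_
      change _ = _ * ch.outE a s e * _
      rw [mul_assoc _ (ch.outE a s e), ch.outE_mul_div]
    have h2 : condEntropy P (fun t => t.2.2.2.1) (fun t => (t.2.2.2.2, t.2.1, t.2.2.1, t.1)) =
        ∑ t, P t * -Real.logb 2 (ch.trans t.2.2.1 t.1 t.2.2.2 / ch.outE t.2.2.1 t.1 t.2.2.2.2) := by
      refine condEntropy_eq_of_factor hP0 _ _ (fun (z : E × U × A × S) b =>
        ch.trans z.2.2.1 z.2.2.2 (b, z.1) / ch.outE z.2.2.1 z.2.2.2 z.1) ?_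
      rintro b ⟨e, u, a, s⟩
      rw [marginal_eq_sum_of_equiv (κ := Unit)
        (e := ⟨fun y => (y.1.2.2.2.2, y.1.2.2.1, y.1.2.2.2.1, y.1.1, y.1.2.1),
        fun t => ((t.2.2.2.1, t.2.2.2.2, t.2.1, t.2.2.1, t.1), ()), fun _ => rfl, fun _ => rfl⟩)
        (h := fun _ _ => rfl), marginal_eq_sum_of_equiv (κ := B)
        (e := ⟨fun y => (y.1.2.2.2, y.1.2.1, y.1.2.2.1, y.2, y.1.1),
        fun t => ((t.2.2.2.2, t.2.1, t.2.2.1, t.1), t.2.2.2.1), fun _ => rfl, fun _ => rfl⟩)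
        (h := fun _ _ => rfl)]
      simp only [Equiv.coe_fn_mk, hfac, ← Finset.mul_sum, Finset.univ_unique,
        Finset.sum_singleton]
      change _ = _ * ch.outE a s e * _
      rw [mul_assoc _ (ch.outE a s e), ch.outE_mul_div]
    have h3 := condEntropy_le_comp hP0 (fun t => t.2.2.2.1)
      (fun t => (t.2.2.2.2, t.2.1, t.2.2.1, t.1)) (fun y => (y.1, y.2.1, y.2.2.2))
    dsimp only at h3
    linarith

/-- The channel input may serve as the auxiliary variable. -/
lemma StateChannel.exists_isAdmissible {ν : S × A → ℝ} (hν : ν ∈ ch.inputLaws)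
    (hE : marginal (ch.letterLaw ν) (fun t => t.2.2.2) = ch.wardenIdle) :
    ∃ (k : ℕ) (P : S × Fin k × A × B × E → ℝ), ch.IsAdmissible P ∧
      infoUB_S P = infoAB_S (ch.letterLaw ν) ∧
      infoUB_ES P + entropyS_E P = secretInfo (ch.letterLaw ν) ∧
      entropyS P = stateEntropy (ch.letterLaw ν) := by
  classical
  -- Auxiliary alphabets in the theorem are of the form `Fin k`, so the input alphabet is
  -- transported there.
  set φ := Fintype.equivFin A
  set p := ch.letterLaw ν with hp
  have hp0 : ∀ t, 0 ≤ p t := ch.letterLaw_nonneg hν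
  set P : S × Fin (Fintype.card A) × A × B × E → ℝ :=
    marginal p (fun t => (t.1, φ t.2.1, t.2)) with hPdef
  have hP0 : ∀ t, 0 ≤ P t := fun t => marginal_nonneg hp0 _ _
  have hPval : ∀ s u a b e, P (s, u, a, b, e) =
      if φ a = u then ν (s, a) * ch.trans a s (b, e) else 0 := by
    intro s u a b e
    rw [hPdef]
    unfold marginal
    rw [Finset.sum_eq_single (s, a, b, e)]
    · simp [hp, StateChannel.letterLaw]
    · rintro ⟨s', a', b', e'⟩ _ h
      rw [if_neg]
      rintro h'
      simp only [Prod.mk.injEq] at h'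
      exact h (by rw [h'.1, h'.2.2.1, h'.2.2.2.1, h'.2.2.2.2])
    · simp
  -- On null states the conditional law of U is arbitrary; the innocent law is a distribution always
  -- at hand.
  refine ⟨Fintype.card A, P, ⟨⟨fun s u => if ch.stateLaw s = 0 then ch.innocent (φ.symm u)
    else ν (s, φ.symm u) / ch.stateLaw s, fun u _ a => if φ a = u then 1 else 0, ?_, ?_, ?_⟩, ?_⟩,
    ?_, ?_, ?_⟩
  · intro s
    dsimp only
    split_ifs with h
    · exact ⟨fun u => ch.innocent_mem.1 _,
        (φ.symm.sum_comp ch.innocent).trans ch.innocent_mem.2⟩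
    · refine ⟨fun u => div_nonneg (hν.1 _) (ch.stateLaw_mem.1 s), ?_⟩
      rw [← Finset.sum_div, φ.symm.sum_comp (fun a => ν (s, a)), hν.2, div_self h]
  · intro u _
    refine ⟨fun a => by dsimp only; split_ifs <;> norm_num, ?_⟩
    rw [Finset.sum_eq_single (φ.symm u)]
    · simp
    · intro a _ h
      exact if_neg fun h' => h (by rw [← h', Equiv.symm_apply_apply])
    · simp
  · intro s u a b e
    rw [hPval]
    dsimp only
    by_cases h : φ a = u
    · subst h
      simp only [if_true, Equiv.symm_apply_apply, mul_one]
      congr 1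
      split_ifs with h0
      · rw [h0, zero_mul]
        have h1 := Finset.single_le_sum (f := fun a => ν (s, a)) (fun a _ => hν.1 (s, a))
          (Finset.mem_univ a)
        rw [hν.2, h0] at h1
        exact le_antisymm h1 (hν.1 _)
      · field_simp
    · simp [h]
  · rw [hPdef, marginal_marginal]
    exact hE
  · rw [infoUB_S_eq_output hP0, hPdef, condEntropy_marginal, condEntropy_marginal]
    unfold infoAB_S condEntropy
    rw [entropy_congr hp0 (fun t => (t.2.2.1, φ t.2.1, t.1)) (fun t => (t.2.2.1, t.2.1, t.1))
      (fun y => (y.1, φ.symm y.2.1, y.2.2)) (fun y => (y.1, φ y.2.1, y.2.2))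
      (fun _ => by simp) (fun _ => rfl),
      entropy_congr hp0 (fun t => (φ t.2.1, t.1)) (fun t => (t.2.1, t.1))
      (fun y => (φ.symm y.1, y.2)) (fun y => (φ y.1, y.2)) (fun _ => by simp) (fun _ => rfl)]
  · rw [infoUB_ES_eq_output hP0, entropyS_E_eq, hPdef, condEntropy_marginal, condEntropy_marginal,
      condEntropy_marginal]
    unfold secretInfo condEntropy
    rw [entropy_congr hp0 (fun t => (t.2.2.1, t.2.2.2, φ t.2.1, t.1))
      (fun t => (t.2.2.1, t.2.2.2, t.2.1, t.1))
      (fun y => (y.1, y.2.1, φ.symm y.2.2.1, y.2.2.2)) (fun y => (y.1, y.2.1, φ y.2.2.1, y.2.2.2))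
      (fun _ => by simp) (fun _ => rfl),
      entropy_congr hp0 (fun t => (t.2.2.2, φ t.2.1, t.1)) (fun t => (t.2.2.2, t.2.1, t.1))
      (fun y => (y.1, φ.symm y.2.1, y.2.2)) (fun y => (y.1, φ y.2.1, y.2.2))
      (fun _ => by simp) (fun _ => rfl)]
  · rw [entropyS_eq, hPdef, entropy_marginal]
    rfl

end auxiliary

/-! ### Outputs of the memoryless channel over a block. -/

section blockLaw

variable {S A B E Θ : Type*} [Fintype S] [Fintype A] [Fintype B] [Fintype E] [Fintype Θ] {n : ℕ}

lemma StateChannel.sum_wardenIdle (ch : StateChannel S A B E) : ∑ e, ch.wardenIdle e = 1 := by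
  have h : ∀ e, ch.wardenIdle e = ∑ s, ∑ a, ch.stateLaw s * ch.innocent a * ch.outE a s e := by
    intro e
    simp only [StateChannel.wardenIdle, StateChannel.outE, Finset.mul_sum]
  simp only [h]
  rw [Finset.sum_comm]
  simp only [fun s => Finset.sum_comm (s := (Finset.univ : Finset E)) (t := Finset.univ)
    (f := fun e a => ch.stateLaw s * ch.innocent a * ch.outE a s e), ← Finset.mul_sum,
    ch.sum_outE, mul_one, ch.innocent_mem.2, ch.stateLaw_mem.2]

/-- The law of `(Θ, Bⁿ, Eⁿ)` when `Θ` is distributed as `π` and the states and the inputs are the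
functions `s` and `a` of `Θ`. -/
noncomputable def StateChannel.blockLaw (ch : StateChannel S A B E) (π : Θ → ℝ)
    (s : Θ → Fin n → S) (a : Θ → Fin n → A) : Θ × (Fin n → B) × (Fin n → E) → ℝ :=
  fun ω => π ω.1 * ∏ i, ch.trans (a ω.1 i) (s ω.1 i) (ω.2.1 i, ω.2.2 i)

/-- The letters `(Sᵢ, Aᵢ, Bᵢ, Eᵢ)`. -/
def letter (s : Θ → Fin n → S) (a : Θ → Fin n → A) (i : Fin n)
    (ω : Θ × (Fin n → B) × (Fin n → E)) : S × A × B × E :=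
  (s ω.1 i, a ω.1 i, ω.2.1 i, ω.2.2 i)

/-- The average law of the letters `(Sᵢ, Aᵢ)`. -/
noncomputable def inputAverage (π : Θ → ℝ) (s : Θ → Fin n → S) (a : Θ → Fin n → A) : S × A → ℝ :=
  letterAverage π (fun i θ => (s θ i, a θ i))

variable (ch : StateChannel S A B E) {π : Θ → ℝ} (s : Θ → Fin n → S) (a : Θ → Fin n → A)

omit [Fintype Θ] in
lemma StateChannel.blockLaw_nonneg (hπ : ∀ θ, 0 ≤ π θ) (ω) : 0 ≤ ch.blockLaw π s a ω :=
  mul_nonneg (hπ _) (Finset.prod_nonneg fun _ _ => ch.trans_nonneg _ _ _)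

lemma StateChannel.sum_prod_trans (x : Fin n → S) (y : Fin n → A) :
    ∑ b : Fin n → B, ∑ e : Fin n → E, ∏ i, ch.trans (y i) (x i) (b i, e i) = 1 := by
  rw [sum_prod_pi_pair (fun i b e => ch.trans (y i) (x i) (b, e))]
  simp [ch.sum_sum_trans]

lemma StateChannel.marginal_blockLaw (θ : Θ) :
    marginal (ch.blockLaw π s a) (fun ω => ω.1) θ = π θ := by
  rw [marginal_eq_sum_of_equiv (κ := (Fin n → B) × (Fin n → E)) (e := Equiv.refl _)
    (h := fun _ _ => rfl)]
  simp only [StateChannel.blockLaw, Equiv.refl_apply, ← Finset.mul_sum, Fintype.sum_prod_type,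
    ch.sum_prod_trans, mul_one]

lemma StateChannel.sum_blockLaw (hπ1 : ∑ θ, π θ = 1) : ∑ ω, ch.blockLaw π s a ω = 1 := by
  rw [← sum_marginal _ (fun ω => ω.1)]
  simp only [ch.marginal_blockLaw, hπ1]

/-- Given Θ, the outputs at all times other than i sum out to one and leave one use of the channel
on (Sᵢ, Aᵢ). -/
lemma StateChannel.letterAverage_blockLaw :
    letterAverage (ch.blockLaw π s a) (letter s a) = ch.letterLaw (inputAverage π s a) := by
  classical
  funext ⟨s', a', b', e'⟩
  simp only [letterAverage, StateChannel.letterLaw, inputAverage, mul_assoc, Finset.sum_mul]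
  congr 1
  refine Finset.sum_congr rfl fun i _ => ?_
  rw [marginal_apply, marginal_apply, Fintype.sum_prod_type, Finset.sum_mul]
  refine Finset.sum_congr rfl fun θ _ => ?_
  rw [Fintype.sum_prod_type]
  have h : ∀ (b : Fin n → B) (e : Fin n → E),
      (if letter s a i (θ, b, e) = (s', a', b', e') then ch.blockLaw π s a (θ, b, e) else 0) =
      (if (s θ i, a θ i) = (s', a') then π θ else 0) *
      ((∏ j, ch.trans (a θ j) (s θ j) (b j, e j)) *
        (if b i = b' ∧ e i = e' then 1 else 0)) := by
    intro b e
    simp only [letter, StateChannel.blockLaw, Prod.mk.injEq]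
    split_ifs <;> simp_all
  simp only [h, ← Finset.mul_sum]
  rw [sum_prod_mul_coord_pair (fun j b e => ch.trans (a θ j) (s θ j) (b, e))
    (fun j => ch.sum_sum_trans _ _) i (fun b e => if b = b' ∧ e = e' then 1 else 0)]
  simp only [ite_and, mul_ite, mul_one, mul_zero, Prod.mk.injEq]
  have h2 : ∀ x, (∑ y : E, if x = b' then if y = e' then ch.trans (a θ i) (s θ i) (x, y) else 0
      else 0) = if x = b' then ch.trans (a θ i) (s θ i) (x, e') else 0 := by
    intro x
    split_ifs <;> simp
  simp only [h2, Finset.sum_ite_eq', Finset.mem_univ, if_true]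
  split_ifs with h3 h4
  · rw [h3, h4]
  all_goals simp

lemma inputAverage_mem (hn : 0 < n) (hπ : ∀ θ, 0 ≤ π θ)
    (hs : ∀ i x, marginal π (fun θ => s θ i) x = ch.stateLaw x) :
    inputAverage π s a ∈ ch.inputLaws := by
  refine ⟨fun x => letterAverage_nonneg hπ _ x, fun x => ?_⟩
  have hn' : (n : ℝ) ≠ 0 := by exact_mod_cast hn.ne'
  have h : ∀ i, ∑ y, marginal π (fun θ => (s θ i, a θ i)) (x, y) = ch.stateLaw x := by
    intro i
    rw [← hs i x, ← sum_marginal_prod_left π (fun θ => a θ i) (fun θ => s θ i) x]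
    refine Finset.sum_congr rfl fun y _ => ?_
    classical
    simp only [marginal_apply, Prod.mk.injEq, and_comm]
  simp only [inputAverage, letterAverage, ← Finset.mul_sum]
  rw [Finset.sum_comm]
  simp only [h, Finset.sum_const, Finset.card_univ, Fintype.card_fin, nsmul_eq_mul]
  field_simp

/-- An equality, since given Θ the outputs are independent with the channel laws: −log of the block
law is exactly additive. -/
lemma StateChannel.condEntropy_blockLaw_B (hn : 0 < n) (hπ : ∀ θ, 0 ≤ π θ)
    (hν : inputAverage π s a ∈ ch.inputLaws) :
    condEntropy (ch.blockLaw π s a) (fun ω => ω.2.1) (fun ω => ω.1) =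
      n * condEntropy (ch.letterLaw (inputAverage π s a)) (fun t => t.2.2.1)
        (fun t => (t.2.1, t.1)) := by
  have hp := ch.blockLaw_nonneg s a hπ
  rw [ch.condEntropy_letterLaw_B hν, ← ch.letterAverage_blockLaw, ← sum_letters hn,
    condEntropy_eq_of_factor hp (fun ω => ω.2.1) (fun ω => ω.1)
      (fun θ b => ∏ i, ch.outB (a θ i) (s θ i) (b i))]
  · refine Finset.sum_congr rfl fun ω _ => ?_
    rcases (hp ω).eq_or_lt with h | h
    · simp [← h]
    · rw [neg_logb_prod]
      · rfl
      · intro i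
        refine lt_of_lt_of_le (lt_of_le_of_ne (ch.trans_nonneg _ _ _) fun h0 => h.ne' ?_)
          (ch.trans_le_outB (a ω.1 i) (s ω.1 i) (ω.2.1 i) (ω.2.2 i))
        exact mul_eq_zero_of_right _ (Finset.prod_eq_zero (Finset.mem_univ i) h0.symm)
  · intro b θ
    rw [ch.marginal_blockLaw, marginal_eq_sum_of_equiv (κ := Fin n → E)
      (e := ⟨fun y => (y.1.2, y.1.1, y.2), fun t => ((t.2.1, t.1), t.2.2), fun _ => rfl,
      fun _ => rfl⟩) (h := fun _ _ => rfl)]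
    simp only [Equiv.coe_fn_mk, StateChannel.blockLaw, ← Finset.mul_sum]
    rw [sum_prod_pi (fun i e => ch.trans (a θ i) (s θ i) (b i, e))]
    rfl

lemma StateChannel.condEntropy_blockLaw_B_E (hn : 0 < n) (hπ : ∀ θ, 0 ≤ π θ)
    (hν : inputAverage π s a ∈ ch.inputLaws) :
    condEntropy (ch.blockLaw π s a) (fun ω => ω.2.1) (fun ω => (ω.2.2, ω.1)) =
      n * condEntropy (ch.letterLaw (inputAverage π s a)) (fun t => t.2.2.1)
        (fun t => (t.2.2.2, t.2.1, t.1)) := by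
  have hp := ch.blockLaw_nonneg s a hπ
  rw [ch.condEntropy_letterLaw_B_E hν, ← ch.letterAverage_blockLaw, ← sum_letters hn,
    condEntropy_eq_of_factor hp (fun ω => ω.2.1) (fun ω => (ω.2.2, ω.1))
      (fun z b => ∏ i, (ch.trans (a z.2 i) (s z.2 i) (b i, z.1 i) /
        ch.outE (a z.2 i) (s z.2 i) (z.1 i)))]
  · refine Finset.sum_congr rfl fun ω _ => ?_
    rcases (hp ω).eq_or_lt with h | h
    · simp [← h]
    · rw [neg_logb_prod]
      · rfl
      · intro i
        have h1 : 0 < ch.trans (a ω.1 i) (s ω.1 i) (ω.2.1 i, ω.2.2 i) :=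
          lt_of_le_of_ne (ch.trans_nonneg _ _ _) fun h0 => h.ne'
            (mul_eq_zero_of_right _ (Finset.prod_eq_zero (Finset.mem_univ i) h0.symm))
        exact div_pos h1 (h1.trans_le
          (ch.trans_le_outE (a ω.1 i) (s ω.1 i) (ω.2.1 i) (ω.2.2 i)))
  · rintro b ⟨e, θ⟩
    rw [marginal_eq_sum_of_equiv (κ := Unit)
      (e := ⟨fun y => (y.1.2.2, y.1.1, y.1.2.1), fun t => ((t.2.1, t.2.2, t.1), ()), fun _ => rfl,
      fun _ => rfl⟩) (h := fun _ _ => rfl), marginal_eq_sum_of_equiv (κ := Fin n → B)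
      (e := ⟨fun y => (y.1.2, y.2, y.1.1), fun t => ((t.2.2, t.1), t.2.1), fun _ => rfl,
      fun _ => rfl⟩) (h := fun _ _ => rfl)]
    simp only [Equiv.coe_fn_mk, StateChannel.blockLaw, ← Finset.mul_sum, Finset.univ_unique,
      Finset.sum_singleton]
    rw [sum_prod_pi (fun i b => ch.trans (a θ i) (s θ i) (b, e i)), mul_assoc,
      ← Finset.prod_mul_distrib]
    congr 1
    exact Finset.prod_congr rfl fun i _ => (ch.outE_mul_div _ _ _ _).symm

end blockLaw

/-! ### Converse bounds for a single code. -/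

section converse

variable {Ω α β γ δ : Type*} [Fintype Ω] [Fintype α] [Fintype β] [Fintype γ] [Fintype δ]

/-- By the chain rule, the bound is H(Y|D) ≤ H(Y|f,g) in disguise. With Y = Bⁿ it yields all three
converse bounds, for (f, g) = (M, Sⁿ), ((M,K), Sⁿ) and (K, (Eⁿ,Sⁿ)). -/
lemma entropy_le_of_output {p : Ω → ℝ} (hp : ∀ ω, 0 ≤ p ω) (Y : Ω → β) (D : Ω → δ) (f : δ → α)
    (g : δ → γ) : entropy p (fun ω => (f (D ω), g (D ω))) ≤
      entropy p (fun ω => (Y ω, g (D ω))) - condEntropy p Y D +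
        condEntropy p (fun ω => f (D ω)) (fun ω => (Y ω, g (D ω))) := by
  have h1 := condEntropy_le_comp hp Y D (fun d => (f d, g d))
  unfold condEntropy at h1 ⊢
  have h2 := entropy_congr hp (fun ω => (Y ω, f (D ω), g (D ω)))
    (fun ω => (f (D ω), Y ω, g (D ω))) (fun y => (y.2.1, y.1, y.2.2))
    (fun y => (y.2.1, y.1, y.2.2)) (fun _ => rfl) (fun _ => rfl)
  linarith

lemma condEntropy_fst_le {p : Ω → ℝ} (hp : ∀ ω, 0 ≤ p ω) (X : Ω → α) (Z : Ω → γ) (f : α → β) :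
    condEntropy p (fun ω => f (X ω)) Z ≤ condEntropy p X Z :=
  sub_le_sub_right (entropy_comp_le hp (fun ω => (X ω, Z ω)) (fun y => (f y.1, y.2))) _

variable {S A B E : Type*} [Fintype S] [Fintype A] [Fintype B] [Fintype E] {n M K : ℕ}

/-- The law of the message, the states, the inputs and the key. -/
noncomputable def Code.inputLaw (c : Code S A B n M K) (ch : StateChannel S A B E) :
    Fin M × (Fin n → S) × (Fin n → A) × Fin K → ℝ :=
  fun θ => (1 / (M : ℝ)) * (∏ i, ch.stateLaw (θ.2.1 i)) * c.enc θ.1 θ.2.1 (θ.2.2.1, θ.2.2.2)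

/-- The law of the message, the states, the inputs, the key, and the outputs. -/
noncomputable def Code.outputLaw (c : Code S A B n M K) (ch : StateChannel S A B E) :
    (Fin M × (Fin n → S) × (Fin n → A) × Fin K) × (Fin n → B) × (Fin n → E) → ℝ :=
  ch.blockLaw (c.inputLaw ch) (fun θ => θ.2.1) (fun θ => θ.2.2.1)

variable (c : Code S A B n M K) (ch : StateChannel S A B E)

/-- Regrouping the variables of `Code.law`. -/
def lawEquiv : ((Fin M × (Fin n → S) × (Fin n → A) × Fin K) × (Fin n → B) × (Fin n → E)) ×
    (Fin M × Fin K) ≃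
    Fin M × (Fin n → S) × (Fin n → A) × Fin K × (Fin n → B) × (Fin n → E) × Fin M × Fin K :=
  ⟨fun y => (y.1.1.1, y.1.1.2.1, y.1.1.2.2.1, y.1.1.2.2.2, y.1.2.1, y.1.2.2, y.2),
    fun t => (((t.1, t.2.1, t.2.2.1, t.2.2.2.1), t.2.2.2.2.1, t.2.2.2.2.2.1), t.2.2.2.2.2.2),
    fun _ => rfl, fun _ => rfl⟩

lemma Code.law_lawEquiv (ω) (y : Fin M × Fin K) : c.law ch (lawEquiv (ω, y)) =
    c.outputLaw ch ω * c.dec ω.2.1 ω.1.2.1 y :=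
  rfl

lemma Code.marginal_law : marginal (c.law ch)
    (fun t => ((t.1, t.2.1, t.2.2.1, t.2.2.2.1), t.2.2.2.2.1, t.2.2.2.2.2.1)) =
      c.outputLaw ch := by
  funext ω
  rw [marginal_eq_sum_of_equiv (e := lawEquiv) (h := fun _ _ => rfl)]
  simp only [c.law_lawEquiv, ← Finset.mul_sum, (c.dec_mem _ _).2, mul_one]

/-- Averaging over the decoder's randomness leaves only its probability of the true pair, the form
in which Fano's inequality takes a stochastic estimator. -/
lemma Code.errorProb_eq : c.errorProb ch =
    ∑ ω, c.outputLaw ch ω * (1 - c.dec ω.2.1 ω.1.2.1 (ω.1.1, ω.1.2.2.2)) := by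
  classical
  unfold Code.errorProb
  rw [← lawEquiv.sum_comp, Fintype.sum_prod_type]
  refine Finset.sum_congr rfl fun ω _ => ?_
  have h : ∀ y : Fin M × Fin K, ((fun (m, _, _, k, _, _, m', k') =>
      if (m, k) ≠ (m', k') then (1 : ℝ) else 0) (lawEquiv (ω, y))) * c.law ch (lawEquiv (ω, y)) =
      c.outputLaw ch ω * (c.dec ω.2.1 ω.1.2.1 y -
        if y = (ω.1.1, ω.1.2.2.2) then c.dec ω.2.1 ω.1.2.1 y else 0) := by
    intro y
    rw [c.law_lawEquiv]
    change (if (ω.1.1, ω.1.2.2.2) ≠ y then (1 : ℝ) else 0) * _ = _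
    by_cases hy : y = (ω.1.1, ω.1.2.2.2)
    · simp [hy]
    · rw [if_pos (Ne.symm hy), if_neg hy]
      ring
  simp only [h, ← Finset.mul_sum, Finset.sum_sub_distrib, (c.dec_mem _ _).2, Finset.sum_ite_eq',
    Finset.mem_univ, if_true]

lemma Code.covertKeyDist_eq : c.covertKeyDist ch =
    tvDist (marginal (c.outputLaw ch) (fun ω => (ω.1.2.2.2, ω.2.2)))
      (fun x : Fin K × (Fin n → E) => (1 / (K : ℝ)) * ∏ i, ch.wardenIdle (x.2 i)) := by
  rw [← c.marginal_law, marginal_marginal]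
  rfl

lemma Code.messageKeyDist_eq : c.messageKeyDist ch =
    tvDist (marginal (c.outputLaw ch) (fun ω => (ω.1.1, ω.1.2.2.2)))
      (fun _ : Fin M × Fin K => 1 / ((M : ℝ) * (K : ℝ))) := by
  rw [← c.marginal_law, marginal_marginal]
  rfl

lemma Code.inputLaw_nonneg (θ) : 0 ≤ c.inputLaw ch θ :=
  mul_nonneg (mul_nonneg (by positivity) (Finset.prod_nonneg fun _ _ => ch.stateLaw_mem.1 _))
    ((c.enc_mem _ _).1 _)

lemma Code.outputLaw_nonneg (ω) : 0 ≤ c.outputLaw ch ω :=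
  ch.blockLaw_nonneg _ _ (c.inputLaw_nonneg ch) ω

lemma Code.marginal_inputLaw (m : Fin M) (s : Fin n → S) :
    marginal (c.inputLaw ch) (fun θ => (θ.1, θ.2.1)) (m, s) =
      (1 / (M : ℝ)) * ∏ i, ch.stateLaw (s i) := by
  rw [marginal_eq_sum_of_equiv (κ := (Fin n → A) × Fin K) (e := ⟨fun y => (y.1.1, y.1.2, y.2),
    fun t => ((t.1, t.2.1), t.2.2), fun _ => rfl, fun _ => rfl⟩) (h := fun _ _ => rfl)]
  simp only [Equiv.coe_fn_mk, Code.inputLaw, ← Finset.mul_sum, Prod.mk.eta, (c.enc_mem _ _).2,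
    mul_one]

lemma Code.marginal_inputLaw_state (hM : 0 < M) (s : Fin n → S) :
    marginal (c.inputLaw ch) (fun θ => θ.2.1) s = ∏ i, ch.stateLaw (s i) := by
  rw [← sum_marginal_prod_left _ (fun θ => θ.1)]
  have : (M : ℝ) ≠ 0 := by exact_mod_cast hM.ne'
  simp only [c.marginal_inputLaw, Finset.sum_const, Finset.card_univ, Fintype.card_fin,
    nsmul_eq_mul]
  field_simp

lemma sum_prod_stateLaw : ∑ s : Fin n → S, ∏ i, ch.stateLaw (s i) = 1 := by
  rw [sum_prod_pi (fun _ x => ch.stateLaw x)]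
  simp [ch.stateLaw_mem.2]

lemma Code.sum_inputLaw (hM : 0 < M) : ∑ θ, c.inputLaw ch θ = 1 := by
  rw [← sum_marginal _ (fun θ => θ.2.1)]
  simp only [c.marginal_inputLaw_state ch hM, sum_prod_stateLaw]

lemma Code.sum_outputLaw (hM : 0 < M) : ∑ ω, c.outputLaw ch ω = 1 :=
  ch.sum_blockLaw _ _ (c.sum_inputLaw ch hM)

/-- The average law of the letters `(Sᵢ, Aᵢ)`. -/
noncomputable def Code.averageInput : S × A → ℝ :=
  inputAverage (c.inputLaw ch) (fun θ => θ.2.1) (fun θ => θ.2.2.1)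

lemma Code.averageInput_mem (hn : 0 < n) (hM : 0 < M) : c.averageInput ch ∈ ch.inputLaws := by
  classical
  refine inputAverage_mem ch _ _ hn (c.inputLaw_nonneg ch) fun i x => ?_
  have h := marginal_marginal (c.inputLaw ch) (fun θ => θ.2.1) (fun s => s i)
  rw [← h]
  unfold marginal
  change (∑ s, if s i = x then marginal (c.inputLaw ch) (fun θ => θ.2.1) s else 0) = _
  simp only [c.marginal_inputLaw_state ch hM]
  have := sum_prod_mul_coord (fun (_ : Fin n) x => ch.stateLaw x) (fun _ => ch.stateLaw_mem.2) i
    (fun y => if y = x then 1 else 0)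
  simpa using this

lemma Code.letterAverage_outputLaw : letterAverage (c.outputLaw ch)
    (letter (fun θ => θ.2.1) (fun θ => θ.2.2.1)) = ch.letterLaw (c.averageInput ch) :=
  ch.letterAverage_blockLaw _ _

lemma Code.condEntropy_outputLaw_B (hn : 0 < n) (hM : 0 < M) :
    condEntropy (c.outputLaw ch) (fun ω => ω.2.1) (fun ω => ω.1) =
      n * condEntropy (ch.letterLaw (c.averageInput ch)) (fun t => t.2.2.1)
        (fun t => (t.2.1, t.1)) := by
  have hν := c.averageInput_mem ch hn hM
  unfold Code.averageInput at hν ⊢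
  exact ch.condEntropy_blockLaw_B _ _ hn (c.inputLaw_nonneg ch) hν

lemma Code.condEntropy_outputLaw_B_E (hn : 0 < n) (hM : 0 < M) :
    condEntropy (c.outputLaw ch) (fun ω => ω.2.1) (fun ω => (ω.2.2, ω.1)) =
      n * condEntropy (ch.letterLaw (c.averageInput ch)) (fun t => t.2.2.1)
        (fun t => (t.2.2.2, t.2.1, t.1)) := by
  have hν := c.averageInput_mem ch hn hM
  unfold Code.averageInput at hν ⊢
  exact ch.condEntropy_blockLaw_B_E _ _ hn (c.inputLaw_nonneg ch) hν

lemma Code.fano (hM : 0 < M) :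
    condEntropy (c.outputLaw ch) (fun ω => (ω.1.1, ω.1.2.2.2)) (fun ω => (ω.2.1, ω.1.2.1)) ≤
      1 + c.errorProb ch * Real.logb 2 ((M : ℝ) * K) := by
  have := condEntropy_le_fano (c.outputLaw_nonneg ch) (c.sum_outputLaw ch hM)
    (fun ω => (ω.1.1, ω.1.2.2.2)) (fun ω => (ω.2.1, ω.1.2.1)) (fun z => c.dec z.1 z.2)
    (fun z => c.dec_mem _ _)
  rw [c.errorProb_eq]
  simpa using this

lemma Code.condEntropy_block (hn : 0 < n) :
    condEntropy (c.outputLaw ch) (fun ω => ω.2.1) (fun ω => ω.1.2.1) ≤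
      n * condEntropy (ch.letterLaw (c.averageInput ch)) (fun t => t.2.2.1) (fun t => t.1) := by
  rw [← c.letterAverage_outputLaw]
  exact condEntropy_block_le hn (c.outputLaw_nonneg ch)
    (letter (fun θ => θ.2.1) (fun θ => θ.2.2.1)) (fun t => t.2.2.1) (fun t => t.1)

/-- M is uniform and independent of Sⁿ, so log M = H(M|Sⁿ); the receiver's output then accounts for
it up to Fano's term. -/
lemma Code.message_bound (hn : 0 < n) (hM : 0 < M) :
    Real.logb 2 M ≤ n * infoAB_S (ch.letterLaw (c.averageInput ch)) +
      (1 + c.errorProb ch * Real.logb 2 ((M : ℝ) * K)) := by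
  have hp0 : ∀ ω, 0 ≤ c.outputLaw ch ω := c.outputLaw_nonneg ch
  have hp1 : ∑ ω, c.outputLaw ch ω = 1 := c.sum_outputLaw ch hM
  have hM' : (M : ℝ) ≠ 0 := by exact_mod_cast hM.ne'
  have h1 : condEntropy (c.outputLaw ch) (fun ω => ω.1.1) (fun ω => ω.1.2.1) = Real.logb 2 M := by
    rw [condEntropy_eq_of_factor hp0 _ _ (fun _ _ => 1 / (M : ℝ))]
    · rw [← Finset.sum_mul, hp1]
      simp
    · intro m s
      have e1 : marginal (c.outputLaw ch) (fun ω => (ω.1.1, ω.1.2.1)) =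
          marginal (c.inputLaw ch) (fun θ => (θ.1, θ.2.1)) := by
        rw [← marginal_marginal (c.outputLaw ch) (fun ω => ω.1) (fun θ => (θ.1, θ.2.1))]
        congr 1
        exact funext fun θ => ch.marginal_blockLaw _ _ θ
      have e2 : marginal (c.outputLaw ch) (fun ω => ω.1.2.1) =
          marginal (c.inputLaw ch) (fun θ => θ.2.1) := by
        rw [← marginal_marginal (c.outputLaw ch) (fun ω => ω.1) (fun θ => θ.2.1)]
        congr 1
        exact funext fun θ => ch.marginal_blockLaw _ _ θ
      rw [e1, e2, c.marginal_inputLaw, c.marginal_inputLaw_state ch hM, mul_comm]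
  have h2 := entropy_le_of_output hp0 (fun ω => ω.2.1) (fun ω => ω.1) (fun θ => θ.1)
    (fun θ => θ.2.1)
  have h3 := condEntropy_fst_le hp0 (fun ω => (ω.1.1, ω.1.2.2.2)) (fun ω => (ω.2.1, ω.1.2.1))
    Prod.fst
  have h4 := c.fano ch hM
  have h5 := c.condEntropy_block ch hn
  have h6 := c.condEntropy_outputLaw_B ch hn hM
  rw [← h1]
  unfold infoAB_S
  rw [mul_sub, ← h6]
  unfold condEntropy at h2 h3 h4 h5 ⊢
  linarith

/-- The key may be extracted from the state, so Sⁿ is included with (M, K) and its entropy n H(S)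
adds to the information carried by the channel. -/
lemma Code.sum_bound (hn : 0 < n) (hM : 0 < M) :
    entropy (c.outputLaw ch) (fun ω => (ω.1.1, ω.1.2.2.2)) ≤
      n * (infoAB_S (ch.letterLaw (c.averageInput ch)) +
        stateEntropy (ch.letterLaw (c.averageInput ch))) +
      (1 + c.errorProb ch * Real.logb 2 ((M : ℝ) * K)) := by
  have hp0 : ∀ ω, 0 ≤ c.outputLaw ch ω := c.outputLaw_nonneg ch
  have hp1 : ∑ ω, c.outputLaw ch ω = 1 := c.sum_outputLaw ch hM
  have h1 : entropy (c.outputLaw ch) (fun ω => ω.1.2.1) ≤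
      n * stateEntropy (ch.letterLaw (c.averageInput ch)) := by
    rw [← c.letterAverage_outputLaw]
    exact entropy_block_le hn hp0 hp1 (letter (fun θ => θ.2.1) (fun θ => θ.2.2.1)) (fun t => t.1)
  have h2 := entropy_le_of_output hp0 (fun ω => ω.2.1) (fun ω => ω.1)
    (fun θ => (θ.1, θ.2.2.2)) (fun θ => θ.2.1)
  have h3 := entropy_comp_le hp0 (fun ω => ((ω.1.1, ω.1.2.2.2), ω.1.2.1)) Prod.fst
  have h4 := c.fano ch hM
  have h5 := c.condEntropy_block ch hn
  have h6 := c.condEntropy_outputLaw_B ch hn hM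
  unfold infoAB_S
  rw [mul_add, mul_sub, ← h6]
  unfold condEntropy at h2 h4 h5 ⊢
  linarith

/-- H(K|Eⁿ) ≤ H(Sⁿ|Eⁿ) + H(K|Eⁿ,Sⁿ); what the receiver learns about K beyond (Eⁿ, Sⁿ) is bounded by
H(Bⁿ|Eⁿ,Sⁿ) minus the channel noise given Eⁿ. -/
lemma Code.key_bound (hn : 0 < n) (hM : 0 < M) :
    condEntropy (c.outputLaw ch) (fun ω => ω.1.2.2.2) (fun ω => ω.2.2) ≤
      n * secretInfo (ch.letterLaw (c.averageInput ch)) +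
      (1 + c.errorProb ch * Real.logb 2 ((M : ℝ) * K)) := by
  have hp0 : ∀ ω, 0 ≤ c.outputLaw ch ω := c.outputLaw_nonneg ch
  have h1 : condEntropy (c.outputLaw ch) (fun ω => ω.1.2.1) (fun ω => ω.2.2) ≤
      n * condEntropy (ch.letterLaw (c.averageInput ch)) (fun t => t.1) (fun t => t.2.2.2) := by
    rw [← c.letterAverage_outputLaw]
    exact condEntropy_block_le hn hp0 (letter (fun θ => θ.2.1) (fun θ => θ.2.2.1)) (fun t => t.1)
      (fun t => t.2.2.2)
  have h2 := entropy_le_of_output hp0 (fun ω => ω.2.1) (fun ω => (ω.2.2, ω.1))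
    (fun z => z.2.2.2.2) (fun z => (z.1, z.2.2.1))
  have h3 := condEntropy_fst_le hp0 (fun ω => (ω.1.1, ω.1.2.2.2)) (fun ω => (ω.2.1, ω.1.2.1))
    Prod.snd
  have h3' := condEntropy_le_comp hp0 (fun ω => ω.1.2.2.2) (fun ω => (ω.2.1, ω.2.2, ω.1.2.1))
    (fun y => (y.1, y.2.2))
  have h4 := c.fano ch hM
  have h5 : condEntropy (c.outputLaw ch) (fun ω => ω.2.1) (fun ω => (ω.2.2, ω.1.2.1)) ≤
      n * condEntropy (ch.letterLaw (c.averageInput ch)) (fun t => t.2.2.1)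
        (fun t => (t.2.2.2, t.1)) := by
    rw [← c.letterAverage_outputLaw]
    refine le_trans (le_of_eq ?_) (condEntropy_block_le hn hp0
      (letter (fun θ => θ.2.1) (fun θ => θ.2.2.1)) (fun t => t.2.2.1) (fun t => (t.2.2.2, t.1)))
    unfold condEntropy
    -- A pair of sequences is recoded as a sequence of pairs, the form of `condEntropy_block_le`.
    rw [entropy_congr hp0 (fun ω => (ω.2.1, ω.2.2, ω.1.2.1)) _
      (fun y => (y.1, fun i => (y.2.1 i, y.2.2 i)))
      (fun y => (y.1, fun i => (y.2 i).1, fun i => (y.2 i).2)) (fun _ => rfl) (fun _ => rfl),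
      entropy_congr hp0 (fun ω => (ω.2.2, ω.1.2.1)) _ (fun y i => (y.1 i, y.2 i))
      (fun y => (fun i => (y i).1, fun i => (y i).2)) (fun _ => rfl) (fun _ => rfl)]
    rfl
  have h6 := c.condEntropy_outputLaw_B_E ch hn hM
  have h7 := entropy_comp_le hp0 (fun ω => (ω.1.2.2.2, ω.2.2, ω.1.2.1)) (fun y => (y.1, y.2.1))
  have h8 := entropy_congr hp0 (fun ω => (ω.2.2, ω.1.2.1)) (fun ω => (ω.1.2.1, ω.2.2))
    Prod.swap Prod.swap (fun _ => rfl) (fun _ => rfl)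
  unfold secretInfo
  rw [mul_add, mul_sub, ← h6]
  unfold condEntropy at *
  linarith

/-- The case of trivial side information; 4 is the 2 of `condEntropy_ge_of_near_uniform` times the 2
undoing the factor 1/2 of `tvDist`. -/
lemma Code.entropy_messageKey_ge (hM : 0 < M) :
    Real.logb 2 ((M : ℝ) * K) - 1 - 4 * Real.logb 2 ((M : ℝ) * K) * c.messageKeyDist ch ≤
      entropy (c.outputLaw ch) (fun ω => (ω.1.1, ω.1.2.2.2)) := by
  have hp0 := c.outputLaw_nonneg ch
  have hp1 := c.sum_outputLaw ch hM
  have h := condEntropy_ge_of_near_uniform hp0 hp1 (fun ω => (ω.1.1, ω.1.2.2.2)) (fun _ => ())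
  rw [← entropy_eq_condEntropy_unit hp0 hp1] at h
  refine le_trans (le_of_eq ?_) h
  have e : ∑ y : (Fin M × Fin K) × Unit,
      |marginal (c.outputLaw ch) (fun ω => ((ω.1.1, ω.1.2.2.2), ())) y -
        1 / (Fintype.card (Fin M × Fin K) : ℝ) * marginal (c.outputLaw ch) (fun _ => ()) y.2| =
      2 * c.messageKeyDist ch := by
    rw [c.messageKeyDist_eq, tvDist, Fintype.sum_prod_type]
    simp only [Finset.univ_unique, Finset.sum_singleton]
    rw [← mul_assoc]
    norm_num
    refine Finset.sum_congr rfl fun y _ => ?_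
    congr 1
    classical
    simp [marginal_apply, hp1, mul_comm]
  rw [e]
  simp
  ring

/-- Summing out the key does not increase the ℓ¹ distance. -/
lemma Code.marginal_warden_close (hK : 0 < K) :
    ∑ e : Fin n → E, |marginal (c.outputLaw ch) (fun ω => ω.2.2) e - ∏ i, ch.wardenIdle (e i)| ≤
      2 * c.covertKeyDist ch := by
  rw [c.covertKeyDist_eq, tvDist, ← mul_assoc, Fintype.sum_prod_type_right]
  norm_num
  refine Finset.sum_le_sum fun e _ => ?_
  rw [← sum_marginal_prod_left _ (fun ω => ω.1.2.2.2)]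
  have hK' : (K : ℝ) ≠ 0 := by exact_mod_cast hK.ne'
  have : ∏ i, ch.wardenIdle (e i) = ∑ _k : Fin K, (K : ℝ)⁻¹ * ∏ i, ch.wardenIdle (e i) := by
    rw [Finset.sum_const, Finset.card_univ, Fintype.card_fin, nsmul_eq_mul]
    field_simp
  conv_lhs => rw [this]
  rw [← Finset.sum_sub_distrib]
  exact Finset.abs_sum_le_sum_abs _ _

lemma Code.condEntropy_key_ge (hM : 0 < M) (hK : 0 < K) :
    Real.logb 2 K - 1 - 8 * Real.logb 2 K * c.covertKeyDist ch ≤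
      condEntropy (c.outputLaw ch) (fun ω => ω.1.2.2.2) (fun ω => ω.2.2) := by
  have hp0 := c.outputLaw_nonneg ch
  have hp1 := c.sum_outputLaw ch hM
  have h := condEntropy_ge_of_near_uniform hp0 hp1 (fun ω => ω.1.2.2.2) (fun ω => ω.2.2)
  refine le_trans ?_ h
  have hK' : (1 : ℝ) ≤ K := by exact_mod_cast hK
  have hl : 0 ≤ Real.logb 2 K := Real.logb_nonneg (by norm_num) hK'
  -- Near-uniformity is needed relative to the code's own law of Eⁿ, while covertness compares with
  -- Q₀ⁿ. Passing from one to the other doubles the ℓ¹ distance, whence 4 here and 8 in the result.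
  have e : ∑ y : Fin K × (Fin n → E),
      |marginal (c.outputLaw ch) (fun ω => (ω.1.2.2.2, ω.2.2)) y -
        1 / (K : ℝ) * marginal (c.outputLaw ch) (fun ω => ω.2.2) y.2| ≤
      4 * c.covertKeyDist ch := by
    have h1 := c.marginal_warden_close ch hK
    have h2 : ∑ y : Fin K × (Fin n → E), 1 / (K : ℝ) * |∏ i, ch.wardenIdle (y.2 i) -
        marginal (c.outputLaw ch) (fun ω => ω.2.2) y.2| ≤ 2 * c.covertKeyDist ch := by
      rw [Fintype.sum_prod_type]
      simp only [Finset.sum_const, Finset.card_univ, Fintype.card_fin, nsmul_eq_mul,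
        ← Finset.mul_sum]
      rw [← mul_assoc, mul_one_div_cancel (by linarith), one_mul]
      simpa only [abs_sub_comm] using h1
    have h3 : ∑ y : Fin K × (Fin n → E),
        |marginal (c.outputLaw ch) (fun ω => (ω.1.2.2.2, ω.2.2)) y -
          1 / (K : ℝ) * ∏ i, ch.wardenIdle (y.2 i)| = 2 * c.covertKeyDist ch := by
      rw [c.covertKeyDist_eq, tvDist]
      ring
    have h4 : 4 * c.covertKeyDist ch = 2 * c.covertKeyDist ch + 2 * c.covertKeyDist ch := by ring
    rw [h4]
    refine le_trans ?_ (add_le_add h3.le h2)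
    rw [← Finset.sum_add_distrib]
    refine Finset.sum_le_sum fun y _ => ?_
    have h5 : 0 ≤ 1 / (K : ℝ) := by positivity
    rw [← abs_of_nonneg h5, ← abs_mul, abs_of_nonneg h5]
    refine le_trans (le_of_eq ?_) (abs_add_le _ _)
    congr 1
    ring
  rw [Fintype.card_fin]
  have := mul_le_mul_of_nonneg_left e hl
  linarith

/-- The frequency of the symbol `e` in Eⁿ lies in [0, 1], so its means under two laws differ by at
most their ℓ¹ distance. -/
lemma Code.letter_warden_close (hn : 0 < n) (hK : 0 < K) (e : E) :
    |marginal (ch.letterLaw (c.averageInput ch)) (fun t => t.2.2.2) e - ch.wardenIdle e| ≤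
      2 * c.covertKeyDist ch := by
  classical
  have hn' : (0 : ℝ) < n := by exact_mod_cast hn
  set p := c.outputLaw ch
  have h1 : ∀ g : E → ℝ, (∑ t, ch.letterLaw (c.averageInput ch) t * g t.2.2.2) =
      (1 / (n : ℝ)) * ∑ e' : Fin n → E, marginal p (fun ω => ω.2.2) e' * ∑ i, g (e' i) := by
    intro g
    rw [sum_marginal_mul, ← c.letterAverage_outputLaw]
    have := sum_letters hn p (letter (fun θ => θ.2.1) (fun θ => θ.2.2.1)) (fun t => g t.2.2.2)
    change (∑ ω, p ω * ∑ i, g (ω.2.2 i)) = _ at this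
    rw [this]
    field_simp
    rfl
  have h2 : ch.wardenIdle e = (1 / (n : ℝ)) * ∑ e' : Fin n → E,
      (∏ i, ch.wardenIdle (e' i)) * ∑ i, (if e' i = e then (1 : ℝ) else 0) := by
    simp only [Finset.mul_sum (s := (Finset.univ : Finset (Fin n)))]
    rw [Finset.sum_comm]
    have h3 : ∀ i : Fin n, ∑ e' : Fin n → E, (∏ i, ch.wardenIdle (e' i)) *
        (if e' i = e then (1 : ℝ) else 0) = ch.wardenIdle e := by
      intro i
      rw [sum_prod_mul_coord (fun (_ : Fin n) x => ch.wardenIdle x) (fun _ => ch.sum_wardenIdle) i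
        (fun y => if y = e then 1 else 0)]
      simp
    simp only [h3, Finset.sum_const, Finset.card_univ, Fintype.card_fin, nsmul_eq_mul]
    field_simp
  have h3 : marginal (ch.letterLaw (c.averageInput ch)) (fun t => t.2.2.2) e =
      (1 / (n : ℝ)) * ∑ e' : Fin n → E, marginal p (fun ω => ω.2.2) e' *
        ∑ i, (if e' i = e then (1 : ℝ) else 0) := by
    rw [← h1 (fun x => if x = e then 1 else 0)]
    simp [marginal]
  rw [h3, h2, ← mul_sub, ← Finset.sum_sub_distrib, abs_mul, abs_of_nonneg (by positivity)]
  refine le_trans ?_ (c.marginal_warden_close ch hK)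
  rw [one_div, inv_mul_le_iff₀ hn', Finset.mul_sum]
  refine (Finset.abs_sum_le_sum_abs _ _).trans (Finset.sum_le_sum fun e' _ => ?_)
  rw [← sub_mul, abs_mul, mul_comm]
  refine mul_le_mul_of_nonneg_right ?_ (abs_nonneg _)
  rw [abs_of_nonneg (Finset.sum_nonneg fun i _ => by split_ifs <;> norm_num)]
  refine (Finset.sum_le_sum (g := fun _ => (1 : ℝ)) fun i _ => ?_).trans (by simp)
  split_ifs <;> norm_num

end converse

/-! ### The converse: passing to the limit. -/

section converse

variable {S A B E : Type*} [Fintype S] [Fintype A] [Fintype B] [Fintype E]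

open Filter Topology

/-- The rate pair `(R, RK)` satisfies the bounds given by the law `ν` of the state and the
input. -/
def StateChannel.Supports (ch : StateChannel S A B E) (ν : S × A → ℝ) (R RK : ℝ) : Prop :=
  ν ∈ ch.inputLaws ∧ marginal (ch.letterLaw ν) (fun t => t.2.2.2) = ch.wardenIdle ∧
    R ≤ infoAB_S (ch.letterLaw ν) ∧ RK ≤ secretInfo (ch.letterLaw ν) ∧
    R + RK ≤ infoAB_S (ch.letterLaw ν) + stateEntropy (ch.letterLaw ν)

lemma continuous_infoAB_S : Continuous (infoAB_S : (S × A × B × E → ℝ) → ℝ) :=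
  (continuous_condEntropy _ _).sub (continuous_condEntropy _ _)

lemma continuous_secretInfo : Continuous (secretInfo : (S × A × B × E → ℝ) → ℝ) :=
  ((continuous_condEntropy _ _).sub (continuous_condEntropy _ _)).add (continuous_condEntropy _ _)

lemma continuous_stateEntropy : Continuous (stateEntropy : (S × A × B × E → ℝ) → ℝ) :=
  continuous_entropy _

variable {ch : StateChannel S A B E}

/-- Compactness of the input laws and continuity of the entropies. It serves both as the block
length grows and when passing to the closure of the achievable pairs. -/
lemma StateChannel.exists_supports_of_tendsto {ν : ℕ → S × A → ℝ} (hν : ∀ j, ν j ∈ ch.inputLaws)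
    (hE : ∀ e, Tendsto (fun j => marginal (ch.letterLaw (ν j)) (fun t => t.2.2.2) e) atTop
      (𝓝 (ch.wardenIdle e)))
    {u v w : ℕ → ℝ} {R RK : ℝ} (hu : Tendsto u atTop (𝓝 R)) (hv : Tendsto v atTop (𝓝 RK))
    (hw : Tendsto w atTop (𝓝 (R + RK))) (hu' : ∀ j, u j ≤ infoAB_S (ch.letterLaw (ν j)))
    (hv' : ∀ j, v j ≤ secretInfo (ch.letterLaw (ν j)))
    (hw' : ∀ j, w j ≤ infoAB_S (ch.letterLaw (ν j)) + stateEntropy (ch.letterLaw (ν j))) :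
    ∃ ν, ch.Supports ν R RK := by
  obtain ⟨ν', hν', φ, hφ, hlim⟩ := ch.isCompact_inputLaws.tendsto_subseq hν
  have hφ' := hφ.tendsto_atTop
  have hl : ∀ g : (S × A × B × E → ℝ) → ℝ, Continuous g →
      Tendsto (fun j => g (ch.letterLaw (ν (φ j)))) atTop (𝓝 (g (ch.letterLaw ν'))) := fun g hg =>
    ((hg.comp ch.continuous_letterLaw).tendsto ν').comp hlim
  refine ⟨ν', hν', funext fun e => ?_, ?_, ?_, ?_⟩
  · exact tendsto_nhds_unique (hl (fun p => marginal p (fun t => t.2.2.2) e)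
      (continuous_marginal _ _)) ((hE e).comp hφ')
  · exact le_of_tendsto_of_tendsto' (hu.comp hφ') (hl _ continuous_infoAB_S) fun j => hu' _
  · exact le_of_tendsto_of_tendsto' (hv.comp hφ') (hl _ continuous_secretInfo) fun j => hv' _
  · exact le_of_tendsto_of_tendsto' (hw.comp hφ')
      (hl _ (continuous_infoAB_S.add continuous_stateEntropy)) fun j => hw' _

/-- Rounding down a number that is at least 1 loses less than half of it, hence at most one bit. -/
lemma logb_floor_rpow_ge {x : ℝ} (hx : 0 ≤ x) :
    x - 1 ≤ Real.logb 2 (⌊(2 : ℝ) ^ x⌋₊ : ℝ) := by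
  have h1 : (1 : ℝ) ≤ 2 ^ x := Real.one_le_rpow (by norm_num) hx
  have h2 : (1 : ℝ) ≤ (⌊(2 : ℝ) ^ x⌋₊ : ℝ) := by
    exact_mod_cast Nat.one_le_floor_iff _ |>.2 h1
  have h3 := Nat.lt_floor_add_one ((2 : ℝ) ^ x)
  rw [Real.le_logb_iff_rpow_le (by norm_num) (by linarith), Real.rpow_sub (by norm_num),
    Real.rpow_one]
  linarith

lemma floor_rpow_pos {x : ℝ} (hx : 0 ≤ x) : 0 < ⌊(2 : ℝ) ^ x⌋₊ :=
  Nat.floor_pos.2 (Real.one_le_rpow (by norm_num) hx)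

lemma logb_floor_rpow_le {x : ℝ} (hx : 0 ≤ x) :
    Real.logb 2 (⌊(2 : ℝ) ^ x⌋₊ : ℝ) ≤ x := by
  have h2 : (0 : ℝ) < (⌊(2 : ℝ) ^ x⌋₊ : ℝ) := by exact_mod_cast floor_rpow_pos hx
  rw [Real.logb_le_iff_le_rpow (by norm_num) h2]
  exact Nat.floor_le (by positivity)

lemma tvDist_nonneg {α : Type*} [Fintype α] (p q : α → ℝ) : 0 ≤ tvDist p q :=
  mul_nonneg (by norm_num) (Finset.sum_nonneg fun _ _ => abs_nonneg _)

lemma stdSimplex_le_one {α : Type*} [Fintype α] {f : α → ℝ} (hf : f ∈ stdSimplex ℝ α) (x : α) :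
    f x ≤ 1 :=
  (Finset.single_le_sum (fun i _ => hf.1 i) (Finset.mem_univ x)).trans hf.2.le

lemma Code.errorProb_nonneg {n M K : ℕ} (c : Code S A B n M K) (ch : StateChannel S A B E) :
    0 ≤ c.errorProb ch := by
  rw [c.errorProb_eq]
  exact Finset.sum_nonneg fun ω _ => mul_nonneg (c.outputLaw_nonneg ch ω)
    (sub_nonneg.2 (stdSimplex_le_one (c.dec_mem _ _) _))

/-- The converse. -/
lemma StateChannel.Achievable.exists_supports {R RK : ℝ} (hR : 0 ≤ R) (hRK : 0 ≤ RK)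
    (h : ch.Achievable R RK) : ∃ ν, ch.Supports ν R RK := by
  obtain ⟨c, herr, hck, hmk⟩ := h
  -- The index is shifted by one to exclude block length 0.
  set err : ℕ → ℝ := fun j => (c (j + 1)).errorProb ch
  set ck : ℕ → ℝ := fun j => (c (j + 1)).covertKeyDist ch
  set mk : ℕ → ℝ := fun j => (c (j + 1)).messageKeyDist ch
  have herr' : Tendsto err atTop (𝓝 0) := (tendsto_add_atTop_iff_nat 1).2 herr
  have hck' : Tendsto ck atTop (𝓝 0) := (tendsto_add_atTop_iff_nat 1).2 hck
  have hmk' : Tendsto mk atTop (𝓝 0) := (tendsto_add_atTop_iff_nat 1).2 hmk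
  have hinv : Tendsto (fun j : ℕ => 1 / ((j : ℝ) + 1)) atTop (𝓝 0) :=
    tendsto_one_div_add_atTop_nhds_zero_nat
  have hM : ∀ j : ℕ, 0 < ⌊(2 : ℝ) ^ (((j + 1 : ℕ) : ℝ) * R)⌋₊ := fun j =>
    floor_rpow_pos (by positivity)
  have hK : ∀ j : ℕ, 0 < ⌊(2 : ℝ) ^ (((j + 1 : ℕ) : ℝ) * RK)⌋₊ := fun j =>
    floor_rpow_pos (by positivity)
  have hlM : ∀ j : ℕ, ((j : ℝ) + 1) * R - 1 ≤
      Real.logb 2 (⌊(2 : ℝ) ^ (((j + 1 : ℕ) : ℝ) * R)⌋₊ : ℝ) := fun j => by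
    have := logb_floor_rpow_ge (x := ((j + 1 : ℕ) : ℝ) * R) (by positivity)
    push_cast at this ⊢
    exact this
  have hlK : ∀ j : ℕ, ((j : ℝ) + 1) * RK - 1 ≤
      Real.logb 2 (⌊(2 : ℝ) ^ (((j + 1 : ℕ) : ℝ) * RK)⌋₊ : ℝ) := fun j => by
    have := logb_floor_rpow_ge (x := ((j + 1 : ℕ) : ℝ) * RK) (by positivity)
    push_cast at this ⊢
    exact this
  have hlM' : ∀ j : ℕ, Real.logb 2 (⌊(2 : ℝ) ^ (((j + 1 : ℕ) : ℝ) * R)⌋₊ : ℝ) ≤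
      ((j : ℝ) + 1) * R := fun j => by
    have := logb_floor_rpow_le (x := ((j + 1 : ℕ) : ℝ) * R) (by positivity)
    push_cast at this ⊢
    exact this
  have hlK' : ∀ j : ℕ, Real.logb 2 (⌊(2 : ℝ) ^ (((j + 1 : ℕ) : ℝ) * RK)⌋₊ : ℝ) ≤
      ((j : ℝ) + 1) * RK := fun j => by
    have := logb_floor_rpow_le (x := ((j + 1 : ℕ) : ℝ) * RK) (by positivity)
    push_cast at this ⊢
    exact this
  have hlMK : ∀ j : ℕ, Real.logb 2 ((⌊(2 : ℝ) ^ (((j + 1 : ℕ) : ℝ) * R)⌋₊ : ℝ) *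
      (⌊(2 : ℝ) ^ (((j + 1 : ℕ) : ℝ) * RK)⌋₊ : ℝ)) =
      Real.logb 2 (⌊(2 : ℝ) ^ (((j + 1 : ℕ) : ℝ) * R)⌋₊ : ℝ) +
      Real.logb 2 (⌊(2 : ℝ) ^ (((j + 1 : ℕ) : ℝ) * RK)⌋₊ : ℝ) := fun j =>
    Real.logb_mul (by exact_mod_cast (hM j).ne') (by exact_mod_cast (hK j).ne')
  have herr0 : ∀ j, 0 ≤ err j := fun j => (c _).errorProb_nonneg ch
  have hck0 : ∀ j, 0 ≤ ck j := fun j => tvDist_nonneg _ _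
  have hmk0 : ∀ j, 0 ≤ mk j := fun j => tvDist_nonneg _ _
  have hj : ∀ j : ℕ, (0 : ℝ) < (j : ℝ) + 1 := fun j => by positivity
  have hdiv : ∀ (j : ℕ) (x y z : ℝ), ((j : ℝ) + 1) * x - z ≤ ((j : ℝ) + 1) * y →
      x - z * (1 / ((j : ℝ) + 1)) ≤ y := by
    intro j x y z h
    have := hj j
    rw [mul_one_div, sub_le_iff_le_add, ← sub_le_iff_le_add', le_div_iff₀ this]
    linarith
  refine StateChannel.exists_supports_of_tendsto
    (ν := fun j => (c (j + 1)).averageInput ch)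
    -- The constants 2, 3, 4 count lost bits: one per rounded size (two for the sum rate), one for
    -- Fano's inequality, and one for near-uniformity in the last two bounds.
    (u := fun j => R - err j * (R + RK) - 2 * (1 / ((j : ℝ) + 1)))
    (v := fun j => RK - err j * (R + RK) - 8 * RK * ck j - 3 * (1 / ((j : ℝ) + 1)))
    (w := fun j => (R + RK) - err j * (R + RK) - 4 * (R + RK) * mk j - 4 * (1 / ((j : ℝ) + 1)))
    ?_ ?_ ?_ ?_ ?_ ?_ ?_ ?_
  · exact fun j => (c (j + 1)).averageInput_mem ch (Nat.succ_pos j) (hM j)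
  · intro e
    rw [tendsto_iff_dist_tendsto_zero]
    refine squeeze_zero (fun _ => dist_nonneg)
      (fun j => (c (j + 1)).letter_warden_close ch (Nat.succ_pos j) (hK j) e) ?_
    simpa using hck'.const_mul 2
  · simpa using ((herr'.mul_const (R + RK)).const_sub R).sub (hinv.const_mul 2)
  · simpa using (((herr'.mul_const (R + RK)).const_sub RK).sub (hck'.const_mul (8 * RK))).sub
      (hinv.const_mul 3)
  · simpa using (((herr'.mul_const (R + RK)).const_sub (R + RK)).sub
      (hmk'.const_mul (4 * (R + RK)))).sub (hinv.const_mul 4)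
  · intro j
    have h1 := (c (j + 1)).message_bound ch (Nat.succ_pos j) (hM j)
    rw [hlMK] at h1
    refine hdiv j _ _ _ ?_
    push_cast at h1
    have h2 := mul_le_mul_of_nonneg_left (add_le_add (hlM' j) (hlK' j)) (herr0 j)
    have h3 := hlM j
    push_cast at h2 h3
    simp only [err] at *
    linarith
  · intro j
    have h1 := (c (j + 1)).key_bound ch (Nat.succ_pos j) (hM j)
    have h1' := (c (j + 1)).condEntropy_key_ge ch (hM j) (hK j)
    rw [hlMK] at h1
    refine hdiv j _ _ _ ?_
    push_cast at h1 h1'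
    have h2 := mul_le_mul_of_nonneg_left (add_le_add (hlM' j) (hlK' j)) (herr0 j)
    have h3 := hlK j
    have h4 := mul_le_mul_of_nonneg_left (hlK' j) (hck0 j)
    push_cast at h2 h3 h4
    simp only [err, ck] at *
    linarith
  · intro j
    have h1 := (c (j + 1)).sum_bound ch (Nat.succ_pos j) (hM j)
    have h1' := (c (j + 1)).entropy_messageKey_ge ch (hM j)
    rw [hlMK] at h1 h1'
    refine hdiv j _ _ _ ?_
    push_cast at h1 h1'
    have h2 := mul_le_mul_of_nonneg_left (add_le_add (hlM' j) (hlK' j)) (herr0 j)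
    have h3 := hlK j
    have h3' := hlM j
    have h4 := mul_le_mul_of_nonneg_left (add_le_add (hlM' j) (hlK' j)) (hmk0 j)
    push_cast at h2 h3 h3' h4
    simp only [err, mk] at *
    linarith

end converse

/-! ### Product laws: soft covering and the weak law of large numbers. -/

section productLaw

variable {ι T Y : Type*} [Fintype ι] [Fintype T] [Fintype Y] [DecidableEq ι]

/-- The product of the laws `μ i`. -/
noncomputable def productLaw (μ : ι → T → ℝ) (t : ι → T) : ℝ := ∏ i, μ i (t i)

variable {μ : ι → T → ℝ}

omit [Fintype T] [DecidableEq ι] in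
lemma productLaw_nonneg (hμ : ∀ i x, 0 ≤ μ i x) (t : ι → T) : 0 ≤ productLaw μ t :=
  Finset.prod_nonneg fun _ _ => hμ _ _

lemma sum_productLaw (hμ : ∀ i, ∑ x, μ i x = 1) : ∑ t, productLaw μ t = 1 := by
  unfold productLaw
  rw [sum_prod_pi]
  simp [hμ]

lemma sum_productLaw_mul (hμ : ∀ i, ∑ x, μ i x = 1) (i : ι) (g : T → ℝ) :
    ∑ t, productLaw μ t * g (t i) = ∑ x, μ i x * g x :=
  sum_prod_mul_coord μ hμ i g

lemma sum_productLaw_mul_mul (hμ : ∀ i, ∑ x, μ i x = 1) {i j : ι} (hij : i ≠ j) (g h : T → ℝ) :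
    ∑ t, productLaw μ t * (g (t i) * h (t j)) = (∑ x, μ i x * g x) * ∑ x, μ j x * h x := by
  have e : ∀ t : ι → T, productLaw μ t * (g (t i) * h (t j)) =
      ∏ k, μ k (t k) * ((if k = i then g (t k) else 1) * (if k = j then h (t k) else 1)) := by
    intro t
    rw [Finset.prod_mul_distrib, Finset.prod_mul_distrib,
      Finset.prod_ite_eq' Finset.univ i (fun k => g (t k)),
      Finset.prod_ite_eq' Finset.univ j (fun k => h (t k))]
    simp [productLaw]
  simp_rw [e]
  rw [sum_prod_pi (fun k x => μ k x * ((if k = i then g x else 1) * (if k = j then h x else 1))),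
    ← Finset.mul_prod_erase _ _ (Finset.mem_univ i),
    ← Finset.mul_prod_erase _ _ (Finset.mem_erase.2 ⟨hij.symm, Finset.mem_univ j⟩)]
  rw [Finset.prod_eq_one]
  · simp [hij, hij.symm]
  · intro k hk
    simp only [Finset.mem_erase, Finset.mem_univ, and_true] at hk
    simp [hk.1, hk.2, hμ]

/-- The variance of a sum of independent variables. -/
lemma sum_productLaw_sq (hμ : ∀ i, ∑ x, μ i x = 1) (g : ι → T → ℝ)
    (hg : ∀ i, ∑ x, μ i x * g i x = 0) :
    ∑ t, productLaw μ t * (∑ i, g i (t i)) ^ 2 = ∑ i, ∑ x, μ i x * g i x ^ 2 := by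
  have e : ∀ t : ι → T, productLaw μ t * (∑ i, g i (t i)) ^ 2 =
      ∑ i, ∑ j, productLaw μ t * (g i (t i) * g j (t j)) := by
    intro t
    rw [pow_two, Finset.sum_mul_sum, Finset.mul_sum]
    simp only [Finset.mul_sum]
  simp_rw [e]
  rw [Finset.sum_comm]
  refine Finset.sum_congr rfl fun i _ => ?_
  rw [Finset.sum_comm, Finset.sum_eq_single i]
  · rw [← sum_productLaw_mul hμ i (fun x => g i x ^ 2)]
    simp only [pow_two]
  · intro j _ hj
    rw [sum_productLaw_mul_mul hμ hj.symm, hg, zero_mul]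
  · simp

/-- Cauchy–Schwarz. -/
lemma sum_mul_abs_le_sqrt {Ω : Type*} [Fintype Ω] {w : Ω → ℝ} (hw : ∀ t, 0 ≤ w t)
    (hw1 : ∑ t, w t = 1) (Z : Ω → ℝ) :
    ∑ t, w t * |Z t| ≤ √(∑ t, w t * Z t ^ 2) := by
  apply Real.le_sqrt_of_sq_le
  have := Finset.sum_sq_le_sum_mul_sum_of_sq_le_mul Finset.univ (r := fun t => w t * |Z t|)
    (f := w) (g := fun t => w t * Z t ^ 2) (fun i _ => hw i)
    (fun i _ => mul_nonneg (hw i) (sq_nonneg _)) (fun i _ => by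
      rw [mul_pow, sq_abs]
      exact le_of_eq (by ring))
  rwa [hw1, one_mul] at this

/-- Soft covering: a sum of independent nonnegative functions is close to its mean, up to the
contribution of the large summands. -/
lemma softCovering (hμ0 : ∀ i x, 0 ≤ μ i x) (hμ : ∀ i, ∑ x, μ i x = 1) (f : ι → T → Y → ℝ)
    (hf : ∀ i x y, 0 ≤ f i x y) (ρ : Y → ℝ) (hρ : ∀ y, ∑ i, ∑ x, μ i x * f i x y = ρ y) {γ : ℝ}
    (hγ : 0 ≤ γ) :
    ∑ t, productLaw μ t * ∑ y, |∑ i, f i (t i) y - ρ y| ≤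
      √γ * ∑ y, ρ y +
        2 * ∑ y, ∑ i, ∑ x, μ i x * if γ * ρ y < f i x y then f i x y else 0 := by
  have hP0 := productLaw_nonneg hμ0
  have hP1 := sum_productLaw hμ
  have hρ0 : ∀ y, 0 ≤ ρ y := fun y => by
    rw [← hρ]
    exact Finset.sum_nonneg fun i _ => Finset.sum_nonneg fun x _ => mul_nonneg (hμ0 i x) (hf i x y)
  simp only [Finset.mul_sum (s := (Finset.univ : Finset Y))]
  rw [Finset.sum_comm, ← Finset.sum_add_distrib]
  refine Finset.sum_le_sum fun y _ => ?_
  -- Truncation at γρ(y). The small part has variance at most γρ(y)², hence mean deviation at most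
  -- √γ ρ(y). The large part is bounded by its first moment, once for the sum and once for its mean,
  -- which gives the factor 2.
  set f₁ : ι → T → ℝ := fun i x => if γ * ρ y < f i x y then 0 else f i x y with hf₁
  set f₂ : ι → T → ℝ := fun i x => if γ * ρ y < f i x y then f i x y else 0 with hf₂
  have hf₁0 : ∀ i x, 0 ≤ f₁ i x := fun i x => by
    simp only [hf₁]
    split_ifs
    exacts [le_rfl, hf i x y]
  have hf₂0 : ∀ i x, 0 ≤ f₂ i x := fun i x => by
    simp only [hf₂]
    split_ifs
    exacts [hf i x y, le_rfl]
  have hf₁γ : ∀ i x, f₁ i x ≤ γ * ρ y := fun i x => by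
    simp only [hf₁]
    split_ifs with h
    exacts [mul_nonneg hγ (hρ0 y), not_lt.1 h]
  have hsplit : ∀ i x, f i x y = f₁ i x + f₂ i x := fun i x => by
    simp only [hf₁, hf₂]
    split_ifs <;> simp
  set q₁ : ι → ℝ := fun i => ∑ x, μ i x * f₁ i x
  set q₂ : ι → ℝ := fun i => ∑ x, μ i x * f₂ i x
  have hq₂ : ∀ i, 0 ≤ q₂ i := fun i => Finset.sum_nonneg fun x _ => mul_nonneg (hμ0 i x) (hf₂0 i x)
  have hq : ρ y = ∑ i, q₁ i + ∑ i, q₂ i := by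
    rw [← hρ, ← Finset.sum_add_distrib]
    refine Finset.sum_congr rfl fun i _ => ?_
    rw [← Finset.sum_add_distrib]
    exact Finset.sum_congr rfl fun x _ => by rw [hsplit]; ring
  have hq₁ρ : ∑ i, q₁ i ≤ ρ y := by
    rw [hq]
    linarith [Finset.sum_nonneg fun i (_ : i ∈ Finset.univ) => hq₂ i]
  have hA : ∑ t, productLaw μ t * |∑ i, (f₁ i (t i) - q₁ i)| ≤ √γ * ρ y := by
    refine (sum_mul_abs_le_sqrt hP0 hP1 _).trans ?_
    rw [sum_productLaw_sq hμ (fun i x => f₁ i x - q₁ i)]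
    · rw [← Real.sqrt_sq (hρ0 y), ← Real.sqrt_mul hγ]
      apply Real.sqrt_le_sqrt
      have : ∀ i, ∑ x, μ i x * (f₁ i x - q₁ i) ^ 2 ≤ γ * ρ y * q₁ i := by
        intro i
        have e : ∑ x, μ i x * (f₁ i x - q₁ i) ^ 2 = ∑ x, μ i x * f₁ i x ^ 2 - q₁ i ^ 2 := by
          have : ∀ x, μ i x * (f₁ i x - q₁ i) ^ 2 = μ i x * f₁ i x ^ 2 -
              2 * q₁ i * (μ i x * f₁ i x) + q₁ i ^ 2 * μ i x := fun x => by ring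
          simp only [this, Finset.sum_add_distrib, Finset.sum_sub_distrib, ← Finset.mul_sum, hμ]
          change _ - 2 * q₁ i * q₁ i + _ = _
          ring
        rw [e, Finset.mul_sum]
        refine (sub_le_self _ (sq_nonneg _)).trans (Finset.sum_le_sum fun x _ => ?_)
        have := mul_le_mul_of_nonneg_left (hf₁γ i x) (mul_nonneg (hμ0 i x) (hf₁0 i x))
        nlinarith
      refine (Finset.sum_le_sum fun i _ => this i).trans ?_
      rw [← Finset.mul_sum]
      have := mul_le_mul_of_nonneg_left hq₁ρ (mul_nonneg hγ (hρ0 y))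
      linarith
    · intro i
      simp only [mul_sub, Finset.sum_sub_distrib, ← Finset.sum_mul, hμ, one_mul]
      exact sub_self _
  have hB : ∑ t, productLaw μ t * (∑ i, f₂ i (t i) + ∑ i, q₂ i) = 2 * ∑ i, q₂ i := by
    simp only [mul_add, Finset.sum_add_distrib, ← Finset.sum_mul, hP1, one_mul]
    simp only [Finset.mul_sum]
    rw [Finset.sum_comm]
    simp only [sum_productLaw_mul hμ]
    change ∑ i, q₂ i + _ = _
    rw [← Finset.mul_sum]
    ring
  refine le_trans (Finset.sum_le_sum (g := fun t => productLaw μ t *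
    |∑ i, (f₁ i (t i) - q₁ i)| + productLaw μ t * (∑ i, f₂ i (t i) + ∑ i, q₂ i)) fun t _ => ?_) ?_
  · rw [← mul_add]
    refine mul_le_mul_of_nonneg_left ?_ (hP0 t)
    have e : ∑ i, f i (t i) y - ρ y = ∑ i, (f₁ i (t i) - q₁ i) +
        (∑ i, f₂ i (t i) - ∑ i, q₂ i) := by
      simp only [hsplit, hq, Finset.sum_add_distrib, Finset.sum_sub_distrib]
      ring
    rw [e]
    refine (abs_add_le _ _).trans (add_le_add le_rfl ?_)
    have h1 : 0 ≤ ∑ i, f₂ i (t i) := Finset.sum_nonneg fun i _ => hf₂0 _ _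
    have h2 : 0 ≤ ∑ i, q₂ i := Finset.sum_nonneg fun i _ => hq₂ i
    rw [abs_le]
    constructor <;> linarith
  · rw [Finset.sum_add_distrib, hB]
    exact add_le_add hA le_rfl

/-- A random variable is at most its mean somewhere. -/
lemma exists_le_mean {Ω : Type*} [Fintype Ω] {w : Ω → ℝ} (hw : ∀ t, 0 ≤ w t)
    (hw1 : ∑ t, w t = 1) (Z : Ω → ℝ) {ε : ℝ} (h : ∑ t, w t * Z t ≤ ε) : ∃ t, Z t ≤ ε := by
  by_contra! hc
  have h1 : ∑ t, w t * (Z t - ε) ≤ 0 := by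
    simp only [mul_sub, Finset.sum_sub_distrib, ← Finset.sum_mul, hw1]
    linarith
  have h2 : ∀ t, w t * (Z t - ε) = 0 := by
    intro t
    exact (Finset.sum_eq_zero_iff_of_nonneg fun t _ =>
      mul_nonneg (hw t) (sub_nonneg.2 (hc t).le)).1
      (le_antisymm h1 (Finset.sum_nonneg fun t _ =>
        mul_nonneg (hw t) (sub_nonneg.2 (hc t).le))) t (Finset.mem_univ t)
  have h3 : ∀ t, w t = 0 := fun t =>
    (mul_eq_zero.1 (h2 t)).resolve_right (sub_pos.2 (hc t)).ne'
  simp [h3] at hw1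

open Filter Topology

/-- The weak law of large numbers on a finite alphabet. -/
lemma tendsto_deviation {p : T → ℝ} (hp : ∀ x, 0 ≤ p x) (hp1 : ∑ x, p x = 1) (g : T → ℝ) {δ : ℝ}
    (hδ : 0 < δ) :
    Tendsto (fun n : ℕ => ∑ t : Fin n → T, productLaw (fun _ => p) t *
      if (n : ℝ) * δ ≤ |∑ i, g (t i) - n * ∑ x, p x * g x| then 1 else 0) atTop (𝓝 0) := by
  set m := ∑ x, p x * g x
  -- Chebyshev's inequality bounds the probability by v / n.
  set v := ∑ x, p x * (g x - m) ^ 2 / δ ^ 2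
  have hlim : Tendsto (fun n : ℕ => v * ((n : ℝ)⁻¹)) atTop (𝓝 0) := by
    simpa using tendsto_inv_atTop_nhds_zero_nat.const_mul v
  have hP0 : ∀ n, ∀ t : Fin n → T, 0 ≤ productLaw (fun _ => p) t := fun n =>
    productLaw_nonneg fun _ => hp
  refine squeeze_zero' (Eventually.of_forall fun n => Finset.sum_nonneg fun t _ =>
    mul_nonneg (hP0 n t) (by split_ifs <;> norm_num)) ?_ hlim
  filter_upwards [eventually_gt_atTop 0] with n hn
  have hn' : (0 : ℝ) < n := by exact_mod_cast hn
  have hvar := sum_productLaw_sq (ι := Fin n) (μ := fun _ => p) (fun _ => hp1)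
    (fun _ x => g x - m) (fun _ => by
      simp only [mul_sub, Finset.sum_sub_distrib, ← Finset.sum_mul, hp1, one_mul]
      exact sub_self _)
  have e : v * (n : ℝ)⁻¹ = (∑ t : Fin n → T, productLaw (fun _ => p) t *
      (∑ i, (g (t i) - m)) ^ 2) / ((n : ℝ) * δ) ^ 2 := by
    rw [hvar, Finset.sum_const, Finset.card_univ, Fintype.card_fin, nsmul_eq_mul]
    simp only [v, ← Finset.sum_div]
    field_simp
  rw [e, Finset.sum_div]
  refine Finset.sum_le_sum fun t _ => ?_
  rw [mul_div_assoc]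
  refine mul_le_mul_of_nonneg_left ?_ (hP0 n t)
  split_ifs with h
  · rw [one_le_div (by positivity), sq_le_sq, abs_of_pos (by positivity)]
    simpa [Finset.sum_sub_distrib] using h
  · positivity

end productLaw

/-! ### Random codebooks, for one use of an abstract channel. -/

section randomCode

variable {S A B E : Type*} [Fintype S] [Fintype A] [Fintype B] [Fintype E]
  [DecidableEq S] {M K L : ℕ}

/-- The law of the entry of a random codebook at the state `j.1`, the message `j.2.1` and the
local randomness `j.2.2`: an input drawn from `μ j.1` and an independent uniform key. -/
noncomputable def entryLaw (μ : S → A → ℝ) (j : S × Fin M × Fin L) (x : A × Fin K) : ℝ :=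
  μ j.1 x.1 * (1 / (K : ℝ))

variable {q : S → ℝ} (hq : q ∈ stdSimplex ℝ S) {μ : S → A → ℝ} (hμ : ∀ s, μ s ∈ stdSimplex ℝ A)
  (hM : 0 < M) (hK : 0 < K) (hL : 0 < L)

omit [Fintype S] [DecidableEq S] in
include hμ in
lemma entryLaw_nonneg (j : S × Fin M × Fin L) (x : A × Fin K) : 0 ≤ entryLaw μ j x :=
  mul_nonneg ((hμ _).1 _) (by positivity)

omit [Fintype S] [DecidableEq S] in
include hμ hK in
lemma sum_entryLaw (j : S × Fin M × Fin L) : ∑ x : A × Fin K, entryLaw μ j x = 1 := by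
  have hK' : (K : ℝ) ≠ 0 := by exact_mod_cast hK.ne'
  simp only [entryLaw, Fintype.sum_prod_type, Finset.sum_const, Finset.card_univ,
    Fintype.card_fin, nsmul_eq_mul, ← Finset.sum_mul, ← Finset.mul_sum, (hμ _).2]
  field_simp

omit [Fintype S] [DecidableEq S] in
include hK in
lemma sum_entryLaw_mul_input (j : S × Fin M × Fin L) (g : A → ℝ) :
    ∑ x : A × Fin K, entryLaw μ j x * g x.1 = ∑ a, μ j.1 a * g a := by
  have hK' : (K : ℝ) ≠ 0 := by exact_mod_cast hK.ne'
  simp only [entryLaw, Fintype.sum_prod_type, Finset.sum_const, Finset.card_univ,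
    Fintype.card_fin, nsmul_eq_mul]
  refine Finset.sum_congr rfl fun a _ => ?_
  field_simp

omit [Fintype S] [DecidableEq S] in
lemma sum_entryLaw_mul_ite (j : S × Fin M × Fin L) (k : Fin K) (g : A → ℝ) :
    ∑ x : A × Fin K, entryLaw μ j x * (if x.2 = k then g x.1 else 0) =
      1 / (K : ℝ) * ∑ a, μ j.1 a * g a := by
  simp only [entryLaw, Fintype.sum_prod_type, mul_ite, mul_zero, Finset.sum_ite_eq',
    Finset.mem_univ, if_true, Finset.mul_sum]
  exact Finset.sum_congr rfl fun a _ => by ring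

omit [DecidableEq S] in
lemma sum_index (G : S → ℝ) : ∑ j : S × Fin M × Fin L, G j.1 = (M : ℝ) * L * ∑ s, G s := by
  rw [Fintype.sum_prod_type, Finset.mul_sum]
  refine Finset.sum_congr rfl fun s _ => ?_
  simp

lemma sum_key_index (G : E → ℝ) : ∑ y : Fin K × E, G y.2 = (K : ℝ) * ∑ e, G e := by
  rw [Fintype.sum_prod_type]
  simp

omit [DecidableEq S] in
lemma sum_index_message (m : Fin M) (G : S → ℝ) :
    ∑ j : S × Fin M × Fin L, (if j.2.1 = m then G j.1 else 0) = (L : ℝ) * ∑ s, G s := by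
  rw [Fintype.sum_prod_type, Finset.mul_sum]
  refine Finset.sum_congr rfl fun s _ => ?_
  rw [Fintype.sum_prod_type]
  simp

variable {WE : S → A → E → ℝ} (hWE : ∀ s a, WE s a ∈ stdSimplex ℝ E)

include hq hμ hM hK hL hWE in
-- Soft covering over all indices (s, m, l), with weights q(s)/(ML): state, message and local
-- randomness jointly cover the warden's output and the key.
lemma sum_codebook_covertKey {ρ : E → ℝ} (hρ : ∀ e, ∑ s, ∑ a, q s * μ s a * WE s a e = ρ e)
    {γ : ℝ} (hγ : 0 ≤ γ) :
    ∑ t : S × Fin M × Fin L → A × Fin K, productLaw (entryLaw μ) t *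
      ∑ y : Fin K × E, |∑ j, (if (t j).2 = y.1 then
        q j.1 / ((M : ℝ) * L) * WE j.1 (t j).1 y.2 else 0) - 1 / (K : ℝ) * ρ y.2| ≤
      √γ + 2 * ∑ s, ∑ a, ∑ e, q s * μ s a * WE s a e *
        if γ * (1 / (K : ℝ) * ρ e) < q s / ((M : ℝ) * L) * WE s a e then 1 else 0 := by
  have hK' : (K : ℝ) ≠ 0 := by exact_mod_cast hK.ne'
  have hM' : (M : ℝ) ≠ 0 := by exact_mod_cast hM.ne'
  have hL' : (L : ℝ) ≠ 0 := by exact_mod_cast hL.ne'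
  have hρ1 : ∑ e, ρ e = 1 := by
    simp only [← hρ]
    rw [Finset.sum_comm]
    simp only [fun s => Finset.sum_comm (s := (Finset.univ : Finset E)) (t := Finset.univ)
      (f := fun e a => q s * μ s a * WE s a e), ← Finset.mul_sum, (hWE _ _).2, mul_one,
      (hμ _).2, hq.2]
  have hρ0 : ∀ e, 0 ≤ ρ e := fun e => by
    rw [← hρ]
    exact Finset.sum_nonneg fun s _ => Finset.sum_nonneg fun a _ =>
      mul_nonneg (mul_nonneg (hq.1 s) ((hμ s).1 a)) ((hWE s a).1 e)
  refine (softCovering (Y := Fin K × E) (μ := entryLaw μ) (fun j x => entryLaw_nonneg hμ j x)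
    (fun j => sum_entryLaw hμ hK j)
    (fun j x y => if x.2 = y.1 then q j.1 / ((M : ℝ) * L) * WE j.1 x.1 y.2 else 0) ?_
    (fun y => 1 / (K : ℝ) * ρ y.2) ?_ hγ).trans (le_of_eq ?_)
  · intro j x y
    split_ifs
    · exact mul_nonneg (div_nonneg (hq.1 _) (by positivity)) ((hWE _ _).1 _)
    · exact le_rfl
  · rintro ⟨k, e⟩
    have e1 : ∀ j : S × Fin M × Fin L, ∑ x : A × Fin K, entryLaw μ j x *
        (if x.2 = k then q j.1 / ((M : ℝ) * L) * WE j.1 x.1 e else 0) =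
        1 / (K : ℝ) * ∑ a, μ j.1 a * (q j.1 / ((M : ℝ) * L) * WE j.1 a e) := fun j =>
      sum_entryLaw_mul_ite j k (fun a => q j.1 / ((M : ℝ) * L) * WE j.1 a e)
    simp only [e1, ← Finset.mul_sum]
    rw [sum_index (fun s => ∑ a, μ s a * (q s / ((M : ℝ) * L) * WE s a e)), ← hρ]
    congr 1
    rw [Finset.mul_sum]
    refine Finset.sum_congr rfl fun s _ => ?_
    rw [Finset.mul_sum]
    refine Finset.sum_congr rfl fun a _ => ?_
    field_simp
  · congr 1
    · rw [Fintype.sum_prod_type]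
      simp only [← Finset.mul_sum, hρ1, Finset.sum_const, Finset.card_univ, Fintype.card_fin,
        nsmul_eq_mul]
      field_simp
    · congr 1
      have e : ∀ (y : Fin K × E) (j : S × Fin M × Fin L) (x : A × Fin K),
          entryLaw μ j x * (if γ * (1 / (K : ℝ) * ρ y.2) <
            (if x.2 = y.1 then q j.1 / ((M : ℝ) * L) * WE j.1 x.1 y.2 else 0) then
            (if x.2 = y.1 then q j.1 / ((M : ℝ) * L) * WE j.1 x.1 y.2 else 0) else 0) =
          entryLaw μ j x * (if x.2 = y.1 then q j.1 / ((M : ℝ) * L) * (WE j.1 x.1 y.2 *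
            if γ * (1 / (K : ℝ) * ρ y.2) < q j.1 / ((M : ℝ) * L) * WE j.1 x.1 y.2
            then 1 else 0) else 0) := by
        intro y j x
        congr 1
        by_cases h : x.2 = y.1
        · simp [h]
        · simp [h]
      simp only [e]
      have e1 : ∀ (y : Fin K × E) (j : S × Fin M × Fin L), ∑ x : A × Fin K,
          entryLaw μ j x * (if x.2 = y.1 then q j.1 / ((M : ℝ) * L) * (WE j.1 x.1 y.2 *
            if γ * (1 / (K : ℝ) * ρ y.2) < q j.1 / ((M : ℝ) * L) * WE j.1 x.1 y.2
            then 1 else 0) else 0) = 1 / (K : ℝ) * ∑ a, μ j.1 a * (q j.1 / ((M : ℝ) * L) *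
            (WE j.1 a y.2 * if γ * (1 / (K : ℝ) * ρ y.2) < q j.1 / ((M : ℝ) * L) * WE j.1 a y.2
            then 1 else 0)) := fun y j =>
        sum_entryLaw_mul_ite j y.1 (fun a => q j.1 / ((M : ℝ) * L) * (WE j.1 a y.2 *
          if γ * (1 / (K : ℝ) * ρ y.2) < q j.1 / ((M : ℝ) * L) * WE j.1 a y.2 then 1 else 0))
      have e2 := fun y : Fin K × E => sum_index (M := M) (L := L) (fun s => 1 / (K : ℝ) *
        ∑ a, μ s a * (q s / ((M : ℝ) * L) *
            (WE s a y.2 * if γ * (1 / (K : ℝ) * ρ y.2) < q s / ((M : ℝ) * L) * WE s a y.2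
            then 1 else 0)))
      simp only [e1, e2]
      rw [sum_key_index (fun e => (M : ℝ) * L * ∑ s, 1 / (K : ℝ) *
        ∑ a, μ s a * (q s / ((M : ℝ) * L) *
            (WE s a e * if γ * (1 / (K : ℝ) * ρ e) < q s / ((M : ℝ) * L) * WE s a e
            then 1 else 0)))]
      simp only [Finset.mul_sum (s := (Finset.univ : Finset S)),
        Finset.mul_sum (s := (Finset.univ : Finset E))]
      rw [Finset.sum_comm]
      refine Finset.sum_congr rfl fun s _ => ?_
      rw [Finset.sum_comm]
      refine Finset.sum_congr rfl fun e _ => ?_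
      simp only [Finset.mul_sum]
      refine Finset.sum_congr rfl fun a _ => ?_
      field_simp

include hq hμ hM hK hL in
-- Soft covering again. With the message fixed only s and l randomise the key, so M cancels from the
-- comparison and L with q(s) must cover K.
lemma sum_codebook_messageKey {γ : ℝ} (hγ : 0 ≤ γ) :
    ∑ t : S × Fin M × Fin L → A × Fin K, productLaw (entryLaw μ) t *
      ∑ y : Fin M × Fin K, |∑ j, (if (t j).2 = y.2 then
        (if j.2.1 = y.1 then q j.1 / ((M : ℝ) * L) else 0) else 0) - 1 / ((M : ℝ) * K)| ≤
      √γ + 2 * ∑ s, q s *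
        if γ * (1 / ((M : ℝ) * K)) < q s / ((M : ℝ) * L) then 1 else 0 := by
  have hK' : (K : ℝ) ≠ 0 := by exact_mod_cast hK.ne'
  have hM' : (M : ℝ) ≠ 0 := by exact_mod_cast hM.ne'
  have hL' : (L : ℝ) ≠ 0 := by exact_mod_cast hL.ne'
  refine (softCovering (Y := Fin M × Fin K) (μ := entryLaw μ) (fun j x => entryLaw_nonneg hμ j x)
    (fun j => sum_entryLaw hμ hK j)
    (fun j x y => if x.2 = y.2 then (if j.2.1 = y.1 then q j.1 / ((M : ℝ) * L) else 0) else 0) ?_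
    (fun y => 1 / ((M : ℝ) * K)) ?_ hγ).trans (le_of_eq ?_)
  · intro j x y
    split_ifs
    · exact div_nonneg (hq.1 _) (by positivity)
    · exact le_rfl
    · exact le_rfl
  · rintro ⟨m, k⟩
    have e1 : ∀ j : S × Fin M × Fin L, ∑ x : A × Fin K, entryLaw μ j x *
        (if x.2 = k then (if j.2.1 = m then q j.1 / ((M : ℝ) * L) else 0) else 0) =
        1 / (K : ℝ) * ∑ a, μ j.1 a * (if j.2.1 = m then q j.1 / ((M : ℝ) * L) else 0) := fun j =>
      sum_entryLaw_mul_ite j k (fun _ => if j.2.1 = m then q j.1 / ((M : ℝ) * L) else 0)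
    simp only [e1, ← Finset.mul_sum, ← Finset.sum_mul, (hμ _).2, one_mul]
    rw [sum_index_message m (fun s => q s / ((M : ℝ) * L)), ← Finset.sum_div, hq.2]
    field_simp
  · congr 1
    · simp only [Finset.sum_const, Finset.card_univ, Fintype.card_prod, Fintype.card_fin,
        nsmul_eq_mul]
      push_cast
      field_simp
    · congr 1
      have e : ∀ (y : Fin M × Fin K) (j : S × Fin M × Fin L) (x : A × Fin K),
          entryLaw μ j x * (if γ * (1 / ((M : ℝ) * K)) <
            (if x.2 = y.2 then (if j.2.1 = y.1 then q j.1 / ((M : ℝ) * L) else 0) else 0) then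
            (if x.2 = y.2 then (if j.2.1 = y.1 then q j.1 / ((M : ℝ) * L) else 0) else 0) else 0) =
          entryLaw μ j x * (if x.2 = y.2 then (if j.2.1 = y.1 then q j.1 / ((M : ℝ) * L) *
            (if γ * (1 / ((M : ℝ) * K)) < q j.1 / ((M : ℝ) * L) then 1 else 0) else 0)
            else 0) := by
        intro y j x
        congr 1
        by_cases h : x.2 = y.2 <;> by_cases h' : j.2.1 = y.1 <;> simp [h, h']
      simp only [e]
      have e1 : ∀ (y : Fin M × Fin K) (j : S × Fin M × Fin L), ∑ x : A × Fin K,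
          entryLaw μ j x * (if x.2 = y.2 then (if j.2.1 = y.1 then q j.1 / ((M : ℝ) * L) *
            (if γ * (1 / ((M : ℝ) * K)) < q j.1 / ((M : ℝ) * L) then 1 else 0) else 0)
            else 0) = 1 / (K : ℝ) * ∑ a, μ j.1 a * (if j.2.1 = y.1 then q j.1 / ((M : ℝ) * L) *
            (if γ * (1 / ((M : ℝ) * K)) < q j.1 / ((M : ℝ) * L) then 1 else 0) else 0) :=
        fun y j => sum_entryLaw_mul_ite j y.2 (fun _ => if j.2.1 = y.1 then
          q j.1 / ((M : ℝ) * L) *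
            (if γ * (1 / ((M : ℝ) * K)) < q j.1 / ((M : ℝ) * L) then 1 else 0) else 0)
      have e2 := fun m : Fin M => sum_index_message (L := L) m (fun s => q s / ((M : ℝ) * L) *
            (if γ * (1 / ((M : ℝ) * K)) < q s / ((M : ℝ) * L) then 1 else 0))
      simp only [e1, ← Finset.mul_sum, ← Finset.sum_mul, (hμ _).2, one_mul, e2]
      simp only [Finset.sum_const, Finset.card_univ, Fintype.card_prod, Fintype.card_fin,
        nsmul_eq_mul]
      simp only [Finset.mul_sum]
      refine Finset.sum_congr rfl fun s _ => ?_
      push_cast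
      field_simp

variable {WB : S → A → B → ℝ} (hWB : ∀ s a, WB s a ∈ stdSimplex ℝ B)

open Classical in
/-- The threshold decoder. -/
noncomputable def thresholdDecoder (WB : S → A → B → ℝ) (PB : S → B → ℝ) (τ : ℝ)
    (hM : 0 < M) (hK : 0 < K) (t : S × Fin M × Fin L → A × Fin K) (b : B) (s : S) :
    Fin M × Fin K :=
  if h : ∃ y, τ * PB s b < WB s (t (s, y)).1 b then (h.choose.1, (t (s, h.choose)).2)
  else (⟨0, hM⟩, ⟨0, hK⟩)

omit [Fintype S] [Fintype A] [Fintype B] [DecidableEq S] in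
-- If the true entry passes the threshold and the answer is still wrong, the index chosen by the
-- decoder is another passing one. The state and index determine the key, so only indices matter.
lemma thresholdDecoder_error (PB : S → B → ℝ) (τ : ℝ)
    (t : S × Fin M × Fin L → A × Fin K) (b : B) (s : S) (y : Fin M × Fin L) :
    (if thresholdDecoder WB PB τ hM hK t b s ≠ (y.1, (t (s, y)).2) then (1 : ℝ) else 0) ≤
      (if WB s (t (s, y)).1 b ≤ τ * PB s b then 1 else 0) +
        ∑ y' ∈ Finset.univ.erase y, if τ * PB s b < WB s (t (s, y')).1 b then 1 else 0 := by
  have h0 : ∀ y', (0 : ℝ) ≤ if τ * PB s b < WB s (t (s, y')).1 b then 1 else 0 := fun y' => by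
    split_ifs <;> norm_num
  have hs := Finset.sum_nonneg fun y' (_ : y' ∈ Finset.univ.erase y) => h0 y'
  by_cases h1 : WB s (t (s, y)).1 b ≤ τ * PB s b
  · rw [if_pos h1]
    split_ifs <;> linarith
  · rw [if_neg h1, zero_add]
    by_cases h2 : thresholdDecoder WB PB τ hM hK t b s = (y.1, (t (s, y)).2)
    · rw [if_neg (not_not.2 h2)]
      exact hs
    · rw [if_pos h2]
      have h3 : ∃ y, τ * PB s b < WB s (t (s, y)).1 b := ⟨y, not_le.1 h1⟩
      unfold thresholdDecoder at h2
      rw [dif_pos h3] at h2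
      have h4 : h3.choose ≠ y := fun h => h2 (by rw [h])
      refine le_trans (by rw [if_pos h3.choose_spec]) (Finset.single_le_sum
        (f := fun y' => if τ * PB s b < WB s (t (s, y')).1 b then (1 : ℝ) else 0)
        (fun y' _ => h0 y') (Finset.mem_erase.2 ⟨h4, Finset.mem_univ _⟩))

include hq hμ hM hK hL hWB in
-- Union bound over the ML − 1 rivals, each costing 1/τ. The exact count matters: it vanishes for a
-- single entry, a case used when the channel carries no information.
lemma sum_codebook_error {PB : S → B → ℝ} (hPB : ∀ s b, ∑ a, μ s a * WB s a b = PB s b) {τ : ℝ}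
    (hτ : 0 < τ) :
    ∑ t : S × Fin M × Fin L → A × Fin K, productLaw (entryLaw μ) t *
      ∑ j : S × Fin M × Fin L, q j.1 / ((M : ℝ) * L) * ∑ b, WB j.1 (t j).1 b *
        (if thresholdDecoder WB PB τ hM hK t b j.1 ≠ (j.2.1, (t j).2) then (1 : ℝ) else 0) ≤
      ∑ s, ∑ a, ∑ b, q s * μ s a * WB s a b * (if WB s a b ≤ τ * PB s b then 1 else 0) +
        ((M : ℝ) * L - 1) / τ := by
  classical
  have hM' : (M : ℝ) ≠ 0 := by exact_mod_cast hM.ne'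
  have hL' : (L : ℝ) ≠ 0 := by exact_mod_cast hL.ne'
  have hP0 : ∀ t, 0 ≤ productLaw (entryLaw μ : S × Fin M × Fin L → A × Fin K → ℝ) t :=
    productLaw_nonneg (entryLaw_nonneg hμ)
  have hP1 := fun j : S × Fin M × Fin L => sum_entryLaw hμ hK j
  have hPB0 : ∀ s b, 0 ≤ PB s b := fun s b => by
    rw [← hPB]
    exact Finset.sum_nonneg fun a _ => mul_nonneg ((hμ s).1 a) ((hWB s a).1 b)
  have hc : ∀ j : S × Fin M × Fin L, 0 ≤ q j.1 / ((M : ℝ) * L) := fun j =>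
    div_nonneg (hq.1 _) (by positivity)
  have hterm : ∀ (j : S × Fin M × Fin L) (b : B),
      ∑ t : S × Fin M × Fin L → A × Fin K, productLaw (entryLaw μ) t * (WB j.1 (t j).1 b *
        (if thresholdDecoder WB PB τ hM hK t b j.1 ≠ (j.2.1, (t j).2) then (1 : ℝ) else 0)) ≤
      ∑ a, μ j.1 a * (WB j.1 a b * (if WB j.1 a b ≤ τ * PB j.1 b then 1 else 0)) +
        ∑ _y' ∈ Finset.univ.erase j.2, ∑ a, μ j.1 a * WB j.1 a b / τ := by
    rintro ⟨s, y⟩ b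
    dsimp only
    refine (Finset.sum_le_sum fun t _ => mul_le_mul_of_nonneg_left (mul_le_mul_of_nonneg_left
      (thresholdDecoder_error hM hK PB τ t b s y) ((hWB _ _).1 _)) (hP0 t)).trans ?_
    simp only [mul_add, Finset.sum_add_distrib]
    refine add_le_add (le_of_eq ?_) ?_
    · rw [← sum_entryLaw_mul_input hK (s, y) (fun a => WB s a b *
        (if WB s a b ≤ τ * PB s b then 1 else 0)), ← sum_productLaw_mul hP1 (s, y)]
    · simp only [Finset.mul_sum]
      rw [Finset.sum_comm]
      refine Finset.sum_le_sum fun y' hy' => ?_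
      have hne : ((s, y) : S × Fin M × Fin L) ≠ (s, y') := fun h =>
        (Finset.mem_erase.1 hy').1 (Prod.mk.inj h).2.symm
      rw [sum_productLaw_mul_mul hP1 hne (fun x => WB s x.1 b)
        (fun x => if τ * PB s b < WB s x.1 b then 1 else 0),
        sum_entryLaw_mul_input hK (s, y) (fun a => WB s a b),
        sum_entryLaw_mul_input hK (s, y') (fun a => if τ * PB s b < WB s a b then 1 else 0)]
      dsimp only
      rw [hPB, Finset.mul_sum]
      -- A rival entry is independent of the output, whose law is then `PB`; above the threshold
      -- `PB` is smaller than WB/τ, a change of measure.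
      refine Finset.sum_le_sum fun a _ => ?_
      rw [mul_div_assoc, mul_left_comm]
      refine mul_le_mul_of_nonneg_left ?_ ((hμ s).1 a)
      split_ifs with h
      · rw [mul_one, le_div_iff₀ hτ]
        linarith
      · rw [mul_zero]
        exact div_nonneg ((hWB s a).1 b) hτ.le
  have hswap : ∑ t : S × Fin M × Fin L → A × Fin K, productLaw (entryLaw μ) t *
      ∑ j : S × Fin M × Fin L, q j.1 / ((M : ℝ) * L) * ∑ b, WB j.1 (t j).1 b *
        (if thresholdDecoder WB PB τ hM hK t b j.1 ≠ (j.2.1, (t j).2) then (1 : ℝ) else 0) =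
      ∑ j : S × Fin M × Fin L, q j.1 / ((M : ℝ) * L) * ∑ b,
        ∑ t : S × Fin M × Fin L → A × Fin K, productLaw (entryLaw μ) t * (WB j.1 (t j).1 b *
        (if thresholdDecoder WB PB τ hM hK t b j.1 ≠ (j.2.1, (t j).2) then (1 : ℝ) else 0)) := by
    simp only [Finset.mul_sum]
    rw [Finset.sum_comm]
    refine Finset.sum_congr rfl fun j _ => ?_
    rw [Finset.sum_comm]
    exact Finset.sum_congr rfl fun b _ => Finset.sum_congr rfl fun t _ => by ring
  rw [hswap]
  refine (Finset.sum_le_sum fun j _ => mul_le_mul_of_nonneg_left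
    (Finset.sum_le_sum fun b _ => hterm j b) (hc j)).trans (le_of_eq ?_)
  simp only [Finset.sum_add_distrib, mul_add]
  congr 1
  · rw [sum_index (fun s => q s / ((M : ℝ) * L) * ∑ b, ∑ a, μ s a * (WB s a b *
      (if WB s a b ≤ τ * PB s b then 1 else 0))), Finset.mul_sum]
    refine Finset.sum_congr rfl fun s _ => ?_
    rw [Finset.sum_comm]
    simp only [Finset.mul_sum]
    refine Finset.sum_congr rfl fun a _ => Finset.sum_congr rfl fun b _ => ?_
    field_simp
  · have e1 : ∀ s, ∑ b, ∑ a, μ s a * WB s a b / τ = 1 / τ := by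
      intro s
      rw [Finset.sum_comm]
      simp only [← Finset.sum_div, ← Finset.mul_sum, (hWB _ _).2, mul_one, (hμ _).2]
    have e2 : ∀ y : Fin M × Fin L, ((Finset.univ.erase y).card : ℝ) = (M : ℝ) * L - 1 := by
      intro y
      rw [Finset.cast_card_erase_of_mem (Finset.mem_univ y)]
      simp
    simp only [Finset.sum_const, nsmul_eq_mul, e2, ← Finset.mul_sum, e1]
    rw [← Finset.sum_mul, Fintype.sum_prod_type]
    simp only [Finset.sum_const, Finset.card_univ, Fintype.card_fin, Fintype.card_prod,
      nsmul_eq_mul, ← Finset.mul_sum, ← Finset.sum_div, hq.2]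
    push_cast
    field_simp

include hq hμ hM hK hL hWB hWE in
/-- Random coding: some codebook is reliable, covert, secret, and has a nearly uniform key. -/
lemma exists_codebook {PB : S → B → ℝ} (hPB : ∀ s b, ∑ a, μ s a * WB s a b = PB s b)
    {ρ : E → ℝ} (hρ : ∀ e, ∑ s, ∑ a, q s * μ s a * WE s a e = ρ e) {τ γ₁ γ₂ : ℝ} (hτ : 0 < τ)
    (hγ₁ : 0 ≤ γ₁) (hγ₂ : 0 ≤ γ₂) :
    ∃ t : S × Fin M × Fin L → A × Fin K,
      (∑ j : S × Fin M × Fin L, q j.1 / ((M : ℝ) * L) * ∑ b, WB j.1 (t j).1 b *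
        (if thresholdDecoder WB PB τ hM hK t b j.1 ≠ (j.2.1, (t j).2) then (1 : ℝ) else 0)) +
      (∑ y : Fin K × E, |∑ j, (if (t j).2 = y.1 then
        q j.1 / ((M : ℝ) * L) * WE j.1 (t j).1 y.2 else 0) - 1 / (K : ℝ) * ρ y.2|) +
      (∑ y : Fin M × Fin K, |∑ j, (if (t j).2 = y.2 then
        (if j.2.1 = y.1 then q j.1 / ((M : ℝ) * L) else 0) else 0) - 1 / ((M : ℝ) * K)|) ≤
      (∑ s, ∑ a, ∑ b, q s * μ s a * WB s a b * (if WB s a b ≤ τ * PB s b then 1 else 0) +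
        ((M : ℝ) * L - 1) / τ) +
      (√γ₁ + 2 * ∑ s, ∑ a, ∑ e, q s * μ s a * WE s a e *
        if γ₁ * (1 / (K : ℝ) * ρ e) < q s / ((M : ℝ) * L) * WE s a e then 1 else 0) +
      (√γ₂ + 2 * ∑ s, q s *
        if γ₂ * (1 / ((M : ℝ) * K)) < q s / ((M : ℝ) * L) then 1 else 0) := by
  refine exists_le_mean (w := productLaw (entryLaw μ)) (productLaw_nonneg (entryLaw_nonneg hμ))
    (sum_productLaw fun j => sum_entryLaw hμ hK j) _ ?_
  simp only [mul_add, Finset.sum_add_distrib]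
  have h1 := sum_codebook_error hq hμ hM hK hL hWB hPB hτ
  have h2 := sum_codebook_covertKey hq hμ hM hK hL hWE hρ hγ₁
  have h3 := sum_codebook_messageKey hq hμ hM hK hL hγ₂
  linarith

end randomCode

/-! ### From codebooks to codes. -/

section codebookCode

variable {S A B E : Type*} [Fintype S] [Fintype A] [Fintype B] [Fintype E] {n M K L : ℕ}

open Classical in
/-- The code given by a codebook and a decoder; the encoder picks an entry of the codebook
uniformly among those of its message and state sequence. -/
noncomputable def codebookCode (hL : 0 < L)
    (t : (Fin n → S) × Fin M × Fin L → (Fin n → A) × Fin K)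
    (d : (Fin n → B) → (Fin n → S) → Fin M × Fin K) : Code S A B n M K where
  enc m s x := 1 / (L : ℝ) * ∑ l, if t (s, m, l) = x then 1 else 0
  enc_mem m s := by
    refine ⟨fun x => mul_nonneg (by positivity) (Finset.sum_nonneg fun l _ => ?_), ?_⟩
    · split_ifs <;> norm_num
    · have : (L : ℝ) ≠ 0 := by exact_mod_cast hL.ne'
      rw [← Finset.mul_sum, Finset.sum_comm]
      simp [this]
  dec b s y := if d b s = y then 1 else 0
  dec_mem b s := ⟨fun y => by dsimp only; split_ifs <;> norm_num, by simp⟩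

variable (ch : StateChannel S A B E) (hL : 0 < L)
  (t : (Fin n → S) × Fin M × Fin L → (Fin n → A) × Fin K)
  (d : (Fin n → B) → (Fin n → S) → Fin M × Fin K)

/-- Turns expectations under the code into weighted sums over codebook indices, the form controlled
by `exists_codebook`. -/
lemma sum_inputLaw_codebookCode (H : Fin M × (Fin n → S) × (Fin n → A) × Fin K → ℝ) :
    ∑ θ, (codebookCode hL t d).inputLaw ch θ * H θ =
      ∑ j : (Fin n → S) × Fin M × Fin L, (∏ i, ch.stateLaw (j.1 i)) / ((M : ℝ) * L) *
        H (j.2.1, j.1, t j) := by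
  classical
  have e : ∀ (m : Fin M) (s : Fin n → S), ∑ x : (Fin n → A) × Fin K,
      (codebookCode hL t d).inputLaw ch (m, s, x) * H (m, s, x) =
      ∑ l : Fin L, (∏ i, ch.stateLaw (s i)) / ((M : ℝ) * L) * H (m, s, t (s, m, l)) := by
    intro m s
    simp only [Code.inputLaw, codebookCode, Prod.mk.eta, Finset.mul_sum, Finset.sum_mul]
    rw [Finset.sum_comm]
    refine Finset.sum_congr rfl fun l _ => ?_
    rw [Finset.sum_eq_single (t (s, m, l))]
    · rw [if_pos rfl]
      field_simp
    · intro x _ hx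
      rw [if_neg hx.symm]
      ring
    · simp
  calc _ = ∑ m : Fin M, ∑ s : Fin n → S, ∑ x : (Fin n → A) × Fin K,
        (codebookCode hL t d).inputLaw ch (m, s, x) * H (m, s, x) := by
        rw [Fintype.sum_prod_type]
        exact Finset.sum_congr rfl fun m _ => Fintype.sum_prod_type _
    _ = ∑ s : Fin n → S, ∑ m : Fin M, ∑ l : Fin L,
        (∏ i, ch.stateLaw (s i)) / ((M : ℝ) * L) * H (m, s, t (s, m, l)) := by
        simp only [e]
        exact Finset.sum_comm
    _ = _ := by
        rw [Fintype.sum_prod_type]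
        exact Finset.sum_congr rfl fun s _ => by rw [Fintype.sum_prod_type]

lemma sum_outputLaw_codebookCode
    (G : (Fin M × (Fin n → S) × (Fin n → A) × Fin K) × (Fin n → B) × (Fin n → E) → ℝ) :
    ∑ ω, (codebookCode hL t d).outputLaw ch ω * G ω =
      ∑ j : (Fin n → S) × Fin M × Fin L, (∏ i, ch.stateLaw (j.1 i)) / ((M : ℝ) * L) *
        ∑ b : Fin n → B, ∑ e : Fin n → E, (∏ i, ch.trans ((t j).1 i) (j.1 i) (b i, e i)) *
          G ((j.2.1, j.1, t j), b, e) := by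
  rw [← sum_inputLaw_codebookCode ch hL t d (fun θ => ∑ b : Fin n → B, ∑ e : Fin n → E,
    (∏ i, ch.trans (θ.2.2.1 i) (θ.2.1 i) (b i, e i)) * G (θ, b, e)), Fintype.sum_prod_type]
  refine Finset.sum_congr rfl fun θ _ => ?_
  rw [Fintype.sum_prod_type]
  simp only [Finset.mul_sum]
  refine Finset.sum_congr rfl fun b _ => Finset.sum_congr rfl fun e _ => ?_
  rw [← mul_assoc]
  rfl

lemma errorProb_codebookCode : (codebookCode hL t d).errorProb ch =
    ∑ j : (Fin n → S) × Fin M × Fin L, (∏ i, ch.stateLaw (j.1 i)) / ((M : ℝ) * L) *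
      ∑ b : Fin n → B, (∏ i, ch.outB ((t j).1 i) (j.1 i) (b i)) *
        (if d b j.1 ≠ (j.2.1, (t j).2) then (1 : ℝ) else 0) := by
  classical
  rw [Code.errorProb_eq, sum_outputLaw_codebookCode ch hL t d (fun ω =>
    1 - (codebookCode hL t d).dec ω.2.1 ω.1.2.1 (ω.1.1, ω.1.2.2.2))]
  refine Finset.sum_congr rfl fun j _ => ?_
  congr 1
  refine Finset.sum_congr rfl fun b _ => ?_
  dsimp only
  rw [← Finset.sum_mul, sum_prod_pi (fun i e => ch.trans ((t j).1 i) (j.1 i) (b i, e))]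
  congr 1
  simp only [codebookCode]
  by_cases h : d b j.1 = (j.2.1, (t j).2) <;> simp [h]

lemma covertKeyDist_codebookCode : (codebookCode hL t d).covertKeyDist ch =
    1 / 2 * ∑ y : Fin K × (Fin n → E),
      |∑ j : (Fin n → S) × Fin M × Fin L, (if (t j).2 = y.1 then
        (∏ i, ch.stateLaw (j.1 i)) / ((M : ℝ) * L) * ∏ i, ch.outE ((t j).1 i) (j.1 i) (y.2 i)
        else 0) - 1 / (K : ℝ) * ∏ i, ch.wardenIdle (y.2 i)| := by
  classical
  rw [Code.covertKeyDist_eq, tvDist]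
  congr 1
  refine Finset.sum_congr rfl fun y _ => ?_
  congr 2
  have h1 : marginal ((codebookCode hL t d).outputLaw ch) (fun ω => (ω.1.2.2.2, ω.2.2)) y =
      ∑ ω, (codebookCode hL t d).outputLaw ch ω *
        if (ω.1.2.2.2, ω.2.2) = y then 1 else 0 := by
    simp [marginal_apply]
  rw [h1, sum_outputLaw_codebookCode ch hL t d (fun ω => if (ω.1.2.2.2, ω.2.2) = y then 1 else 0)]
  refine Finset.sum_congr rfl fun j _ => ?_
  obtain ⟨k, e⟩ := y
  have h2 : ∑ b : Fin n → B, ∏ i, ch.trans ((t j).1 i) (j.1 i) (b i, e i) =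
      ∏ i, ch.outE ((t j).1 i) (j.1 i) (e i) :=
    sum_prod_pi (fun i b => ch.trans ((t j).1 i) (j.1 i) (b, e i))
  by_cases h : (t j).2 = k
  · simp [h, h2]
  · simp [h]

lemma messageKeyDist_codebookCode : (codebookCode hL t d).messageKeyDist ch =
    1 / 2 * ∑ y : Fin M × Fin K,
      |∑ j : (Fin n → S) × Fin M × Fin L, (if (t j).2 = y.2 then (if j.2.1 = y.1 then
        (∏ i, ch.stateLaw (j.1 i)) / ((M : ℝ) * L) else 0) else 0) - 1 / ((M : ℝ) * K)| := by
  classical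
  rw [Code.messageKeyDist_eq, tvDist]
  congr 1
  refine Finset.sum_congr rfl fun y _ => ?_
  congr 2
  have h1 : marginal ((codebookCode hL t d).outputLaw ch) (fun ω => (ω.1.1, ω.1.2.2.2)) y =
      ∑ ω, (codebookCode hL t d).outputLaw ch ω *
        if (ω.1.1, ω.1.2.2.2) = y then 1 else 0 := by
    simp [marginal_apply]
  rw [h1, sum_outputLaw_codebookCode ch hL t d
    (fun ω => if (ω.1.1, ω.1.2.2.2) = y then 1 else 0)]
  refine Finset.sum_congr rfl fun j _ => ?_
  obtain ⟨m, k⟩ := y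
  simp only [← Finset.sum_mul, ch.sum_prod_trans, Prod.mk.injEq]
  by_cases h : (t j).2 = k <;> by_cases h' : j.2.1 = m <;> simp [h, h']

end codebookCode

/-! ### Block sums and the conditional law of the input. -/

section blocks

variable {S A B E : Type*} [Fintype S] [Fintype A] [Fintype B] [Fintype E] {n : ℕ}

lemma sum_arrow_prod {α β : Type*} [Fintype α] [Fintype β] (F : (Fin n → α × β) → ℝ) :
    ∑ t, F t = ∑ x : Fin n → α, ∑ y : Fin n → β, F (fun i => (x i, y i)) := by
  rw [← (Equiv.arrowProdEquivProdArrow (Fin n) (fun _ => α) (fun _ => β)).symm.sum_comp,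
    Fintype.sum_prod_type]
  rfl

lemma sum_letters_split (F : (Fin n → S × A × B × E) → ℝ) :
    ∑ t, F t = ∑ s : Fin n → S, ∑ a : Fin n → A, ∑ b : Fin n → B, ∑ e : Fin n → E,
      F (fun i => (s i, a i, b i, e i)) := by
  rw [sum_arrow_prod]
  refine Finset.sum_congr rfl fun s _ => ?_
  rw [sum_arrow_prod (fun t => F (fun i => (s i, t i)))]
  refine Finset.sum_congr rfl fun a _ => ?_
  rw [sum_arrow_prod (fun t => F (fun i => (s i, a i, t i)))]

lemma prod_mem_stdSimplex {α : Type*} [Fintype α] {f : Fin n → α → ℝ}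
    (hf : ∀ i, f i ∈ stdSimplex ℝ α) : (fun x : Fin n → α => ∏ i, f i (x i)) ∈
      stdSimplex ℝ (Fin n → α) := by
  refine ⟨fun x => Finset.prod_nonneg fun i _ => (hf i).1 _, ?_⟩
  rw [sum_prod_pi]
  simp [(hf _).2]

variable {ch : StateChannel S A B E} {ν : S × A → ℝ}

/-- Disintegration along the state, with the innocent law on null states. -/
lemma StateChannel.exists_conditional (hν : ν ∈ ch.inputLaws) :
    ∃ μ : S → A → ℝ, (∀ s, μ s ∈ stdSimplex ℝ A) ∧ ∀ s a, ν (s, a) = ch.stateLaw s * μ s a := by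
  refine ⟨fun s a => if ch.stateLaw s = 0 then ch.innocent a else ν (s, a) / ch.stateLaw s,
    fun s => ?_, fun s a => ?_⟩
  · dsimp only
    split_ifs with h
    · exact ch.innocent_mem
    · refine ⟨fun a => div_nonneg (hν.1 _) (ch.stateLaw_mem.1 s), ?_⟩
      rw [← Finset.sum_div, hν.2, div_self h]
  · dsimp only
    split_ifs with h
    · rw [h, zero_mul]
      have h1 := Finset.single_le_sum (f := fun a => ν (s, a)) (fun a _ => hν.1 (s, a))
        (Finset.mem_univ a)
      rw [hν.2, h] at h1
      exact le_antisymm h1 (hν.1 _)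
    · field_simp

end blocks

open Filter Topology

/-! ### Achievability at rates with strict slack. -/

section achievability

variable {S A B E : Type*} [Fintype S] [Fintype A] [Fintype B] [Fintype E]
  {ch : StateChannel S A B E} {ν : S × A → ℝ} {μ : S → A → ℝ}

/-- The law of the receiver's output given the state. -/
noncomputable def StateChannel.outGivenState (ch : StateChannel S A B E) (μ : S → A → ℝ) (s : S)
    (b : B) : ℝ :=
  ∑ a, μ s a * ch.outB a s b

variable (hμ : ∀ s, μ s ∈ stdSimplex ℝ A) (hν : ν ∈ ch.inputLaws)
  (hνμ : ∀ s a, ν (s, a) = ch.stateLaw s * μ s a)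
  (hE : marginal (ch.letterLaw ν) (fun t => t.2.2.2) = ch.wardenIdle)

include hν hνμ in
-- I(A;B|S) is the mean of the information density that the decoder compares with its threshold.
lemma infoAB_S_eq_mean : infoAB_S (ch.letterLaw ν) = ∑ t, ch.letterLaw ν t *
    (Real.logb 2 (ch.outB t.2.1 t.1 t.2.2.1) -
      Real.logb 2 (ch.outGivenState μ t.1 t.2.2.1)) := by
  have h : condEntropy (ch.letterLaw ν) (fun t => t.2.2.1) (fun t => t.1) =
      ∑ t, ch.letterLaw ν t * -Real.logb 2 (ch.outGivenState μ t.1 t.2.2.1) := by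
    refine condEntropy_eq_of_factor (ch.letterLaw_nonneg hν) _ _ (ch.outGivenState μ) ?_
    intro b s
    rw [ch.marginal_letterLaw_S hν, marginal_eq_sum_of_equiv (κ := A × E)
      (e := ⟨fun y => (y.1.2, y.2.1, y.1.1, y.2.2), fun t => ((t.2.2.1, t.1), (t.2.1, t.2.2.2)),
        fun _ => rfl, fun _ => rfl⟩) (h := fun _ _ => rfl)]
    simp only [Equiv.coe_fn_mk, StateChannel.letterLaw, Fintype.sum_prod_type, hνμ,
      StateChannel.outGivenState, StateChannel.outB, Finset.mul_sum]
    exact Finset.sum_congr rfl fun a _ => Finset.sum_congr rfl fun e _ => by ring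
  unfold infoAB_S
  rw [h, ch.condEntropy_letterLaw_B hν, ← Finset.sum_sub_distrib]
  exact Finset.sum_congr rfl fun t _ => by ring

include hν in
lemma stateEntropy_eq_mean : stateEntropy (ch.letterLaw ν) = -∑ t, ch.letterLaw ν t *
    Real.logb 2 (ch.stateLaw t.1) := by
  unfold stateEntropy
  rw [entropy_eq_sum, ← Finset.sum_neg_distrib]
  exact Finset.sum_congr rfl fun t _ => by rw [ch.marginal_letterLaw_S hν]; ring

include hν hE in
-- I(A,S;E) − H(S) as a mean: the exponent of the summands in soft covering, relative to Q₀ⁿ.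
lemma leakage_eq_mean : -stateEntropy (ch.letterLaw ν) +
    (entropy (ch.letterLaw ν) (fun t => t.2.2.2) -
      condEntropy (ch.letterLaw ν) (fun t => t.2.2.2) (fun t => (t.2.1, t.1))) =
    ∑ t, ch.letterLaw ν t * (Real.logb 2 (ch.stateLaw t.1) +
      Real.logb 2 (ch.outE t.2.1 t.1 t.2.2.2) - Real.logb 2 (ch.wardenIdle t.2.2.2)) := by
  rw [stateEntropy_eq_mean hν, entropy_eq_sum, hE, ch.condEntropy_letterLaw_E hν,
    ← Finset.sum_sub_distrib, neg_neg, ← Finset.sum_add_distrib]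
  exact Finset.sum_congr rfl fun t _ => by ring

/-- The implication is required only at positive mass, where all factors are positive and logarithms
may be taken. -/
lemma sum_mul_ite_le {Ω : Type*} [Fintype Ω] {w : Ω → ℝ} (hw : ∀ t, 0 ≤ w t) {P Q : Ω → Prop}
    [DecidablePred P] [DecidablePred Q] (h : ∀ t, 0 < w t → P t → Q t) :
    ∑ t, w t * (if P t then 1 else 0) ≤ ∑ t, w t * if Q t then 1 else 0 := by
  refine Finset.sum_le_sum fun t _ => ?_
  rcases (hw t).eq_or_lt with h0 | h0
  · simp [← h0]
  · refine mul_le_mul_of_nonneg_left ?_ h0.le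
    by_cases hP : P t
    · rw [if_pos hP, if_pos (h t h0 hP)]
    · rw [if_neg hP]
      split_ifs <;> norm_num

variable {n : ℕ}

include hνμ in
lemma productLaw_letterLaw (s : Fin n → S) (a : Fin n → A) (b : Fin n → B) (e : Fin n → E) :
    productLaw (fun _ => ch.letterLaw ν) (fun i => (s i, a i, b i, e i)) =
      (∏ i, ch.stateLaw (s i)) * (∏ i, μ (s i) (a i)) * ∏ i, ch.trans (a i) (s i) (b i, e i) := by
  simp only [productLaw, StateChannel.letterLaw, hνμ, Finset.prod_mul_distrib]

include hνμ in
-- Puts events about (Sⁿ, Aⁿ, Bⁿ) on the i.i.d. sequence of letters, to which the law of large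
-- numbers applies.
lemma sum_block_B (f : (Fin n → S) → (Fin n → A) → (Fin n → B) → ℝ) :
    ∑ s : Fin n → S, ∑ a : Fin n → A, ∑ b : Fin n → B, (∏ i, ch.stateLaw (s i)) *
      (∏ i, μ (s i) (a i)) * (∏ i, ch.outB (a i) (s i) (b i)) * f s a b =
    ∑ t : Fin n → S × A × B × E, productLaw (fun _ => ch.letterLaw ν) t *
      f (fun i => (t i).1) (fun i => (t i).2.1) (fun i => (t i).2.2.1) := by
  rw [sum_letters_split]
  refine Finset.sum_congr rfl fun s _ => Finset.sum_congr rfl fun a _ =>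
    Finset.sum_congr rfl fun b _ => ?_
  simp only [productLaw_letterLaw hνμ, ← Finset.sum_mul, ← Finset.mul_sum]
  rw [sum_prod_pi (fun i e => ch.trans (a i) (s i) (b i, e))]
  rfl

include hνμ in
lemma sum_block_E (f : (Fin n → S) → (Fin n → A) → (Fin n → E) → ℝ) :
    ∑ s : Fin n → S, ∑ a : Fin n → A, ∑ e : Fin n → E, (∏ i, ch.stateLaw (s i)) *
      (∏ i, μ (s i) (a i)) * (∏ i, ch.outE (a i) (s i) (e i)) * f s a e =
    ∑ t : Fin n → S × A × B × E, productLaw (fun _ => ch.letterLaw ν) t *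
      f (fun i => (t i).1) (fun i => (t i).2.1) (fun i => (t i).2.2.2) := by
  rw [sum_letters_split]
  refine Finset.sum_congr rfl fun s _ => Finset.sum_congr rfl fun a _ => ?_
  rw [Finset.sum_comm]
  refine Finset.sum_congr rfl fun e _ => ?_
  simp only [productLaw_letterLaw hνμ, ← Finset.sum_mul, ← Finset.mul_sum]
  rw [sum_prod_pi (fun i b => ch.trans (a i) (s i) (b, e i))]
  rfl

include hνμ hμ in
lemma sum_block_S (f : (Fin n → S) → ℝ) :
    ∑ s : Fin n → S, (∏ i, ch.stateLaw (s i)) * f s =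
    ∑ t : Fin n → S × A × B × E, productLaw (fun _ => ch.letterLaw ν) t *
      f (fun i => (t i).1) := by
  rw [← sum_block_B hνμ (fun s _ _ => f s)]
  refine Finset.sum_congr rfl fun s _ => ?_
  have h1 : ∀ a : Fin n → A, ∑ b : Fin n → B, ∏ i, ch.outB (a i) (s i) (b i) = 1 := fun a => by
    rw [sum_prod_pi (fun i b => ch.outB (a i) (s i) b)]
    simp [ch.sum_outB]
  have h2 : ∑ a : Fin n → A, ∏ i, μ (s i) (a i) = 1 := by
    rw [sum_prod_pi (fun i a => μ (s i) a)]
    simp [(hμ _).2]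
  simp only [← Finset.sum_mul, ← Finset.mul_sum, h1, h2, mul_one]

/-- Positivity of the factors of the law of a letter. -/
lemma letterLaw_factors_pos (hμ : ∀ s, μ s ∈ stdSimplex ℝ A) (hν : ν ∈ ch.inputLaws)
    (hνμ : ∀ s a, ν (s, a) = ch.stateLaw s * μ s a)
    (hE : marginal (ch.letterLaw ν) (fun t => t.2.2.2) = ch.wardenIdle) {t : S × A × B × E}
    (h : ch.letterLaw ν t ≠ 0) : 0 < ch.stateLaw t.1 ∧ 0 < ch.outB t.2.1 t.1 t.2.2.1 ∧
      0 < ch.outE t.2.1 t.1 t.2.2.2 ∧ 0 < ch.outGivenState μ t.1 t.2.2.1 ∧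
      0 < ch.wardenIdle t.2.2.2 := by
  obtain ⟨s, a, b, e⟩ := t
  have h0 : 0 < ch.letterLaw ν (s, a, b, e) := lt_of_le_of_ne (ch.letterLaw_nonneg hν _) h.symm
  simp only [StateChannel.letterLaw, hνμ, ne_eq, mul_eq_zero, not_or] at h
  obtain ⟨⟨h1, h2⟩, h3⟩ := h
  have h2' : 0 < μ s a := lt_of_le_of_ne ((hμ s).1 a) (Ne.symm h2)
  have h3' : 0 < ch.trans a s (b, e) := lt_of_le_of_ne (ch.trans_nonneg _ _ _) (Ne.symm h3)
  have hB := h3'.trans_le (ch.trans_le_outB a s b e)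
  refine ⟨lt_of_le_of_ne (ch.stateLaw_mem.1 s) (Ne.symm h1), hB,
    h3'.trans_le (ch.trans_le_outE a s b e), ?_, ?_⟩
  · exact Finset.sum_pos' (fun a _ => mul_nonneg ((hμ s).1 a) (ch.outB_nonneg _ _ _))
      ⟨a, Finset.mem_univ a, mul_pos h2' hB⟩
  · rw [← hE]
    exact marginal_pos (ch.letterLaw_nonneg hν) (fun t => t.2.2.2) h0

lemma logb_prod_eq {f : Fin n → ℝ} (h : ∀ i, 0 < f i) :
    Real.logb 2 (∏ i, f i) = ∑ i, Real.logb 2 (f i) :=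
  Real.logb_prod _ _ fun i _ => (h i).ne'

/-- The probability that the empirical mean of `g` deviates by at least `δ`. -/
noncomputable def deviation (p : S × A × B × E → ℝ) (g : S × A × B × E → ℝ) (δ : ℝ) (n : ℕ) : ℝ :=
  ∑ t : Fin n → S × A × B × E, productLaw (fun _ => p) t *
    if (n : ℝ) * δ ≤ |∑ i, g (t i) - n * ∑ x, p x * g x| then 1 else 0

lemma tendsto_letterLaw_deviation (hν : ν ∈ ch.inputLaws) (g : S × A × B × E → ℝ) {δ : ℝ}
    (hδ : 0 < δ) : Tendsto (deviation (ch.letterLaw ν) g δ) atTop (𝓝 0) :=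
  tendsto_deviation (ch.letterLaw_nonneg hν) (ch.sum_letterLaw hν) g hδ

include hμ hν hνμ hE in
-- In logarithms, a true entry below the threshold 2^{n(I−δ)} is an empirical information density at
-- least δ under its mean.
lemma decoding_deviation (δ : ℝ) :
    ∑ s : Fin n → S, ∑ a : Fin n → A, ∑ b : Fin n → B, (∏ i, ch.stateLaw (s i)) *
      (∏ i, μ (s i) (a i)) * (∏ i, ch.outB (a i) (s i) (b i)) *
      (if ∏ i, ch.outB (a i) (s i) (b i) ≤ (2 : ℝ) ^ ((n : ℝ) *
        (infoAB_S (ch.letterLaw ν) - δ)) * ∏ i, ch.outGivenState μ (s i) (b i) then 1 else 0) ≤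
    deviation (ch.letterLaw ν) (fun t => Real.logb 2 (ch.outB t.2.1 t.1 t.2.2.1) -
      Real.logb 2 (ch.outGivenState μ t.1 t.2.2.1)) δ n := by
  rw [sum_block_B hνμ (fun s a b => if ∏ i, ch.outB (a i) (s i) (b i) ≤ (2 : ℝ) ^ ((n : ℝ) *
        (infoAB_S (ch.letterLaw ν) - δ)) * ∏ i, ch.outGivenState μ (s i) (b i) then 1 else 0)]
  refine sum_mul_ite_le (productLaw_nonneg fun _ => ch.letterLaw_nonneg hν) fun t ht h => ?_
  have hpos := fun i => letterLaw_factors_pos hμ hν hνμ hE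
    (Finset.prod_ne_zero_iff.1 ht.ne' i (Finset.mem_univ i))
  have hB := Finset.prod_pos fun i (_ : i ∈ Finset.univ) => (hpos i).2.1
  have hG := Finset.prod_pos fun i (_ : i ∈ Finset.univ) => (hpos i).2.2.2.1
  have h1 := (Real.logb_le_logb (b := 2) (by norm_num) hB
    (mul_pos (by positivity) hG)).2 h
  rw [Real.logb_mul (by positivity) hG.ne', Real.logb_rpow (by norm_num) (by norm_num),
    logb_prod_eq (fun i => (hpos i).2.1), logb_prod_eq (fun i => (hpos i).2.2.2.1)] at h1
  rw [← infoAB_S_eq_mean hν hνμ, Finset.sum_sub_distrib]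
  refine le_trans ?_ (neg_le_abs _)
  linarith

include hμ hν hνμ hE in
-- `h` is the covering rate condition with N = ML indices; under it, a summand above the truncation
-- level makes the empirical exponent exceed D by at least δ.
lemma covering_deviation {K N D δ : ℝ} (hK : 0 < K) (hN : 0 < N) {γ : ℝ} (hγ : 0 < γ)
    (hD : D = -stateEntropy (ch.letterLaw ν) +
      (entropy (ch.letterLaw ν) (fun t => t.2.2.2) -
      condEntropy (ch.letterLaw ν) (fun t => t.2.2.2) (fun t => (t.2.1, t.1))))
    (h : (n : ℝ) * (D + δ) ≤ Real.logb 2 γ + Real.logb 2 N - Real.logb 2 K) :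
    ∑ s : Fin n → S, ∑ a : Fin n → A, ∑ e : Fin n → E, (∏ i, ch.stateLaw (s i)) *
      (∏ i, μ (s i) (a i)) * (∏ i, ch.outE (a i) (s i) (e i)) *
      (if γ * (1 / K * ∏ i, ch.wardenIdle (e i)) <
        (∏ i, ch.stateLaw (s i)) / N * ∏ i, ch.outE (a i) (s i) (e i) then 1 else 0) ≤
    deviation (ch.letterLaw ν) (fun t => Real.logb 2 (ch.stateLaw t.1) +
      Real.logb 2 (ch.outE t.2.1 t.1 t.2.2.2) - Real.logb 2 (ch.wardenIdle t.2.2.2)) δ n := by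
  rw [sum_block_E hνμ (fun s a e => if γ * (1 / K * ∏ i, ch.wardenIdle (e i)) <
        (∏ i, ch.stateLaw (s i)) / N * ∏ i, ch.outE (a i) (s i) (e i) then 1 else 0)]
  refine sum_mul_ite_le (productLaw_nonneg fun _ => ch.letterLaw_nonneg hν) fun t ht h' => ?_
  have hpos := fun i => letterLaw_factors_pos hμ hν hνμ hE
    (Finset.prod_ne_zero_iff.1 ht.ne' i (Finset.mem_univ i))
  have hS := Finset.prod_pos fun i (_ : i ∈ Finset.univ) => (hpos i).1
  have hW := Finset.prod_pos fun i (_ : i ∈ Finset.univ) => (hpos i).2.2.1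
  have hI := Finset.prod_pos fun i (_ : i ∈ Finset.univ) => (hpos i).2.2.2.2
  have h1 := (Real.logb_le_logb (b := 2) (by norm_num) (mul_pos hγ (mul_pos (one_div_pos.2 hK) hI))
    (mul_pos (div_pos hS hN) hW)).2 h'.le
  rw [Real.logb_mul hγ.ne' (mul_pos (one_div_pos.2 hK) hI).ne',
    Real.logb_mul (one_div_pos.2 hK).ne' hI.ne', Real.logb_mul (div_pos hS hN).ne' hW.ne',
    Real.logb_div hS.ne' hN.ne', one_div, Real.logb_inv,
    logb_prod_eq (fun i => (hpos i).1), logb_prod_eq (fun i => (hpos i).2.2.1),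
    logb_prod_eq (fun i => (hpos i).2.2.2.2)] at h1
  rw [← leakage_eq_mean hν hE, ← hD, Finset.sum_sub_distrib, Finset.sum_add_distrib]
  refine le_trans ?_ (le_abs_self _)
  linarith

include hμ hν hνμ hE in
-- Asymptotic equipartition for the state: a large summand needs a state sequence of probability at
-- least 2^{−n(H(S)−δ)}.
lemma uniform_deviation {K M L δ : ℝ} (hK : 0 < K) (hM : 0 < M) (hL : 0 < L) {γ : ℝ} (hγ : 0 < γ)
    (h : (n : ℝ) * (δ - stateEntropy (ch.letterLaw ν)) ≤
      Real.logb 2 γ + Real.logb 2 L - Real.logb 2 K) :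
    ∑ s : Fin n → S, (∏ i, ch.stateLaw (s i)) *
      (if γ * (1 / (M * K)) < (∏ i, ch.stateLaw (s i)) / (M * L) then 1 else 0) ≤
    deviation (ch.letterLaw ν) (fun t => Real.logb 2 (ch.stateLaw t.1)) δ n := by
  rw [sum_block_S hμ hνμ (fun s => if γ * (1 / (M * K)) <
    (∏ i, ch.stateLaw (s i)) / (M * L) then 1 else 0)]
  refine sum_mul_ite_le (productLaw_nonneg fun _ => ch.letterLaw_nonneg hν) fun t ht h' => ?_
  have hpos := fun i => letterLaw_factors_pos hμ hν hνμ hE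
    (Finset.prod_ne_zero_iff.1 ht.ne' i (Finset.mem_univ i))
  have hS := Finset.prod_pos fun i (_ : i ∈ Finset.univ) => (hpos i).1
  have h1 := (Real.logb_le_logb (b := 2) (by norm_num) (by positivity)
    (div_pos hS (mul_pos hM hL))).2 h'.le
  rw [Real.logb_mul hγ.ne' (by positivity), Real.logb_div hS.ne' (by positivity), one_div,
    Real.logb_inv, Real.logb_mul hM.ne' hK.ne', Real.logb_mul hM.ne' hL.ne',
    logb_prod_eq (fun i => (hpos i).1)] at h1
  have h2 := stateEntropy_eq_mean hν
  refine le_trans ?_ (le_abs_self _)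
  have h3 : (∑ x, ch.letterLaw ν x * Real.logb 2 (ch.stateLaw x.1)) =
    -stateEntropy (ch.letterLaw ν) := by linarith
  rw [h3]
  linarith

include hμ hν hνμ hE in
/-- The errors of some code of given sizes, in terms of deviation probabilities. -/
lemma exists_code_le {M K L : ℕ} (hM : 0 < M) (hK : 0 < K) (hL : 0 < L) {D δ : ℝ}
    (hD : D = -stateEntropy (ch.letterLaw ν) +
      (entropy (ch.letterLaw ν) (fun t => t.2.2.2) -
      condEntropy (ch.letterLaw ν) (fun t => t.2.2.2) (fun t => (t.2.1, t.1))))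
    (h1 : (n : ℝ) * (D + δ) ≤ -(n * δ) + Real.logb 2 ((M : ℝ) * L) - Real.logb 2 K)
    (h2 : (n : ℝ) * (δ - stateEntropy (ch.letterLaw ν)) ≤
      -(n * δ) + Real.logb 2 L - Real.logb 2 K) :
    ∃ c : Code S A B n M K, c.errorProb ch + c.covertKeyDist ch + c.messageKeyDist ch ≤
      deviation (ch.letterLaw ν) (fun t => Real.logb 2 (ch.outB t.2.1 t.1 t.2.2.1) -
        Real.logb 2 (ch.outGivenState μ t.1 t.2.2.1)) δ n +
      ((M : ℝ) * L - 1) / (2 : ℝ) ^ ((n : ℝ) * (infoAB_S (ch.letterLaw ν) - δ)) +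
      2 * √((2 : ℝ) ^ (-(n * δ))) +
      2 * deviation (ch.letterLaw ν) (fun t => Real.logb 2 (ch.stateLaw t.1) +
        Real.logb 2 (ch.outE t.2.1 t.1 t.2.2.2) - Real.logb 2 (ch.wardenIdle t.2.2.2)) δ n +
      2 * deviation (ch.letterLaw ν) (fun t => Real.logb 2 (ch.stateLaw t.1)) δ n := by
  classical
  have hK' : (0 : ℝ) < K := by exact_mod_cast hK
  have hM' : (0 : ℝ) < M := by exact_mod_cast hM
  have hL' : (0 : ℝ) < L := by exact_mod_cast hL
  set γ : ℝ := (2 : ℝ) ^ (-(n * δ)) with hγ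
  have hγ0 : 0 < γ := by positivity
  have hγl : Real.logb 2 γ = -(n * δ) := Real.logb_rpow (by norm_num) (by norm_num)
  have hWB : ∀ a s, ch.outB a s ∈ stdSimplex ℝ B := fun a s =>
    ⟨ch.outB_nonneg a s, ch.sum_outB a s⟩
  have hWE : ∀ a s, ch.outE a s ∈ stdSimplex ℝ E := fun a s =>
    ⟨ch.outE_nonneg a s, ch.sum_outE a s⟩
  have hρ1 : ∀ e, ∑ x : S × A, ch.stateLaw x.1 * μ x.1 x.2 * ch.outE x.2 x.1 e =
      ch.wardenIdle e := fun e => by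
    rw [← hE, ch.marginal_letterLaw_E]
    exact Finset.sum_congr rfl fun x _ => by rw [← hνμ]
  obtain ⟨t, ht⟩ := exists_codebook (S := Fin n → S) (A := Fin n → A) (B := Fin n → B)
    (E := Fin n → E) (L := L) (q := fun s => ∏ i, ch.stateLaw (s i))
    (prod_mem_stdSimplex fun _ => ch.stateLaw_mem) (μ := fun s a => ∏ i, μ (s i) (a i))
    (fun s => prod_mem_stdSimplex fun i => hμ (s i)) hM hK hL
    (WE := fun s a e => ∏ i, ch.outE (a i) (s i) (e i))
    (fun s a => prod_mem_stdSimplex fun i => hWE (a i) (s i))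
    (WB := fun s a b => ∏ i, ch.outB (a i) (s i) (b i))
    (fun s a => prod_mem_stdSimplex fun i => hWB (a i) (s i))
    (PB := fun s b => ∏ i, ch.outGivenState μ (s i) (b i))
    (by
      intro s b
      simp only [← Finset.prod_mul_distrib]
      rw [sum_prod_pi (fun i a => μ (s i) a * ch.outB a (s i) (b i))]
      rfl)
    (ρ := fun e => ∏ i, ch.wardenIdle (e i))
    (by
      intro e
      simp only [← Finset.prod_mul_distrib]
      rw [sum_prod_pi_pair (fun i s a => ch.stateLaw s * μ s a * ch.outE a s (e i))]
      refine Finset.prod_congr rfl fun i _ => ?_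
      rw [← hρ1, Fintype.sum_prod_type])
    (τ := (2 : ℝ) ^ ((n : ℝ) * (infoAB_S (ch.letterLaw ν) - δ))) (γ₁ := γ) (γ₂ := γ)
    (by positivity) hγ0.le hγ0.le
  refine ⟨codebookCode hL t (thresholdDecoder
    (fun s a b => ∏ i, ch.outB (a i) (s i) (b i)) (fun s b => ∏ i, ch.outGivenState μ (s i) (b i))
    ((2 : ℝ) ^ ((n : ℝ) * (infoAB_S (ch.letterLaw ν) - δ))) hM hK t), ?_⟩
  rw [errorProb_codebookCode, covertKeyDist_codebookCode, messageKeyDist_codebookCode]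
  have d1 := decoding_deviation (n := n) hμ hν hνμ hE δ
  have d2 := covering_deviation (n := n) hμ hν hνμ hE (δ := δ) hK' (mul_pos hM' hL') hγ0 hD
    (by rw [hγl]; exact h1)
  have d3 := uniform_deviation (n := n) hμ hν hνμ hE (δ := δ) hK' hM' hL' hγ0
    (by rw [hγl]; exact h2)
  -- The factor 1/2 of the total variation distances is simply dropped.
  have n1 : ∀ x : ℝ, 0 ≤ x → 1 / 2 * x ≤ x := fun x hx => by linarith
  refine (add_le_add (add_le_add le_rfl (n1 _ ?_)) (n1 _ ?_)).trans (ht.trans ?_)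
  · exact Finset.sum_nonneg fun _ _ => abs_nonneg _
  · exact Finset.sum_nonneg fun _ _ => abs_nonneg _
  · linarith

lemma tendsto_two_rpow_neg {δ : ℝ} (hδ : 0 < δ) :
    Tendsto (fun n : ℕ => (2 : ℝ) ^ (-(n * δ))) atTop (𝓝 0) := by
  have h : ∀ n : ℕ, (2 : ℝ) ^ (-(n * δ)) = ((2 : ℝ) ^ (-δ)) ^ n := fun n => by
    rw [← Real.rpow_natCast, ← Real.rpow_mul (by norm_num)]
    ring_nf
  simp only [h]
  exact tendsto_pow_atTop_nhds_zero_of_lt_one (by positivity)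
    (Real.rpow_lt_one_of_one_lt_of_neg (by norm_num) (by linarith))

/-- Achievability from `2 ^ (n r)` values of local randomness. -/
lemma achievable_of_lt (hν : ν ∈ ch.inputLaws)
    (hE : marginal (ch.letterLaw ν) (fun t => t.2.2.2) = ch.wardenIdle) {R RK r : ℝ}
    (hR : 0 ≤ R) (hRK : 0 ≤ RK) (hr : 0 ≤ r)
    (h1 : R + r < infoAB_S (ch.letterLaw ν) ∨ R + r = 0)
    (h2 : RK < R + r + stateEntropy (ch.letterLaw ν) -
      (entropy (ch.letterLaw ν) (fun t => t.2.2.2) -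
        condEntropy (ch.letterLaw ν) (fun t => t.2.2.2) (fun t => (t.2.1, t.1))))
    (h3 : RK < r + stateEntropy (ch.letterLaw ν)) : ch.Achievable R RK := by
  obtain ⟨μ, hμ, hνμ⟩ := StateChannel.exists_conditional hν
  set H := stateEntropy (ch.letterLaw ν) with hH
  set D := -stateEntropy (ch.letterLaw ν) +
      (entropy (ch.letterLaw ν) (fun t => t.2.2.2) -
      condEntropy (ch.letterLaw ν) (fun t => t.2.2.2) (fun t => (t.2.1, t.1))) with hD
  set I := infoAB_S (ch.letterLaw ν) with hI
  -- Covering spends δ on the deviation, δ on γ = 2^{−nδ} and δ on rounding M down, once nδ ≥ 1.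
  -- Uniformity spends the first two, and decoding spends δ on the deviation and δ to make the union
  -- bound vanish.
  obtain ⟨δ, hδ, hδ1, hδ2, hδ3⟩ : ∃ δ : ℝ, 0 < δ ∧ 3 * δ ≤ R + r - RK - D ∧
      2 * δ ≤ r + H - RK ∧ (R + r + 2 * δ ≤ I ∨ R + r = 0) := by
    have hx : 0 < R + r - RK - D := by linarith
    have hy : 0 < r + H - RK := by linarith
    rcases h1 with h1 | h1
    · refine ⟨min ((R + r - RK - D) / 3) (min ((r + H - RK) / 2) ((I - (R + r)) / 2)), ?_, ?_, ?_,
        Or.inl ?_⟩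
      · exact lt_min (by linarith) (lt_min (by linarith) (by linarith))
      · linarith [min_le_left ((R + r - RK - D) / 3) (min ((r + H - RK) / 2) ((I - (R + r)) / 2))]
      · linarith [(min_le_right ((R + r - RK - D) / 3)
          (min ((r + H - RK) / 2) ((I - (R + r)) / 2))).trans (min_le_left _ _)]
      · linarith [(min_le_right ((R + r - RK - D) / 3)
          (min ((r + H - RK) / 2) ((I - (R + r)) / 2))).trans (min_le_right _ _)]
    · refine ⟨min ((R + r - RK - D) / 3) ((r + H - RK) / 2), ?_, ?_, ?_, Or.inr h1⟩
      · exact lt_min (by linarith) (by linarith)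
      · linarith [min_le_left ((R + r - RK - D) / 3) ((r + H - RK) / 2)]
      · linarith [min_le_right ((R + r - RK - D) / 3) ((r + H - RK) / 2)]
  set M : ℕ → ℕ := fun n => ⌊(2 : ℝ) ^ ((n : ℝ) * R)⌋₊ with hMdef
  set K : ℕ → ℕ := fun n => ⌊(2 : ℝ) ^ ((n : ℝ) * RK)⌋₊ with hKdef
  -- Rounding up loses nothing in covering, costs at most a factor 2 in decoding, and gives exactly
  -- 1 when r = 0.
  set L : ℕ → ℕ := fun n => ⌈(2 : ℝ) ^ ((n : ℝ) * r)⌉₊ with hLdef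
  have hM : ∀ n, 0 < M n := fun n => floor_rpow_pos (by positivity)
  have hK : ∀ n, 0 < K n := fun n => floor_rpow_pos (by positivity)
  have hL : ∀ n, 0 < L n := fun n => Nat.ceil_pos.2 (by positivity)
  have hM' : ∀ n, (0 : ℝ) < M n := fun n => by exact_mod_cast hM n
  have hL' : ∀ n, (0 : ℝ) < L n := fun n => by exact_mod_cast hL n
  have hlL : ∀ n : ℕ, (n : ℝ) * r ≤ Real.logb 2 (L n) := fun n => by
    rw [Real.le_logb_iff_rpow_le (by norm_num) (hL' n)]
    exact Nat.le_ceil _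
  have hlM : ∀ n : ℕ, (n : ℝ) * R - 1 ≤ Real.logb 2 (M n) := fun n =>
    logb_floor_rpow_ge (by positivity)
  have hlK : ∀ n : ℕ, Real.logb 2 (K n) ≤ (n : ℝ) * RK := fun n =>
    logb_floor_rpow_le (by positivity)
  set ε : ℕ → ℝ := fun n =>
    deviation (ch.letterLaw ν) (fun t => Real.logb 2 (ch.outB t.2.1 t.1 t.2.2.1) -
        Real.logb 2 (ch.outGivenState μ t.1 t.2.2.1)) δ n +
      ((M n : ℝ) * L n - 1) / (2 : ℝ) ^ ((n : ℝ) * (I - δ)) +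
      2 * √((2 : ℝ) ^ (-(n * δ))) +
      2 * deviation (ch.letterLaw ν) (fun t => Real.logb 2 (ch.stateLaw t.1) +
        Real.logb 2 (ch.outE t.2.1 t.1 t.2.2.2) - Real.logb 2 (ch.wardenIdle t.2.2.2)) δ n +
      2 * deviation (ch.letterLaw ν) (fun t => Real.logb 2 (ch.stateLaw t.1)) δ n with hε
  have hsize : ∀ n : ℕ, 0 ≤ ((M n : ℝ) * L n - 1) / (2 : ℝ) ^ ((n : ℝ) * (I - δ)) ∧
      ((M n : ℝ) * L n - 1) / (2 : ℝ) ^ ((n : ℝ) * (I - δ)) ≤ 2 * (2 : ℝ) ^ (-(n * δ)) := by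
    intro n
    have hone : (1 : ℝ) ≤ (M n : ℝ) * L n := by
      exact_mod_cast Nat.one_le_iff_ne_zero.2 (Nat.mul_pos (hM n) (hL n)).ne'
    refine ⟨div_nonneg (by linarith) (by positivity), ?_⟩
    rcases hδ3 with h | h
    · rw [div_le_iff₀ (by positivity), mul_assoc, ← Real.rpow_add (by norm_num)]
      have e1 : (M n : ℝ) ≤ (2 : ℝ) ^ ((n : ℝ) * R) := Nat.floor_le (by positivity)
      have e2 : (L n : ℝ) ≤ 2 * (2 : ℝ) ^ ((n : ℝ) * r) := by
        have a1 := Nat.ceil_lt_add_one (a := (2 : ℝ) ^ ((n : ℝ) * r)) (by positivity)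
        have a2 : (1 : ℝ) ≤ (2 : ℝ) ^ ((n : ℝ) * r) :=
          Real.one_le_rpow (by norm_num) (by positivity)
        linarith
      have e3 := mul_le_mul e1 e2 (hL' n).le (by positivity)
      have e4 : (2 : ℝ) ^ ((n : ℝ) * R) * (2 * (2 : ℝ) ^ ((n : ℝ) * r)) =
          2 * (2 : ℝ) ^ ((n : ℝ) * (R + r)) := by
        rw [mul_add, Real.rpow_add (by norm_num)]
        ring
      have e5 : (2 : ℝ) ^ ((n : ℝ) * (R + r)) ≤ (2 : ℝ) ^ (-((n : ℝ) * δ) + n * (I - δ)) := by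
        apply Real.rpow_le_rpow_of_exponent_le (by norm_num)
        have := mul_le_mul_of_nonneg_left h (Nat.cast_nonneg (α := ℝ) n)
        linarith
      linarith
    -- One message and one value of local randomness: there are no rivals, so the union bound is 0
    -- and no information rate is needed.
    · have hR0 : R = 0 := by linarith
      have hr0 : r = 0 := by linarith
      have : ((M n : ℝ) * L n - 1) = 0 := by
        simp [hMdef, hLdef, hR0, hr0]
      rw [this, zero_div]
      positivity
  have hεlim : Tendsto ε atTop (𝓝 0) := by
    have l1 := tendsto_letterLaw_deviation (ch := ch) hν (fun t =>
      Real.logb 2 (ch.outB t.2.1 t.1 t.2.2.1) -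
        Real.logb 2 (ch.outGivenState μ t.1 t.2.2.1)) hδ
    have l2 := tendsto_letterLaw_deviation (ch := ch) hν (fun t => Real.logb 2 (ch.stateLaw t.1) +
        Real.logb 2 (ch.outE t.2.1 t.1 t.2.2.2) - Real.logb 2 (ch.wardenIdle t.2.2.2)) hδ
    have l3 := tendsto_letterLaw_deviation (ch := ch) hν
      (fun t => Real.logb 2 (ch.stateLaw t.1)) hδ
    have l4 := tendsto_two_rpow_neg hδ
    have l5 : Tendsto (fun n : ℕ => ((M n : ℝ) * L n - 1) / (2 : ℝ) ^ ((n : ℝ) * (I - δ))) atTop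
        (𝓝 0) := by
      refine squeeze_zero (fun n => (hsize n).1) (fun n => (hsize n).2) ?_
      simpa using l4.const_mul 2
    have l6 : Tendsto (fun n : ℕ => √((2 : ℝ) ^ (-(n * δ)))) atTop (𝓝 0) := by
      simpa using l4.sqrt
    simpa using (((l1.add l5).add (l6.const_mul 2)).add (l2.const_mul 2)).add (l3.const_mul 2)
  have hcode : ∀ n : ℕ, ∃ c : Code S A B n (M n) (K n), 1 ≤ n * δ →
      c.errorProb ch + c.covertKeyDist ch + c.messageKeyDist ch ≤ ε n := by
    intro n
    -- A code is due at every block length; at the finitely many small ones any code will do.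
    by_cases hn : 1 ≤ n * δ
    · obtain ⟨c, hc⟩ := exists_code_le hμ hν hνμ hE (hM n) (hK n) (hL n) (δ := δ) hD
        (by
          rw [Real.logb_mul (hM' n).ne' (hL' n).ne']
          have := mul_le_mul_of_nonneg_left hδ1 (Nat.cast_nonneg (α := ℝ) n)
          linarith [hlM n, hlL n, hlK n])
        (by
          have := mul_le_mul_of_nonneg_left hδ2 (Nat.cast_nonneg (α := ℝ) n)
          linarith [hlL n, hlK n])
      exact ⟨c, fun _ => hc⟩
    · obtain ⟨a₀⟩ : Nonempty A := by
        by_contra h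
        rw [not_nonempty_iff] at h
        simpa using ch.innocent_mem.2
      exact ⟨codebookCode one_pos (fun _ => (fun _ => a₀, ⟨0, hK n⟩))
        (fun _ _ => (⟨0, hM n⟩, ⟨0, hK n⟩)), fun h => absurd h hn⟩
  choose c hc using hcode
  have hev : ∀ᶠ n : ℕ in atTop, 1 ≤ n * δ := by
    have := tendsto_natCast_atTop_atTop (R := ℝ) |>.atTop_mul_const hδ
    exact this.eventually_ge_atTop 1
  have hn1 : ∀ n, 0 ≤ (c n).errorProb ch := fun n => (c n).errorProb_nonneg ch
  have hn2 : ∀ n, 0 ≤ (c n).covertKeyDist ch := fun n => tvDist_nonneg _ _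
  have hn3 : ∀ n, 0 ≤ (c n).messageKeyDist ch := fun n => tvDist_nonneg _ _
  refine ⟨c, ?_, ?_, ?_⟩
  · refine squeeze_zero' (Eventually.of_forall hn1) ?_ hεlim
    filter_upwards [hev] with n hn
    linarith [hc n hn, hn2 n, hn3 n]
  · refine squeeze_zero' (Eventually.of_forall hn2) ?_ hεlim
    filter_upwards [hev] with n hn
    linarith [hc n hn, hn1 n, hn3 n]
  · refine squeeze_zero' (Eventually.of_forall hn3) ?_ hεlim
    filter_upwards [hev] with n hn
    linarith [hc n hn, hn1 n, hn2 n]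

end achievability

/-! ### The boundary of the region. -/

section region

variable {S A B E : Type*} [Fintype S] [Fintype A] [Fintype B] [Fintype E]
  {ch : StateChannel S A B E}

section idle

variable {n M K : ℕ}

/-- The code that sends innocent symbols, and chooses the key and the estimates at random. -/
noncomputable def StateChannel.idleCode (ch : StateChannel S A B E) (n : ℕ) (hM : 0 < M)
    (hK : 0 < K) : Code S A B n M K where
  enc _ _ x := (∏ i, ch.innocent (x.1 i)) * (1 / (K : ℝ))
  enc_mem _ _ := by
    have hK' : (K : ℝ) ≠ 0 := by exact_mod_cast hK.ne'
    refine ⟨fun x => mul_nonneg (Finset.prod_nonneg fun _ _ => ch.innocent_mem.1 _)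
      (by positivity), ?_⟩
    simp only [Fintype.sum_prod_type, Finset.sum_const, Finset.card_univ, Fintype.card_fin,
      nsmul_eq_mul, mul_left_comm (K : ℝ), mul_one_div_cancel hK', mul_one]
    exact (prod_mem_stdSimplex fun _ => ch.innocent_mem).2
  dec _ _ _ := 1 / ((M : ℝ) * K)
  dec_mem _ _ := by
    have hK' : (K : ℝ) ≠ 0 := by exact_mod_cast hK.ne'
    have hM' : (M : ℝ) ≠ 0 := by exact_mod_cast hM.ne'
    refine ⟨fun _ => by positivity, ?_⟩
    simp only [Finset.sum_const, Finset.card_univ, Fintype.card_prod, Fintype.card_fin,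
      nsmul_eq_mul, Nat.cast_mul]
    field_simp

variable (hM : 0 < M) (hK : 0 < K)

lemma errorProb_idleCode (h : M = 1) (h' : K = 1) : (ch.idleCode n hM hK).errorProb ch = 0 := by
  subst h h'
  rw [Code.errorProb_eq]
  simp [StateChannel.idleCode]

/-- Inputs are i.i.d. innocent symbols independent of the states, so Eⁿ has law exactly Q₀ⁿ, and the
key is drawn separately. -/
lemma covertKeyDist_idleCode : (ch.idleCode n hM hK).covertKeyDist ch = 0 := by
  have hM' : (M : ℝ) ≠ 0 := by exact_mod_cast hM.ne'
  rw [Code.covertKeyDist_eq]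
  have : marginal ((ch.idleCode n hM hK).outputLaw ch) (fun ω => (ω.1.2.2.2, ω.2.2)) =
      fun x : Fin K × (Fin n → E) => (1 / (K : ℝ)) * ∏ i, ch.wardenIdle (x.2 i) := by
    funext ⟨k, e⟩
    rw [marginal_eq_sum_of_equiv (κ := Fin M × (Fin n → S) × (Fin n → A) × (Fin n → B))
      (e := ⟨fun y => ((y.2.1, y.2.2.1, y.2.2.2.1, y.1.1), y.2.2.2.2, y.1.2),
        fun ω => ((ω.1.2.2.2, ω.2.2), ω.1.1, ω.1.2.1, ω.1.2.2.1, ω.2.1), fun _ => rfl,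
        fun _ => rfl⟩) (h := fun _ _ => rfl)]
    have inner : ∀ s : Fin n → S, ∑ a : Fin n → A, ∑ b : Fin n → B,
        ∏ i, ch.stateLaw (s i) * ch.innocent (a i) * ch.trans (a i) (s i) (b i, e i) =
        ∏ i, ∑ a, ∑ b, ch.stateLaw (s i) * ch.innocent a * ch.trans a (s i) (b, e i) := fun s =>
      sum_prod_pi_pair (fun i a b => ch.stateLaw (s i) * ch.innocent a * ch.trans a (s i) (b, e i))
    have key : ∑ s : Fin n → S, ∑ a : Fin n → A, ∑ b : Fin n → B,
        ∏ i, ch.stateLaw (s i) * ch.innocent (a i) * ch.trans (a i) (s i) (b i, e i) =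
        ∏ i, ch.wardenIdle (e i) := by
      simp only [inner]
      exact sum_prod_pi (fun i s => ∑ a, ∑ b, ch.stateLaw s * ch.innocent a * ch.trans a s (b, e i))
    simp only [← key, Fintype.sum_prod_type, Equiv.coe_fn_mk, Code.outputLaw, Code.inputLaw,
      StateChannel.blockLaw, StateChannel.idleCode, Finset.sum_const, Finset.card_univ,
      Fintype.card_fin, nsmul_eq_mul, Finset.mul_sum, Finset.prod_mul_distrib]
    refine Finset.sum_congr rfl fun s _ => Finset.sum_congr rfl fun a _ =>
      Finset.sum_congr rfl fun b _ => ?_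
    field_simp
  rw [this]
  simp [tvDist]

lemma messageKeyDist_idleCode : (ch.idleCode n hM hK).messageKeyDist ch = 0 := by
  rw [Code.messageKeyDist_eq]
  have : marginal ((ch.idleCode n hM hK).outputLaw ch) (fun ω => (ω.1.1, ω.1.2.2.2)) =
      fun _ : Fin M × Fin K => 1 / ((M : ℝ) * (K : ℝ)) := by
    funext ⟨m, k⟩
    rw [marginal_eq_sum_of_equiv (κ := (Fin n → S) × (Fin n → A) × (Fin n → B) × (Fin n → E))
      (e := ⟨fun y => ((y.1.1, y.2.1, y.2.2.1, y.1.2), y.2.2.2.1, y.2.2.2.2),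
        fun ω => ((ω.1.1, ω.1.2.2.2), ω.1.2.1, ω.1.2.2.1, ω.2.1, ω.2.2), fun _ => rfl,
        fun _ => rfl⟩) (h := fun _ _ => rfl)]
    simp only [Fintype.sum_prod_type, Equiv.coe_fn_mk, Code.outputLaw, Code.inputLaw,
      StateChannel.blockLaw, StateChannel.idleCode, ← Finset.mul_sum, ch.sum_prod_trans, mul_one,
      ← Finset.sum_mul, (prod_mem_stdSimplex fun _ => ch.innocent_mem).2,
      (prod_mem_stdSimplex fun _ => ch.stateLaw_mem).2, one_mul]
    rw [one_div_mul_one_div]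
  rw [this]
  simp [tvDist]

/-- With one message and one key nothing can go wrong. This covers the case where no admissible law
has positive secret rate and random coding has no slack. -/
lemma achievable_zero : ch.Achievable 0 0 := by
  have h : ∀ n : ℕ, ⌊(2 : ℝ) ^ ((n : ℝ) * 0)⌋₊ = 1 := fun n => by simp
  have h0 : ∀ n : ℕ, 0 < ⌊(2 : ℝ) ^ ((n : ℝ) * 0)⌋₊ := fun n => by rw [h]; exact one_pos
  refine ⟨fun n => ch.idleCode n (h0 n) (h0 n), ?_, ?_, ?_⟩
  · simp only [errorProb_idleCode _ _ (h _) (h _), tendsto_const_nhds]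
  · simp only [covertKeyDist_idleCode, tendsto_const_nhds]
  · simp only [messageKeyDist_idleCode, tendsto_const_nhds]

end idle

section mixture

variable {ν ν' : S × A → ℝ} {t : ℝ}

lemma mixture_mem (hν : ν ∈ ch.inputLaws) (hν' : ν' ∈ ch.inputLaws) (ht0 : 0 < t) (ht1 : t < 1) :
    (fun x => (1 - t) * ν x + t * ν' x) ∈ ch.inputLaws := by
  refine ⟨fun x => add_nonneg (mul_nonneg (by linarith) (hν.1 x)) (mul_nonneg ht0.le (hν'.1 x)),
    fun s => ?_⟩
  rw [Finset.sum_add_distrib, ← Finset.mul_sum, ← Finset.mul_sum, hν.2, hν'.2]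
  ring

lemma letterLaw_mixture : ch.letterLaw (fun x => (1 - t) * ν x + t * ν' x) =
    fun ω => (1 - t) * ch.letterLaw ν ω + t * ch.letterLaw ν' ω := by
  funext ω
  simp only [StateChannel.letterLaw]
  ring

lemma marginal_letterLaw_mixture
    (hE : marginal (ch.letterLaw ν) (fun t => t.2.2.2) = ch.wardenIdle)
    (hE' : marginal (ch.letterLaw ν') (fun t => t.2.2.2) = ch.wardenIdle) :
    marginal (ch.letterLaw fun x => (1 - t) * ν x + t * ν' x) (fun t => t.2.2.2) =
      ch.wardenIdle := by
  funext e
  have h := congrFun hE e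
  have h' := congrFun hE' e
  rw [ch.marginal_letterLaw_E] at h h' ⊢
  simp only [add_mul, Finset.sum_add_distrib, mul_assoc, ← Finset.mul_sum]
  rw [h, h']
  ring

lemma sum_mixture_mul {Ω : Type*} [Fintype Ω] (p q g : Ω → ℝ) :
    ∑ ω, ((1 - t) * p ω + t * q ω) * g ω = (1 - t) * ∑ ω, p ω * g ω + t * ∑ ω, q ω * g ω := by
  simp only [add_mul, Finset.sum_add_distrib, mul_assoc, ← Finset.mul_sum]

variable (hν : ν ∈ ch.inputLaws) (hν' : ν' ∈ ch.inputLaws) (ht0 : 0 < t) (ht1 : t < 1)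

include hν hν' ht0 ht1

/-- H(B|S) is concave in the law and H(B|A,S) is linear in ν. -/
lemma infoAB_S_concave : (1 - t) * infoAB_S (ch.letterLaw ν) + t * infoAB_S (ch.letterLaw ν') ≤
    infoAB_S (ch.letterLaw fun x => (1 - t) * ν x + t * ν' x) := by
  unfold infoAB_S
  rw [ch.condEntropy_letterLaw_B hν, ch.condEntropy_letterLaw_B hν',
    ch.condEntropy_letterLaw_B (mixture_mem hν hν' ht0 ht1), letterLaw_mixture, sum_mixture_mul]
  linarith [condEntropy_concave (ch.letterLaw_nonneg hν) (ch.letterLaw_nonneg hν') ht0 ht1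
    (fun t => t.2.2.1) (fun t => t.1)]

lemma secretInfo_concave :
    (1 - t) * secretInfo (ch.letterLaw ν) + t * secretInfo (ch.letterLaw ν') ≤
    secretInfo (ch.letterLaw fun x => (1 - t) * ν x + t * ν' x) := by
  unfold secretInfo
  rw [ch.condEntropy_letterLaw_B_E hν, ch.condEntropy_letterLaw_B_E hν',
    ch.condEntropy_letterLaw_B_E (mixture_mem hν hν' ht0 ht1), letterLaw_mixture, sum_mixture_mul]
  linarith [condEntropy_concave (ch.letterLaw_nonneg hν) (ch.letterLaw_nonneg hν') ht0 ht1
    (fun t => t.2.2.1) (fun t => (t.2.2.2, t.1)), condEntropy_concave (ch.letterLaw_nonneg hν)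
    (ch.letterLaw_nonneg hν') ht0 ht1 (fun t => t.1) (fun t => t.2.2.2)]

omit ht0 ht1 in
lemma stateEntropy_congr :
    stateEntropy (ch.letterLaw ν) = stateEntropy (ch.letterLaw ν') := by
  unfold stateEntropy entropy
  simp only [ch.marginal_letterLaw_S hν, ch.marginal_letterLaw_S hν']

end mixture

lemma infoAB_S_nonneg {p : S × A × B × E → ℝ} (hp : ∀ t, 0 ≤ p t) : 0 ≤ infoAB_S p :=
  sub_nonneg.2 (condEntropy_le_comp hp _ (fun t => (t.2.1, t.1)) Prod.snd)

/-- This is I(A,S;E) ≥ 0. -/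
lemma leakage_nonneg {ν : S × A → ℝ} (hν : ν ∈ ch.inputLaws) :
    0 ≤ entropy (ch.letterLaw ν) (fun t => t.2.2.2) -
      condEntropy (ch.letterLaw ν) (fun t => t.2.2.2) (fun t => (t.2.1, t.1)) := by
  rw [entropy_eq_condEntropy_unit (ch.letterLaw_nonneg hν) (ch.sum_letterLaw hν)]
  exact sub_nonneg.2 (condEntropy_le_comp (ch.letterLaw_nonneg hν) _
    (fun t => (t.2.1, t.1)) (fun _ => ()))

/-- Achievability inside the region of an input law. -/
lemma achievable_of_strict (hdeg : ch.IsDegraded) {ν : S × A → ℝ} (hν : ν ∈ ch.inputLaws)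
    (hE : marginal (ch.letterLaw ν) (fun t => t.2.2.2) = ch.wardenIdle) {R RK : ℝ}
    (hR : 0 ≤ R) (hRK : 0 ≤ RK) (h1 : R < infoAB_S (ch.letterLaw ν) ∨ R = 0)
    (h2 : RK < secretInfo (ch.letterLaw ν))
    (h3 : R + RK < infoAB_S (ch.letterLaw ν) + stateEntropy (ch.letterLaw ν)) :
    ch.Achievable R RK := by
  have hI := infoAB_S_nonneg (ch.letterLaw_nonneg hν)
  rw [hdeg.secretInfo_eq hν] at h2
  set I := infoAB_S (ch.letterLaw ν)
  set H := stateEntropy (ch.letterLaw ν)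
  set Λ := entropy (ch.letterLaw ν) (fun t => t.2.2.2) -
      condEntropy (ch.letterLaw ν) (fun t => t.2.2.2) (fun t => (t.2.1, t.1))
  by_cases hRI : R < I
  -- The local randomness fills what the message leaves of the receiver's information: r = I − R −
  -- δ.
  · obtain ⟨δ, hδ, hδ'⟩ := exists_between (a₁ := 0)
      (a₂ := min (I - R) (min (I + H - Λ - RK) (I + H - R - RK)))
      (lt_min (by linarith) (lt_min (by linarith) (by linarith)))
    rw [lt_min_iff, lt_min_iff] at hδ'
    exact achievable_of_lt hν hE hR hRK (r := I - R - δ) (by linarith [hδ'.1])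
      (Or.inl (by linarith)) (by linarith [hδ'.2.1]) (by linarith [hδ'.2.2])
  -- Here I = 0: the key comes from the state alone, without local randomness.
  · have hR0 : R = 0 := h1.resolve_left hRI
    have hI0 : I = 0 := by linarith
    exact achievable_of_lt hν hE hR hRK le_rfl (Or.inr (by linarith)) (by linarith) (by linarith)

/-- Concavity makes a mixture of ν with a little of ν' have strictly positive room for the key;
shrinking the rates creates the remaining slack, and the shrunk pairs tend to `r`. -/
lemma mem_capacityRegion_of_supports (hdeg : ch.IsDegraded) {ν ν' : S × A → ℝ} {r : ℝ × ℝ}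
    (hr1 : 0 ≤ r.1) (hr2 : 0 ≤ r.2) (h : ch.Supports ν r.1 r.2) (hν' : ν' ∈ ch.inputLaws)
    (hE' : marginal (ch.letterLaw ν') (fun t => t.2.2.2) = ch.wardenIdle)
    (hpos : 0 < secretInfo (ch.letterLaw ν')) : r ∈ ch.capacityRegion := by
  obtain ⟨hν, hE, hR, hRK, hsum⟩ := h
  -- One factor 1 − t matches the weight of ν in the mixture, the other makes positive rates
  -- strictly smaller. The 2 in the denominator keeps t < 1.
  have hlim : Tendsto (fun j : ℕ => (1 - 1 / ((j : ℝ) + 2)) ^ 2 • r) atTop (𝓝 r) := by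
    have h1 : Tendsto (fun j : ℕ => 1 / ((j : ℝ) + 2)) atTop (𝓝 0) := by
      have := (tendsto_add_atTop_iff_nat 2).2 (tendsto_const_div_atTop_nhds_zero_nat (1 : ℝ))
      simpa using this
    simpa using ((h1.const_sub 1).pow 2).smul_const r
  refine mem_closure_of_tendsto hlim (Eventually.of_forall fun j => ?_)
  obtain ⟨t, ht⟩ : ∃ t : ℝ, t = 1 / ((j : ℝ) + 2) := ⟨_, rfl⟩
  rw [← ht]
  have ht0 : 0 < t := by rw [ht]; positivity
  have ht1 : t < 1 := by
    rw [ht, div_lt_one (by positivity)]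
    linarith [Nat.cast_nonneg (α := ℝ) j]
  have ht' : 0 < 1 - t := by linarith
  have hmix := mixture_mem hν hν' ht0 ht1
  have hI := infoAB_S_concave hν hν' ht0 ht1
  have hs := secretInfo_concave hν hν' ht0 ht1
  have hI' := infoAB_S_nonneg (ch.letterLaw_nonneg hν')
  have hHe := stateEntropy_congr hν hmix
  have hHn : 0 ≤ stateEntropy (ch.letterLaw ν) :=
    entropy_nonneg (ch.letterLaw_nonneg hν) (ch.sum_letterLaw hν) _
  have hsec := hdeg.secretInfo_eq hmix
  have hleak := leakage_nonneg hmix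
  have shrink : ∀ x : ℝ, 0 < x → (1 - t) ^ 2 * x < (1 - t) * x := fun x hx => by
    nlinarith [mul_pos (mul_pos ht' ht0) hx]
  have shrink' : ∀ x : ℝ, 0 ≤ x → (1 - t) ^ 2 * x ≤ (1 - t) * x := fun x hx => by
    nlinarith [mul_nonneg (mul_pos ht' ht0).le hx]
  have htI' := mul_nonneg ht0.le hI'
  have htS' := mul_pos ht0 hpos
  have hR' := mul_le_mul_of_nonneg_left hR ht'.le
  have hRK' := mul_le_mul_of_nonneg_left hRK ht'.le
  have hsum' := mul_le_mul_of_nonneg_left hsum ht'.le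
  have htH := mul_nonneg ht0.le hHn
  have h2 : (1 - t) ^ 2 * r.2 <
      secretInfo (ch.letterLaw fun x => (1 - t) * ν x + t * ν' x) := by
    linarith [shrink' _ hr2]
  refine ⟨mul_nonneg (by positivity) hr1, mul_nonneg (by positivity) hr2,
    achievable_of_strict hdeg hmix (marginal_letterLaw_mixture hE hE')
      (R := (1 - t) ^ 2 * r.1) (RK := (1 - t) ^ 2 * r.2)
      (mul_nonneg (by positivity) hr1) (mul_nonneg (by positivity) hr2) ?_ h2 ?_⟩
  · rcases hr1.eq_or_lt with h0 | h0
    · exact Or.inr (by rw [← h0, mul_zero])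
    · exact Or.inl (by linarith [shrink _ h0])
  -- At message rate 0 shrinking gives no slack in R, but the sum bound then follows from the strict
  -- key bound, since I(A,S;E) ≥ 0.
  · rcases hr1.eq_or_lt with h0 | h0
    · rw [← h0, mul_zero]
      linarith
    · linarith [shrink _ h0, shrink' _ hr2]

end region

end CovertKey

/-! ### The capacity region. -/

theorem theorem4 {S A B E : Type*} [Fintype S] [Fintype A] [Fintype B] [Fintype E]
    (ch : CovertKey.StateChannel S A B E) (hdeg : ch.IsDegraded)
    (hkey : (∃ (k : ℕ) (P : S × Fin k × A × B × E → ℝ),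
        ch.IsAdmissible P ∧ 0 < CovertKey.infoUB_S P) →
      ∃ (k : ℕ) (P : S × Fin k × A × B × E → ℝ),
        ch.IsAdmissible P ∧ 0 < CovertKey.infoUB_ES P + CovertKey.entropyS_E P) :
    ch.capacityRegion =
      {r : ℝ × ℝ | 0 ≤ r.1 ∧ 0 ≤ r.2 ∧
        ∃ (k : ℕ) (P : S × Fin k × A × B × E → ℝ), ch.IsAdmissible P ∧
          r.1 ≤ CovertKey.infoUB_S P ∧
          r.2 ≤ CovertKey.infoUB_ES P + CovertKey.entropyS_E P ∧
          r.1 + r.2 ≤ CovertKey.infoUB_S P + CovertKey.entropyS P} := by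
  ext r
  constructor
  · intro hr
    obtain ⟨u, hu, hlim⟩ := mem_closure_iff_seq_limit.1 hr
    have h1 := (continuous_fst.tendsto r).comp hlim
    have h2 := (continuous_snd.tendsto r).comp hlim
    choose ν hν using fun j => (hu j).2.2.exists_supports (hu j).1 (hu j).2.1
    -- A point of the closure is a limit of supported pairs, so compactness shows that it is
    -- supported as well.
    obtain ⟨ν', hν', hE, a1, a2, a3⟩ := CovertKey.StateChannel.exists_supports_of_tendsto
      (ν := ν) (fun j => (hν j).1) (fun e => by simp only [(hν _).2.1, tendsto_const_nhds])
      h1 h2 (h1.add h2) (fun j => (hν j).2.2.1) (fun j => (hν j).2.2.2.1) (fun j => (hν j).2.2.2.2)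
    obtain ⟨k, P, hP, b1, b2, b3⟩ := CovertKey.StateChannel.exists_isAdmissible hν' hE
    exact ⟨ge_of_tendsto' h1 fun j => (hu j).1, ge_of_tendsto' h2 fun j => (hu j).2.1, k, P, hP,
      by rwa [b1], by rwa [b2], by rwa [b1, b3]⟩
  · rintro ⟨hr1, hr2, k, P, hP, h1, h2, h3⟩
    by_cases hs : ∃ (k : ℕ) (P : S × Fin k × A × B × E → ℝ),
        ch.IsAdmissible P ∧ 0 < CovertKey.infoUB_ES P + CovertKey.entropyS_E P
    · obtain ⟨k', P', hP', hpos⟩ := hs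
      obtain ⟨ν, hν, hE, a1, a2, a3⟩ := hP.exists_inputLaw
      obtain ⟨ν', hν', hE', _, a2', _⟩ := hP'.exists_inputLaw
      exact CovertKey.mem_capacityRegion_of_supports hdeg hr1 hr2
        ⟨hν, hE, h1.trans a1, h2.trans a2, by linarith⟩ hν' hE' (hpos.trans_le a2')
    -- Without any positive secret rate, `hkey` excludes a positive message rate too, and only the
    -- origin is left.
    · have hz1 : ¬ 0 < CovertKey.infoUB_S P := fun h => hs (hkey ⟨k, P, hP, h⟩)
      have hz2 : ¬ 0 < CovertKey.infoUB_ES P + CovertKey.entropyS_E P := fun h => hs ⟨k, P, hP, h⟩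
      have : r = (0, 0) := Prod.ext (by linarith) (by linarith)
      rw [this]
      exact subset_closure ⟨le_rfl, le_rfl, CovertKey.achievable_zero⟩
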